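/- **Setting.** Let $\alpha\in(1,2)$, and let $\beta:\mathbb R\to[-1,1]$ be a Borel function. Let $Z_\alpha$ be an independently scattered strictly $\alpha$-stable random measure on $\mathbb R$, defined on a probability space $(\Omega,\mathcal F,\mathbb P)$, with Lebesgue measure as control measure and skewness intensity $\beta$; thus, for Borel sets $A$ of finite Lebesgue measure $|A|$, $$\mathbb E\,e^{i\theta Z_\alpha(A)}=\exp\Big(-|\theta|^\alpha\Big(|A|-i\,\mathrm{sgn}(\theta)\tan\tfrac{\pi\alpha}{2}\int_A\beta(s)\,ds\Big)\Big),\qquad \theta\in\mathbb R .$$ Let $H:\mathbb R\to[\underline H,\overline H]\subset(1/\alpha,1)$ be a (deterministic) continuous function. Let $\psi:\mathbb R\to\mathbb R$ be a compactly supported, three times continuously differentiable orthonormal mother wavelet (the functions $2^{j/2}\psi(2^j\cdot-k)$, $(j,k)\in\mathbb Z^2$, form an orthonormal basis of $L^2(\mathbb R)$) with $Q\ge 15$ vanishing moments, i.e. $\int t^m\psi(t)\,dt=0$ for $0\le m<Q$ and $\int t^Q\psi(t)\,dt\ne0$; for instance, a sufficiently regular Daubechies wavelet. Put $(x)_+^\kappa=x^\kappa$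 for $x>0$ and $(x)_+^\kappa=0$ for $x\le0$, and set $$\Psi(x,v)=\int_{\mathbb R}(s)_+^{v-1/\alpha}\,\psi(x-s)\,ds,\qquad \epsilon_{j,k}=2^{j/\alpha}\int_{\mathbb R}\psi(2^js-k)\,Z_\alpha(ds),$$ where the second integral is the stochastic integral of a function of $L^\alpha(\mathbb R)$ (the limit in probability of the integrals of simple functions converging to it in $L^\alpha(\mathbb R)$). Let $\Omega_0^*$ be the event, of probability $1$, of all $\omega$ such that for every $\eta>0$ there is a finite $C(\omega)$ with $$|\epsilon_{j,k}(\omega)|\le C(\omega)(1+|j|)^{1/\alpha+\eta}(1+|k|)^{1/\alpha}\log^{1/\alpha+\eta}(2+|k|)\quad\text{for all }(j,k)\in\mathbb Z^2 .$$ For $u\in\mathbb R$ and $v\in(1/\alpha,1)$ let $$X(u,v,\omega)=\sum_{(j,k)\in\mathbb Z^2}2^{-jv}\epsilon_{j,k}(\omega)\big(\Psi(2^ju-k,v)-\Psi(-k,v)\big)\quad\text{if }\omega\in\Omega_0^*,\qquad X(u,v,\omega)=0\quad\text{if }\omega\notin\Omega_0^* ;$$ this is the wavelet-series modification of the field $\int_{\mathbb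 R}\{(u-s)_+^{v-1/\alpha}-(-s)_+^{v-1/\alpha}\}\,Z_\alpha(ds)$. Linear multifractional stable motion (LMSM) with functional Hurst parameter $H$ is the process $Y(t)=X(t,H(t))$, $t\in\mathbb R$. For $f:\mathbb R\to\mathbb R$, $M_1<M_2$ and $t_0\in\mathbb R$ set, with values in $[0,+\infty]$ and the convention $0/0=0$, $$\rho_f^{\rm unif}([M_1,M_2])=\sup\Big\{\rho\ge0:\ \sup_{s',s''\in[M_1,M_2]}\frac{|f(s')-f(s'')|}{|s'-s''|^\rho}<\infty\Big\},\qquad \rho_f^{\rm unif}(t_0)=\sup_{M_1<t_0<M_2}\rho_f^{\rm unif}([M_1,M_2]);$$ the latter is the local (or uniform pointwise) Hölder exponent of $f$ at $t_0$. **Theorem.** There is an event $\Omega_4^*$ of probability $1$, not depending on $t_0$, such that for every $\omega\in\Omega_4^*$ the path $t\mapsto Y(t,\omega)$ is continuous on $\mathbb R$ and, for every $t_0\in\mathbb R$ with $\rho_H^{\rm unif}(t_0)>1/\alpha$, its local Hölder exponent at $t_0$ is $$\rho_{Y}^{\rm unif}(t_0,\omega)=H(t_0)-\frac1\alpha .$$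 -/

import Mathlib

open MeasureTheory ProbabilityTheory Filter Topology Set
open scoped ENNReal NNReal

/-- `(x)_+^κ`: it is `x ^ κ` for `x > 0` and `0` for `x ≤ 0` (for every real `κ`). -/
noncomputable def posPow (x κ : ℝ) : ℝ := if 0 < x then x ^ κ else 0

/-! ### Stable random measures and stochastic integrals -/

/-- `Z` is an independently scattered strictly `α`-stable random measure on `ℝ` (with `α ≠ 1`),
with Lebesgue measure as control measure and skewness intensity `β`. It is defined on the Borel
sets `A` of finite Lebesgue measure `|A|` (its values at other sets are irrelevant), and `Z A` has
the stable law `S_α(σ, b, 0)` with scale `σ = |A|^(1/α)` and skewness `b = |A|⁻¹ ∫_A β`, that is,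
`E exp(iθ Z(A)) = exp(-|θ|^α (|A| - i sgn(θ) tan(πα/2) ∫_A β))`. -/
structure IsStableRandomMeasure {Ω : Type*} [MeasurableSpace Ω] (P : Measure Ω)
    (α : ℝ) (β : ℝ → ℝ) (Z : Set ℝ → Ω → ℝ) : Prop where
  measurable : ∀ A : Set ℝ, MeasurableSet A → volume A < ∞ → Measurable (Z A)
  charFun_eq : ∀ A : Set ℝ, MeasurableSet A → volume A < ∞ → ∀ θ : ℝ,
    charFun (P.map (Z A)) θ =
      Complex.exp (-((|θ| ^ α : ℝ) : ℂ) *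
        (((volume A).toReal : ℂ) -
          Complex.I * ((Real.sign θ * Real.tan (Real.pi * α / 2) * ∫ s in A, β s : ℝ) : ℂ)))
  indep : ∀ (n : ℕ) (A : Fin n → Set ℝ),
    (∀ i, MeasurableSet (A i)) → (∀ i, volume (A i) < ∞) →
    Pairwise (fun i i' => Disjoint (A i) (A i')) →
    iIndepFun (fun i => Z (A i)) P
  /- The series of the `Z (A i)` converges almost surely as an ordered series; in general
  it does not converge absolutely. -/
  sigma_additive : ∀ A : ℕ → Set ℝ,
    (∀ i, MeasurableSet (A i)) → volume (⋃ i, A i) < ∞ →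
    Pairwise (fun i i' => Disjoint (A i) (A i')) →
    ∀ᵐ ω ∂P, Tendsto (fun n => ∑ i ∈ Finset.range n, Z (A i) ω) atTop (𝓝 (Z (⋃ i, A i) ω))

/-- The integral of a simple function `∑ c 1_{g = c}`: the random variable `∑ c Z({g = c})`. -/
noncomputable def simpleStableIntegral {Ω : Type*} (Z : Set ℝ → Ω → ℝ)
    (g : SimpleFunc ℝ ℝ) (ω : Ω) : ℝ :=
  ∑ c ∈ g.range, c * Z (g ⁻¹' {c}) ω

/-- The random variable `I` is a version of the stochastic integral `∫ f dZ`, `f ∈ L^α(ℝ)`: it is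
the limit in probability of the integrals of simple functions that converge to `f` in `L^α`. -/
def IsStableIntegral {Ω : Type*} [MeasurableSpace Ω] (P : Measure Ω) (α : ℝ)
    (Z : Set ℝ → Ω → ℝ) (f : ℝ → ℝ) (I : Ω → ℝ) : Prop :=
  MemLp f (ENNReal.ofReal α) volume ∧ Measurable I ∧
  ∀ g : ℕ → SimpleFunc ℝ ℝ,
    (∀ n, MemLp (g n) (ENNReal.ofReal α) volume) →
    Tendsto (fun n => eLpNorm (fun s => g n s - f s) (ENNReal.ofReal α) volume) atTop (𝓝 0) →
    TendstoInMeasure P (fun n => simpleStableIntegral Z (g n)) atTop I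

open Classical in
/-- The stochastic integral `∫ f dZ` (a version of it; it is unique up to almost sure equality). -/
noncomputable def stableIntegral {Ω : Type*} [MeasurableSpace Ω] (P : Measure Ω) (α : ℝ)
    (Z : Set ℝ → Ω → ℝ) (f : ℝ → ℝ) : Ω → ℝ :=
  if h : ∃ I : Ω → ℝ, IsStableIntegral P α Z f I then h.choose else 0

/-! ### The wavelet -/

/-- `ψ` is a `C³` compactly supported mother wavelet: the functions `2^(j/2) ψ(2^j t - k)` form an
orthonormal basis of `L²(ℝ)`, and the number `Q` of vanishing moments of `ψ` is at least `15`.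
The sufficiently regular wavelets of Daubechies are of this kind. -/
structure IsCompactMotherWavelet (ψ : ℝ → ℝ) : Prop where
  contDiff : ContDiff ℝ 3 ψ
  hasCompactSupport : HasCompactSupport ψ
  moments : ∃ Q : ℕ, 15 ≤ Q ∧ (∀ m < Q, ∫ t : ℝ, t ^ m * ψ t = 0) ∧ ∫ t : ℝ, t ^ Q * ψ t ≠ 0
  orthonormal : ∀ j k j' k' : ℤ,
    ∫ t : ℝ, ((2 : ℝ) ^ ((j : ℝ) / 2) * ψ ((2 : ℝ) ^ j * t - k)) *
      ((2 : ℝ) ^ ((j' : ℝ) / 2) * ψ ((2 : ℝ) ^ j' * t - k')) =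
      if j = j' ∧ k = k' then 1 else 0
  complete : ∀ f : ℝ → ℝ, MemLp f 2 volume →
    (∀ j k : ℤ, ∫ t : ℝ, f t * ((2 : ℝ) ^ ((j : ℝ) / 2) * ψ ((2 : ℝ) ^ j * t - k)) = 0) →
    f =ᵐ[volume] 0

/-- `Ψ(x, v) = ∫ (s)_+^(v - 1/α) ψ(x - s) ds`. -/
noncomputable def waveletPsi (α : ℝ) (ψ : ℝ → ℝ) (x v : ℝ) : ℝ :=
  ∫ s : ℝ, posPow s (v - 1 / α) * ψ (x - s)

/-! ### Linear multifractional stable motion -/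

/-- `ε_{j,k} = 2^(j/α) ∫ ψ(2^j s - k) Z(ds)`. -/
noncomputable def waveletCoeff {Ω : Type*} [MeasurableSpace Ω] (P : Measure Ω) (α : ℝ)
    (Z : Set ℝ → Ω → ℝ) (ψ : ℝ → ℝ) (j k : ℤ) (ω : Ω) : ℝ :=
  (2 : ℝ) ^ ((j : ℝ) / α) * stableIntegral P α Z (fun s => ψ ((2 : ℝ) ^ j * s - k)) ω

/-- The event (of probability one) on which the coefficients `ε_{j,k}` grow slowly: for every
`η > 0` there is a finite `C(ω)` such that, for all `j` and `k`,
`|ε_{j,k}(ω)| ≤ C(ω) (1 + |j|)^(1/α + η) (1 + |k|)^(1/α) log^(1/α + η) (2 + |k|)`. -/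
def slowGrowthEvent {Ω : Type*} [MeasurableSpace Ω] (P : Measure Ω) (α : ℝ)
    (Z : Set ℝ → Ω → ℝ) (ψ : ℝ → ℝ) : Set Ω :=
  {ω | ∀ η : ℝ, 0 < η → ∃ C : ℝ, ∀ j k : ℤ,
    |waveletCoeff P α Z ψ j k ω| ≤
      C * (1 + |(j : ℝ)|) ^ (1 / α + η) * (1 + |(k : ℝ)|) ^ (1 / α) *
        Real.log (2 + |(k : ℝ)|) ^ (1 / α + η)}

open Classical in
/-- The field `X(u, v) = ∑_{(j,k)} 2^(-jv) ε_{j,k} (Ψ(2^j u - k, v) - Ψ(-k, v))`, set to `0` off the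
event above. It is the modification, given by a random wavelet series, of the field of stochastic
integrals `∫ ((u - s)_+^(v - 1/α) - (-s)_+^(v - 1/α)) Z(ds)`. -/
noncomputable def stableField {Ω : Type*} [MeasurableSpace Ω] (P : Measure Ω) (α : ℝ)
    (Z : Set ℝ → Ω → ℝ) (ψ : ℝ → ℝ) (u v : ℝ) (ω : Ω) : ℝ :=
  if ω ∈ slowGrowthEvent P α Z ψ then
    ∑' p : ℤ × ℤ, (2 : ℝ) ^ (-((p.1 : ℝ) * v)) * waveletCoeff P α Z ψ p.1 p.2 ω *
      (waveletPsi α ψ ((2 : ℝ) ^ p.1 * u - p.2) v - waveletPsi α ψ (-(p.2 : ℝ)) v)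
  else 0

/-- Linear multifractional stable motion `Y(t) = X(t, H(t))` with functional Hurst parameter `H`. -/
noncomputable def lmsm {Ω : Type*} [MeasurableSpace Ω] (P : Measure Ω) (α : ℝ)
    (Z : Set ℝ → Ω → ℝ) (ψ H : ℝ → ℝ) (t : ℝ) (ω : Ω) : ℝ :=
  stableField P α Z ψ t (H t) ω

/-! ### Hölder exponents -/

/-- The uniform Hölder exponent of `f` over `[M₁, M₂]`: the supremum, possibly `∞`, of the `ρ ≥ 0`
for which `|f(s') - f(s'')| / |s' - s''|^ρ` is bounded on `[M₁, M₂]²`. -/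
noncomputable def uniformHolderExponent (f : ℝ → ℝ) (M₁ M₂ : ℝ) : ℝ≥0∞ :=
  ⨆ (ρ : ℝ≥0) (_ : ∃ C : ℝ≥0, HolderOnWith C ρ f (Icc M₁ M₂)), (ρ : ℝ≥0∞)

/-- The local (or uniform pointwise) Hölder exponent of `f` at `t₀`: the supremum of the uniform
Hölder exponents of `f` over the `[M₁, M₂]` with `M₁ < t₀ < M₂`. -/
noncomputable def localHolderExponent (f : ℝ → ℝ) (t₀ : ℝ) : ℝ≥0∞ :=
  ⨆ (M₁ : ℝ) (M₂ : ℝ) (_ : M₁ < t₀ ∧ t₀ < M₂), uniformHolderExponent f M₁ M₂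

/-!
# The local Hölder exponent of linear multifractional stable motion

On the slow growth event the field is a deterministic function of its wavelet coefficients
`ε j k`, and the theorem splits into a deterministic statement on the series `waveletSeries α ψ ε`,
for an array `ε` that is `SlowlyGrowing`, and two almost sure properties of the coefficients.

*Deterministic part.* With `κ = v - 1/α` the function `Ψ(·, v)` is the fractional integral
`fracInt κ ψ` of order `1 + κ` of the wavelet. Since the wavelet has many vanishing moments, its
increments in `x` and in `v` decay like `|x|⁻⁴` (`IsCompactMotherWavelet.exists_fracInt_bounds`). Summation over `(j, k)` shows that the series is
Hölder in `u` of every order less than `v - 1/α`, and Lipschitz in `v`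
(`exists_waveletSeries_bounds`, `exists_waveletSeries_sub_right_le`), which gives the continuity of
the paths. As `1/α > 1/2 > H(t₀) - 1/α`, a parameter `H` that is Hölder of order more than `1/α`
near `t₀` does not affect Hölder conditions of order near `H(t₀) - 1/α`, and the lower bound for
the exponent follows (`le_localHolderExponent_waveletSeries`).

For the upper bound the coefficients are recovered from the sum of the series. The convolution of
`(x)_+^κ` and `(x)_+^(-κ)` is a multiple of `(x)_+`, whose second derivative is a Dirac mass, so
that the functions `Ψ(2^j · - k, v)` have an explicit biorthogonal system, generated by the
fractional derivative `dualWavelet κ ψ` of the wavelet. Hence a Hölder condition of order `γ` at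
the point `t = k / 2^j` on the field frozen at `v = H(t)` bounds `|ε j k|` by a multiple of
`2^(j (H(t) - γ))` (`exists_abs_coeff_le`). If the local exponent at `t₀` were more than
`H(t₀) - 1/α`, then for some `δ > 0` all `ε j k` with `k / 2^j` near `t₀` would be at most of order
`2^(j (1/α - δ))` (`localHolderExponent_waveletSeries_le`).

*Probabilistic part.* The stochastic integral of a function of `L^α` exists, its characteristic
function satisfies `|φ(θ)| = exp(-‖f‖^α |θ|^α)` and `|1 - φ(θ)| ≤ C ‖f‖^α |θ|^α`, and the integrals
of functions with disjoint supports are independent (`iIndepFun_stableIntegral`). The two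
properties of `φ` show that `P(|ε j k| > r)` is of exact order `r^(-α)`, uniformly in `(j, k)`. The
upper bound and the Borel–Cantelli lemma give the slow growth event probability one
(`ae_mem_slowGrowthEvent`). By the lower bound and independence it is almost surely impossible
that, for some rational interval, some `δ = 1/(N + 1)` and some integer `C`, all `ε j k` with
`j ≥ 0` and `k / 2^j` in the interval are at most `C 2^(j (1/α - δ))`
(`ae_forall_exists_large_waveletCoeff`). Only countably many null sets are discarded, so that the
event does not depend on `t₀`.
-/

/-! ### The decaying weight -/

/-- The polynomially decaying weight `(1 + |x|)⁻⁴`. -/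
noncomputable def decayWeight (x : ℝ) : ℝ := ((1 + |x|) ^ 4)⁻¹

lemma decayWeight_pos (x : ℝ) : 0 < decayWeight x := by
  unfold decayWeight; positivity

lemma decayWeight_le_one (x : ℝ) : decayWeight x ≤ 1 := by
  unfold decayWeight
  apply inv_le_one_of_one_le₀
  exact one_le_pow₀ (by linarith [abs_nonneg x])

lemma decayWeight_neg (x : ℝ) : decayWeight (-x) = decayWeight x := by
  simp [decayWeight]

/-- The weight changes at most by a constant factor over unit distances. -/
lemma decayWeight_le_of_abs_sub_le {x y : ℝ} (h : |x - y| ≤ 1) :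
    decayWeight y ≤ 16 * decayWeight x := by
  unfold decayWeight
  have h1 : 1 + |x| ≤ 2 * (1 + |y|) := by
    have := abs_sub_abs_le_abs_sub x y
    linarith [abs_nonneg y]
  have h2 : (1 + |x|) ^ 4 ≤ 16 * (1 + |y|) ^ 4 := by
    calc (1 + |x|) ^ 4 ≤ (2 * (1 + |y|)) ^ 4 := by gcongr
      _ = _ := by ring
  rw [← div_eq_mul_inv, le_div_iff₀ (by positivity), inv_mul_le_iff₀ (by positivity)]
  linarith

/-! ### The kernel `(x)_+^κ` -/

lemma posPow_nonneg (x κ : ℝ) : 0 ≤ posPow x κ := by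
  unfold posPow; split_ifs with h
  · exact (Real.rpow_pos_of_pos h κ).le
  · exact le_rfl

lemma posPow_of_pos {x : ℝ} (h : 0 < x) (κ : ℝ) : posPow x κ = x ^ κ := if_pos h

lemma posPow_of_nonpos {x : ℝ} (h : x ≤ 0) (κ : ℝ) : posPow x κ = 0 := if_neg h.not_gt

lemma measurable_posPow (κ : ℝ) : Measurable fun x => posPow x κ := by
  unfold posPow
  exact Measurable.ite measurableSet_Ioi (by fun_prop) measurable_const

lemma posPow_le_add {κ κ₁ κ₂ : ℝ} (h : κ ∈ Icc κ₁ κ₂) (s : ℝ) :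
    posPow s κ ≤ posPow s κ₁ + posPow s κ₂ := by
  rcases le_or_gt s 0 with hs | hs
  · simp [posPow_of_nonpos hs]
  · rw [posPow_of_pos hs, posPow_of_pos hs, posPow_of_pos hs]
    rcases le_total s 1 with h1 | h1
    · have := Real.rpow_le_rpow_of_exponent_ge hs h1 h.1
      linarith [(Real.rpow_pos_of_pos hs κ₂)]
    · have := Real.rpow_le_rpow_of_exponent_le h1 h.2
      linarith [(Real.rpow_pos_of_pos hs κ₁)]

lemma integrableOn_posPow {κ : ℝ} (hκ : -1 < κ) (a b : ℝ) :
    IntegrableOn (fun s => posPow s κ) (Icc a b) := by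
  have h1 : IntegrableOn (fun s : ℝ => s ^ κ) (Ioc 0 (max b 1)) := by
    have := (intervalIntegral.intervalIntegrable_rpow' hκ (a := 0) (b := max b 1)).1
    exact this
  have h2 : IntegrableOn (fun s => posPow s κ) (Ioc 0 (max b 1)) :=
    h1.congr_fun (fun s hs => (posPow_of_pos hs.1 κ).symm) measurableSet_Ioc
  have h3 : IntegrableOn (fun s => posPow s κ) (Iic 0) :=
    (integrableOn_zero).congr_fun (fun s hs => (posPow_of_nonpos hs κ).symm) measurableSet_Iic
  refine (h3.union h2).mono_set fun s hs => ?_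
  rcases le_or_gt s 0 with h | h
  · exact Or.inl h
  · exact Or.inr ⟨h, hs.2.trans (le_max_left _ _)⟩

lemma locallyIntegrable_posPow {κ : ℝ} (hκ : -1 < κ) :
    LocallyIntegrable (fun s => posPow s κ) := by
  intro x
  exact ⟨Icc (x - 1) (x + 1), Icc_mem_nhds (by linarith) (by linarith),
    integrableOn_posPow hκ _ _⟩

/-- `|x^ν - x^ν'| ≤ |ν - ν'| |log x| max(x^ν, x^ν')`. -/
lemma abs_rpow_sub_rpow_le {s : ℝ} (hs : 0 < s) (ν ν' : ℝ) :
    |s ^ ν - s ^ ν'| ≤ |ν - ν'| * |Real.log s| * max (s ^ ν) (s ^ ν') := by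
  have key : ∀ t t' : ℝ, t' ≤ t → |Real.exp t - Real.exp t'| ≤ |t - t'| * Real.exp t := by
    intro t t' h
    rw [abs_of_nonneg (by simpa using h), abs_of_nonneg (by simpa using h)]
    have h1 := Real.add_one_le_exp (t' - t)
    have h2 : Real.exp t' = Real.exp (t' - t) * Real.exp t := by
      rw [← Real.exp_add]; ring_nf
    rw [h2]
    nlinarith [Real.exp_pos t]
  rw [Real.rpow_def_of_pos hs, Real.rpow_def_of_pos hs, ← abs_mul]
  have e : (ν - ν') * Real.log s = Real.log s * ν - Real.log s * ν' := by ring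
  rw [e]
  rcases le_total (Real.log s * ν') (Real.log s * ν) with h | h
  · exact (key _ _ h).trans (by gcongr; exact le_max_left _ _)
  · rw [abs_sub_comm, abs_sub_comm (Real.log s * ν)]
    exact (key _ _ h).trans (by gcongr; exact le_max_right _ _)

/-! ### Fractional integrals of compactly supported functions -/

/-- The (unnormalized) fractional integral `x ↦ ∫ (s)_+^κ χ(x - s) ds`. -/
noncomputable def fracInt (κ : ℝ) (χ : ℝ → ℝ) (x : ℝ) : ℝ := ∫ s : ℝ, posPow s κ * χ (x - s)

lemma fracInt_eq (κ : ℝ) (χ : ℝ → ℝ) (x : ℝ) :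
    fracInt κ χ x = ∫ y : ℝ, posPow (x - y) κ * χ y := by
  unfold fracInt
  rw [← integral_sub_left_eq_self (fun s => posPow s κ * χ (x - s)) volume x]
  simp

section Bump

variable {χ : ℝ → ℝ} {R : ℝ}

lemma integrable_of_continuousOn_of_support {f : ℝ → ℝ} {R : ℝ} (hf : ContinuousOn f (Icc (-R) R))
    (h : ∀ x, R ≤ |x| → f x = 0) : Integrable f := by
  have h1 : IntegrableOn f (Icc (-R) R) := hf.integrableOn_Icc
  refine (integrableOn_iff_integrable_of_support_subset fun x hx => ?_).1 h1
  by_contra hn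
  apply hx
  apply h
  by_contra hlt
  exact hn (abs_le.1 (not_le.1 hlt).le)

lemma hasCompactSupport_of_support {f : ℝ → ℝ} {R : ℝ} (h : ∀ x, R ≤ |x| → f x = 0) :
    HasCompactSupport f := by
  refine HasCompactSupport.intro (isCompact_Icc (a := -R) (b := R)) fun x hx => h x ?_
  by_contra hlt
  exact hx (abs_le.1 (not_le.1 hlt).le)

lemma tsupport_subset_of_support {f : ℝ → ℝ} {R : ℝ} (h : ∀ x, R ≤ |x| → f x = 0) :
    tsupport f ⊆ Icc (-R) R := by
  refine closure_minimal (fun x hx => ?_) isClosed_Icc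
  by_contra hn
  apply hx
  apply h
  by_contra hlt
  exact hn (abs_le.1 (not_le.1 hlt).le)

/-- A continuous function with integral zero, supported in `[-R, R]`, has a primitive supported
in `[-R, R]`, whose moments are those of the function shifted by one. -/
lemma exists_primitive_of_integral_eq_zero (hχ : Continuous χ)
    (hs : ∀ x, R ≤ |x| → χ x = 0) (h0 : ∫ y, χ y = 0) :
    ∃ χ₁ : ℝ → ℝ, (∀ y, HasDerivAt χ₁ (χ y) y) ∧ (∀ x, R ≤ |x| → χ₁ x = 0) ∧
      ∀ n : ℕ, ((n : ℝ) + 1) * ∫ y, y ^ n * χ₁ y = -∫ y, y ^ (n + 1) * χ y := by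
  have hd : ∀ y, HasDerivAt (fun y => ∫ t in (-R)..y, χ t) (χ y) y := fun y =>
    intervalIntegral.integral_hasDerivAt_right (hχ.intervalIntegrable _ _)
      (hχ.stronglyMeasurableAtFilter _ _) hχ.continuousAt
  have hz : ∀ x, R ≤ |x| → ∫ t in (-R)..x, χ t = 0 := by
    intro x hx
    rcases le_abs.1 hx with h | h
    · rw [← h0, intervalIntegral.integral_eq_integral_of_support_subset]
      intro y hy
      by_contra hn
      apply hy
      apply hs
      rw [le_abs]
      rcases le_or_gt y (-R) with h3 | h3
      · right; linarith
      · rcases le_or_gt y x with h4 | h4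
        · exact absurd ⟨h3, h4⟩ hn
        · left; linarith
    · rw [intervalIntegral.integral_zero_ae]
      refine Eventually.of_forall fun y hy => hs y ?_
      rw [uIoc_of_ge (by linarith)] at hy
      rw [le_abs]; right; linarith [hy.2]
  refine ⟨_, hd, hz, fun n => ?_⟩
  set χ₁ := fun y => ∫ t in (-R)..y, χ t with hχ₁
  have hc : Continuous χ₁ := continuous_iff_continuousAt.2 fun y => (hd y).continuousAt
  have hibp := integral_mul_deriv_eq_deriv_mul_of_integrable
    (u := fun y : ℝ => y ^ (n + 1)) (u' := fun y => ((n : ℝ) + 1) * y ^ n) (v := χ₁) (v' := χ)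
    (fun y _ => by simpa using hasDerivAt_pow (n + 1) y) (fun y _ => hd y)
    (integrable_of_continuousOn_of_support (R := R) (by fun_prop)
      fun x hx => by simp [hs x hx])
    (integrable_of_continuousOn_of_support (R := R) (by fun_prop)
      fun x hx => by simp [hz x hx, hχ₁])
    (integrable_of_continuousOn_of_support (R := R) (by fun_prop)
      fun x hx => by simp [hz x hx, hχ₁])
  rw [hibp, neg_neg, ← integral_const_mul]
  congr 1; ext y; ring

/-- To the right of the support the fractional integral has no singularity. -/
lemma fracInt_eq_of_gt {x : ℝ} (hs : ∀ x, R ≤ |x| → χ x = 0) (hx : R ≤ x) (κ : ℝ) :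
    fracInt κ χ x = ∫ y, (x - y) ^ κ * χ y := by
  rw [fracInt_eq]
  congr 1; ext y
  rcases lt_or_ge y x with h | h
  · rw [posPow_of_pos (by linarith)]
  · rw [hs y (le_abs.2 (Or.inl (by linarith)))]; simp

lemma integrable_rpow_mul {x : ℝ} (hχ : Continuous χ) (hs : ∀ x, R ≤ |x| → χ x = 0) (hx : R < x)
    (κ : ℝ) : Integrable fun y => (x - y) ^ κ * χ y := by
  refine integrable_of_continuousOn_of_support (R := R) (fun y hy => ?_)
    fun y hy => by simp [hs y hy]
  apply ContinuousAt.continuousWithinAt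
  exact (ContinuousAt.rpow_const (by fun_prop) (Or.inl (by linarith [hy.2]))).mul hχ.continuousAt

/-- Each vanishing moment of `χ` lowers by one the exponent of the kernel, to the right of the
support: `m` integrations by parts. -/
lemma exists_fracInt_eq_mul (m : ℕ) : ∀ χ : ℝ → ℝ, Continuous χ →
    (∀ x, R ≤ |x| → χ x = 0) → (∀ n < m, ∫ y, y ^ n * χ y = 0) →
    ∃ (φ : ℝ → ℝ) (p : ℝ → ℝ), Continuous φ ∧ (∀ x, R ≤ |x| → φ x = 0) ∧ ContDiff ℝ 1 p ∧
      ∀ κ x, R < x → fracInt κ χ x = p κ * ∫ y, (x - y) ^ (κ - m) * φ y := by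
  induction m with
  | zero =>
    intro χ hχ hs _
    exact ⟨χ, fun _ => 1, hχ, hs, contDiff_const, fun κ x hx => by
      simp [fracInt_eq_of_gt hs hx.le]⟩
  | succ m ih =>
    intro χ hχ hs hm
    obtain ⟨χ₁, hd, hs₁, hm₁⟩ := exists_primitive_of_integral_eq_zero hχ hs
      (by simpa using hm 0 (by omega))
    have hc₁ : Continuous χ₁ := continuous_iff_continuousAt.2 fun y => (hd y).continuousAt
    obtain ⟨φ, p, hφ, hsφ, hp, hE⟩ := ih χ₁ hc₁ hs₁ fun n hn => by
      have h1 := hm₁ n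
      rw [hm (n + 1) (by omega), neg_zero] at h1
      rcases mul_eq_zero.1 h1 with h | h
      · have : (0 : ℝ) < n + 1 := by positivity
        linarith
      · exact h
    refine ⟨φ, fun κ => κ * p (κ - 1), hφ, hsφ, by fun_prop, fun κ x hx => ?_⟩
    have hibp := integral_mul_deriv_eq_deriv_mul_of_integrable
      (u := fun y : ℝ => (x - y) ^ κ) (u' := fun y => -(κ * (x - y) ^ (κ - 1))) (v := χ₁) (v' := χ)
      (fun y hy => by
        have hy' := (tsupport_subset_of_support hs₁ hy).2
        have := ((hasDerivAt_id y).const_sub x).rpow_const (p := κ) (Or.inl (by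
          simp only [id]; linarith))
        convert! this using 1
        simp only [id]; ring) (fun y _ => hd y)
      (integrable_rpow_mul hχ hs hx κ)
      (((integrable_rpow_mul hc₁ hs₁ hx (κ - 1)).const_mul (-κ)).congr
        (Eventually.of_forall fun y => by simp only [Pi.mul_apply]; ring))
      (integrable_rpow_mul hc₁ hs₁ hx κ)
    rw [fracInt_eq_of_gt hs hx.le, hibp, ← integral_neg]
    have h2 := hE (κ - 1) x hx
    rw [fracInt_eq_of_gt hs₁ hx.le] at h2
    have : κ - 1 - (m : ℝ) = κ - ((m + 1 : ℕ) : ℝ) := by push_cast; ring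
    rw [this] at h2
    rw [mul_assoc, ← h2, ← integral_const_mul]
    congr 1; ext y; ring

lemma integrable_posPow_mul {κ : ℝ} (hκ : -1 < κ) (hχ : Continuous χ)
    (hc : HasCompactSupport χ) (x : ℝ) :
    Integrable fun s => posPow s κ * χ (x - s) :=
  hc.convolutionExists_right (ContinuousLinearMap.mul ℝ ℝ) (locallyIntegrable_posPow hκ) hχ x

lemma fracInt_hasDerivAt {κ : ℝ} (hκ : -1 < κ) (hχ : ContDiff ℝ 1 χ)
    (hc : HasCompactSupport χ) (x : ℝ) :
    HasDerivAt (fracInt κ χ) (fracInt κ (deriv χ) x) x :=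
  hc.hasDerivAt_convolution_right (ContinuousLinearMap.mul ℝ ℝ) (locallyIntegrable_posPow hκ) hχ x

lemma fracInt_eq_zero (hs : ∀ x, R ≤ |x| → χ x = 0) {x : ℝ} (hx : x ≤ -R) (κ : ℝ) :
    fracInt κ χ x = 0 := by
  unfold fracInt
  rw [← integral_zero ℝ ℝ]
  congr 1; ext s
  rcases le_or_gt s 0 with h | h
  · simp [posPow_of_nonpos h]
  · rw [hs _ (le_abs.2 (Or.inr (by linarith))), mul_zero]

lemma abs_integral_mul_le_near {f G : ℝ → ℝ} {M : ℝ} (hs : ∀ x, R ≤ |x| → χ x = 0)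
    (hG : IntegrableOn G (Icc 0 (3 * R))) (h0 : ∀ s ≤ 0, f s = 0)
    (hfG : ∀ s ∈ Icc 0 (3 * R), |f s| ≤ G s) (hM : ∀ y, |χ y| ≤ M) {x : ℝ} (hx : x ≤ 2 * R) :
    |∫ s, f s * χ (x - s)| ≤ M * ∫ s in Icc 0 (3 * R), G s := by
  rw [← setIntegral_eq_integral_of_forall_compl_eq_zero (s := Icc 0 (3 * R)), ← integral_const_mul,
    ← Real.norm_eq_abs]
  · refine norm_integral_le_of_norm_le (hG.const_mul M) ?_
    rw [ae_restrict_iff' measurableSet_Icc]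
    refine Eventually.of_forall fun s hs' => ?_
    rw [Real.norm_eq_abs, abs_mul, mul_comm]
    have h1 := hfG s hs'
    have h2 := hM (x - s)
    exact mul_le_mul h2 h1 (abs_nonneg _) ((abs_nonneg _).trans h2)
  · intro s hs'
    rcases le_or_gt s 0 with h | h
    · rw [h0 s h, zero_mul]
    · rw [hs _ (le_abs.2 (Or.inr _)), mul_zero]
      by_contra hn
      exact hs' ⟨h.le, by linarith⟩

lemma exists_abs_le_of_support (hχ : Continuous χ) (hs : ∀ x, R ≤ |x| → χ x = 0) :
    ∃ M, 0 ≤ M ∧ ∀ y, |χ y| ≤ M := by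
  obtain ⟨M, hM⟩ := hχ.bounded_above_of_compact_support (hasCompactSupport_of_support hs)
  exact ⟨M, (norm_nonneg _).trans (hM 0), hM⟩

/-- A bound near the support, together with a bound by `(x / 2)⁻⁴` far from it, gives a bound by
the weight. -/
lemma le_decayWeight_of_near_of_far (hR : 1 ≤ R) {F A B : ℝ} {x : ℝ} (hA : 0 ≤ A) (hB : 0 ≤ B)
    (hneg : x ≤ -R → F = 0) (hnear : x ≤ 2 * R → F ≤ A)
    (hfar : 2 * R < x → F ≤ B * ((x / 2) ^ 4)⁻¹) :
    F ≤ (A * (1 + 2 * R) ^ 4 + 256 * B) * decayWeight x := by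
  have hw := decayWeight_pos x
  rcases le_or_gt x (-R) with h | h
  · rw [hneg h]; positivity
  rcases le_or_gt x (2 * R) with h2 | h2
  · have hx : |x| ≤ 2 * R := abs_le.2 ⟨by linarith, h2⟩
    have h3 : 1 ≤ (1 + 2 * R) ^ 4 * decayWeight x := by
      unfold decayWeight
      rw [← div_eq_mul_inv, one_le_div (by positivity)]
      gcongr
    have h4 : 0 ≤ 256 * B * decayWeight x := by positivity
    nlinarith [hnear h2, mul_le_mul_of_nonneg_left h3 hA]
  · have h3 : ((x / 2) ^ 4)⁻¹ ≤ 256 * decayWeight x := by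
      unfold decayWeight
      have hx0 : 0 < x := by linarith
      rw [abs_of_pos hx0, ← div_eq_mul_inv, inv_le_comm₀ (by positivity) (by positivity), inv_div,
        div_le_iff₀ (by norm_num)]
      calc (1 + x) ^ 4 ≤ (2 * x) ^ 4 := by gcongr; linarith
        _ = _ := by ring
    have h4 : 0 ≤ A * (1 + 2 * R) ^ 4 * decayWeight x := by positivity
    nlinarith [hfar h2, mul_le_mul_of_nonneg_left h3 hB]

lemma abs_integral_rpow_mul_le {φ : ℝ → ℝ} (hR : 1 ≤ R) (hφ : Continuous φ)
    (hs : ∀ x, R ≤ |x| → φ x = 0) {ν x : ℝ} (hν : ν ≤ -4) (hx : 2 * R < x) :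
    |∫ y, (x - y) ^ ν * φ y| ≤ (∫ y, |φ y|) * ((x / 2) ^ 4)⁻¹ := by
  have hx0 : 0 < x := by linarith
  rw [← integral_mul_const, ← Real.norm_eq_abs]
  have hi : Integrable fun y => |φ y| :=
    integrable_of_continuousOn_of_support (R := R) (by fun_prop) fun x hx => by simp [hs x hx]
  refine norm_integral_le_of_norm_le (hi.mul_const _) (Eventually.of_forall fun y => ?_)
  rcases le_or_gt R |y| with h | h
  · simp [hs y h]
  · have hy : x / 2 ≤ x - y := by linarith [(abs_lt.1 h).2]
    have h1 : (x - y) ^ ν ≤ ((x / 2) ^ 4)⁻¹ := by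
      calc (x - y) ^ ν ≤ (x - y) ^ (-4 : ℝ) := Real.rpow_le_rpow_of_exponent_le (by linarith) hν
        _ = ((x - y) ^ 4)⁻¹ := by rw [Real.rpow_neg (by linarith)]; norm_cast
        _ ≤ _ := by gcongr
    rw [Real.norm_eq_abs, abs_mul, mul_comm,
      abs_of_nonneg (Real.rpow_nonneg (by linarith : 0 ≤ x - y) _)]
    gcongr

lemma abs_integral_rpow_sub_mul_le {φ : ℝ → ℝ} (hR : 1 ≤ R) (hφ : Continuous φ)
    (hs : ∀ x, R ≤ |x| → φ x = 0) {ν ν' x : ℝ} (hν : ν ≤ -5) (hν' : ν' ≤ -5) (hx : 2 * R < x) :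
    |(∫ y, (x - y) ^ ν * φ y) - ∫ y, (x - y) ^ ν' * φ y| ≤
      (∫ y, |φ y|) * |ν - ν'| * ((x / 2) ^ 4)⁻¹ := by
  have hx0 : 0 < x := by linarith
  rw [← integral_sub (integrable_rpow_mul hφ hs (by linarith) _)
    (integrable_rpow_mul hφ hs (by linarith) _), mul_assoc, ← integral_mul_const,
    ← Real.norm_eq_abs]
  have hi : Integrable fun y => |φ y| :=
    integrable_of_continuousOn_of_support (R := R) (by fun_prop) fun x hx => by simp [hs x hx]
  refine norm_integral_le_of_norm_le (hi.mul_const _) (Eventually.of_forall fun y => ?_)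
  rcases le_or_gt R |y| with h | h
  · simp [hs y h]
  · have hy : x / 2 ≤ x - y := by linarith [(abs_lt.1 h).2]
    have hxy : 1 ≤ x - y := by linarith
    have h5 : max ((x - y) ^ ν) ((x - y) ^ ν') ≤ (x - y) ^ (-5 : ℝ) :=
      max_le (Real.rpow_le_rpow_of_exponent_le hxy hν) (Real.rpow_le_rpow_of_exponent_le hxy hν')
    have h6 : |Real.log (x - y)| ≤ x - y := by
      rw [abs_of_nonneg (Real.log_nonneg hxy)]
      linarith [Real.log_le_sub_one_of_pos (by linarith : 0 < x - y)]
    have h7 : (x - y) * (x - y) ^ (-5 : ℝ) = ((x - y) ^ 4)⁻¹ := by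
      rw [show (-5 : ℝ) = -4 - 1 by norm_num, Real.rpow_sub_one (by linarith),
        mul_div_cancel₀ _ (by linarith), Real.rpow_neg (by linarith)]
      norm_cast
    have h8 : |(x - y) ^ ν - (x - y) ^ ν'| ≤ |ν - ν'| * ((x / 2) ^ 4)⁻¹ := by
      calc _ ≤ _ := abs_rpow_sub_rpow_le (by linarith : 0 < x - y) ν ν'
        _ ≤ |ν - ν'| * (x - y) * (x - y) ^ (-5 : ℝ) := by gcongr
        _ = |ν - ν'| * ((x - y) ^ 4)⁻¹ := by rw [mul_assoc, h7]
        _ ≤ _ := by gcongr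
    rw [← sub_mul, Real.norm_eq_abs, abs_mul, mul_comm]
    gcongr

/-- Fractional integrals of a function with six vanishing moments decay like `|x|⁻⁴`, uniformly
in the exponent. -/
theorem exists_abs_fracInt_le (hR : 1 ≤ R) (hχ : Continuous χ) (hs : ∀ x, R ≤ |x| → χ x = 0)
    (hm : ∀ n < 6, ∫ y, y ^ n * χ y = 0) {κ₁ κ₂ : ℝ} (h₁ : -1 < κ₁) (h₂ : κ₂ ≤ 1) :
    ∃ K, 0 ≤ K ∧ ∀ κ ∈ Icc κ₁ κ₂, ∀ x, |fracInt κ χ x| ≤ K * decayWeight x := by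
  rcases lt_or_ge κ₂ κ₁ with h12 | h12
  · exact ⟨0, le_rfl, fun κ hκ => absurd (hκ.1.trans hκ.2) (not_le.2 h12)⟩
  obtain ⟨M, hM0, hM⟩ := exists_abs_le_of_support hχ hs
  -- six integrations by parts turn the exponent `κ ≤ 1` into `κ - 6 ≤ -5`
  obtain ⟨φ, p, hφ, hsφ, hp, hE⟩ := exists_fracInt_eq_mul 6 χ hχ hs hm
  obtain ⟨A, hA⟩ := isCompact_Icc.exists_bound_of_continuousOn (s := Icc κ₁ κ₂)
    hp.continuous.continuousOn
  have hA0 : 0 ≤ A := (norm_nonneg _).trans (hA κ₁ ⟨le_rfl, h12⟩)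
  set G : ℝ → ℝ := fun s => posPow s κ₁ + posPow s κ₂
  have hG : IntegrableOn G (Icc 0 (3 * R)) :=
    (integrableOn_posPow h₁ _ _).add (integrableOn_posPow (h₁.trans_le h12) _ _)
  have hG0 : ∀ s, 0 ≤ G s := fun s => add_nonneg (posPow_nonneg _ _) (posPow_nonneg _ _)
  have hφ0 : 0 ≤ ∫ y, |φ y| := integral_nonneg fun _ => abs_nonneg _
  have hI0 : 0 ≤ ∫ s in Icc 0 (3 * R), G s := integral_nonneg hG0
  refine ⟨M * (∫ s in Icc 0 (3 * R), G s) * (1 + 2 * R) ^ 4 + 256 * (A * ∫ y, |φ y|),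
    by positivity, fun κ hκ x => ?_⟩
  refine le_decayWeight_of_near_of_far hR (by positivity) (by positivity)
    (fun h => by simp [fracInt_eq_zero hs h]) (fun h => ?_) fun h => ?_
  · refine abs_integral_mul_le_near hs hG (fun s hs' => posPow_of_nonpos hs' κ) (fun s _ => ?_) hM h
    rw [abs_of_nonneg (posPow_nonneg _ _)]
    exact posPow_le_add hκ s
  · rw [hE κ x (by linarith), abs_mul, mul_assoc]
    have := abs_integral_rpow_mul_le hR hφ hsφ (ν := κ - (6 : ℕ)) (by
      push_cast; linarith [hκ.2]) h
    exact mul_le_mul (hA κ hκ) this (abs_nonneg _) hA0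

lemma abs_posPow_sub_posPow_le {κ₁ κ₂ κ κ' S s : ℝ} (h₁ : 0 < κ₁) (h₂ : κ₂ ≤ 1)
    (hκ : κ ∈ Icc κ₁ κ₂) (hκ' : κ' ∈ Icc κ₁ κ₂) (hs : s ≤ S) (hS : 1 ≤ S) :
    |posPow s κ - posPow s κ'| ≤ |κ - κ'| * (1 / κ₁ + S ^ 2) := by
  rcases le_or_gt s 0 with h | h
  · rw [posPow_of_nonpos h, posPow_of_nonpos h, sub_zero, abs_zero]; positivity
  rw [posPow_of_pos h, posPow_of_pos h]
  refine (abs_rpow_sub_rpow_le h κ κ').trans ?_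
  rw [mul_assoc]
  refine mul_le_mul_of_nonneg_left ?_ (abs_nonneg _)
  rcases le_total s 1 with h1 | h1
  · have h3 : max (s ^ κ) (s ^ κ') ≤ s ^ κ₁ :=
      max_le (Real.rpow_le_rpow_of_exponent_ge h h1 hκ.1)
        (Real.rpow_le_rpow_of_exponent_ge h h1 hκ'.1)
    calc |Real.log s| * max (s ^ κ) (s ^ κ') ≤ |Real.log s| * s ^ κ₁ := by gcongr
      _ = |Real.log s * s ^ κ₁| := by rw [abs_mul, abs_of_pos (Real.rpow_pos_of_pos h _)]
      _ ≤ 1 / κ₁ := (Real.abs_log_mul_self_rpow_lt s κ₁ h h1 h₁).le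
      _ ≤ _ := by linarith [sq_nonneg S]
  · have h3 : max (s ^ κ) (s ^ κ') ≤ s ^ (1 : ℝ) :=
      max_le (Real.rpow_le_rpow_of_exponent_le h1 (hκ.2.trans h₂))
        (Real.rpow_le_rpow_of_exponent_le h1 (hκ'.2.trans h₂))
    rw [Real.rpow_one] at h3
    have h4 : |Real.log s| ≤ s := by
      rw [abs_of_nonneg (Real.log_nonneg h1)]
      linarith [Real.log_le_sub_one_of_pos h]
    calc |Real.log s| * max (s ^ κ) (s ^ κ') ≤ s * s := by gcongr
      _ ≤ S ^ 2 := by nlinarith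
      _ ≤ _ := by linarith [one_div_pos.2 h₁]

/-- The fractional integral is Lipschitz in the exponent, with the same decay in `x`. -/
theorem exists_abs_fracInt_sub_le (hR : 1 ≤ R) (hχ : Continuous χ) (hs : ∀ x, R ≤ |x| → χ x = 0)
    (hm : ∀ n < 6, ∫ y, y ^ n * χ y = 0) {κ₁ κ₂ : ℝ} (h₁ : 0 < κ₁) (h₂ : κ₂ ≤ 1) :
    ∃ K, 0 ≤ K ∧ ∀ κ ∈ Icc κ₁ κ₂, ∀ κ' ∈ Icc κ₁ κ₂, ∀ x,
      |fracInt κ χ x - fracInt κ' χ x| ≤ K * |κ - κ'| * decayWeight x := by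
  rcases lt_or_ge κ₂ κ₁ with h12 | h12
  · exact ⟨0, le_rfl, fun κ hκ => absurd (hκ.1.trans hκ.2) (not_le.2 h12)⟩
  obtain ⟨M, hM0, hM⟩ := exists_abs_le_of_support hχ hs
  obtain ⟨φ, p, hφ, hsφ, hp, hE⟩ := exists_fracInt_eq_mul 6 χ hχ hs hm
  obtain ⟨A, hA⟩ := isCompact_Icc.exists_bound_of_continuousOn (s := Icc κ₁ κ₂)
    hp.continuous.continuousOn
  have hA0 : 0 ≤ A := (norm_nonneg _).trans (hA κ₁ ⟨le_rfl, h12⟩)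
  obtain ⟨L, hL⟩ := (hp.contDiffOn (s := Icc κ₁ κ₂)).exists_lipschitzOnWith one_ne_zero
    (convex_Icc _ _) isCompact_Icc
  have hφ0 : 0 ≤ ∫ y, |φ y| := integral_nonneg fun _ => abs_nonneg _
  set D : ℝ := 1 / κ₁ + (3 * R) ^ 2
  have hD : 0 ≤ D := by positivity
  refine ⟨M * (D * (3 * R)) * (1 + 2 * R) ^ 4 + 256 * ((L + A) * ∫ y, |φ y|),
    by positivity, fun κ hκ κ' hκ' x => ?_⟩
  have key := le_decayWeight_of_near_of_far (F := |fracInt κ χ x - fracInt κ' χ x|)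
    (A := |κ - κ'| * (M * (D * (3 * R)))) (B := |κ - κ'| * ((L + A) * ∫ y, |φ y|)) (x := x) hR
    (by positivity) (by positivity)
    (fun h => by simp [fracInt_eq_zero hs h]) (fun h => ?_) fun h => ?_
  · refine key.trans_eq (by ring)
  · have hc := hasCompactSupport_of_support hs
    have := abs_integral_mul_le_near (f := fun s => posPow s κ - posPow s κ')
      (G := fun _ => |κ - κ'| * D) (M := M) (x := x) hs (integrableOn_const measure_Icc_lt_top.ne)
      (fun s hs' => by simp [posPow_of_nonpos hs'])
      (fun s hs' => abs_posPow_sub_posPow_le h₁ h₂ hκ hκ' hs'.2 (by linarith)) hM h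
    unfold fracInt
    rw [← integral_sub (integrable_posPow_mul (by linarith [hκ.1]) hχ hc x)
      (integrable_posPow_mul (by linarith [hκ'.1]) hχ hc x)]
    simp_rw [← sub_mul]
    refine this.trans_eq ?_
    rw [setIntegral_const]
    simp only [measureReal_def, Real.volume_Icc, smul_eq_mul]
    rw [ENNReal.toReal_ofReal (by linarith)]
    ring
  · rw [hE κ x (by linarith), hE κ' x (by linarith)]
    have e1 := abs_integral_rpow_mul_le hR hφ hsφ (ν := κ - (6 : ℕ)) (by
      push_cast; linarith [hκ.2]) h
    have e2 := abs_integral_rpow_sub_mul_le hR hφ hsφ (ν := κ - (6 : ℕ)) (ν' := κ' - (6 : ℕ)) (by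
      push_cast; linarith [hκ.2]) (by push_cast; linarith [hκ'.2]) h
    have e3 : |p κ - p κ'| ≤ L * |κ - κ'| := by
      have := hL.dist_le_mul κ hκ κ' hκ'
      simpa [Real.dist_eq] using this
    set I := ∫ y, (x - y) ^ (κ - (6 : ℕ)) * φ y
    set I' := ∫ y, (x - y) ^ (κ' - (6 : ℕ)) * φ y
    have e4 : |I - I'| ≤ (∫ y, |φ y|) * |κ - κ'| * ((x / 2) ^ 4)⁻¹ := by
      refine e2.trans_eq ?_
      congr 3; ring
    calc |p κ * I - p κ' * I'| = |(p κ - p κ') * I + p κ' * (I - I')| := by congr 1; ring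
      _ ≤ |p κ - p κ'| * |I| + |p κ'| * |I - I'| := by
        rw [← abs_mul, ← abs_mul]; exact abs_add_le _ _
      _ ≤ (L * |κ - κ'|) * ((∫ y, |φ y|) * ((x / 2) ^ 4)⁻¹) +
          A * ((∫ y, |φ y|) * |κ - κ'| * ((x / 2) ^ 4)⁻¹) := by
        have := hA κ' hκ'
        rw [Real.norm_eq_abs] at this
        gcongr
      _ = _ := by ring

end Bump

/-- A function that decays, together with its derivative, like the weight has increments that are
controlled by the weight. -/
lemma abs_sub_le_of_abs_deriv_le {F F' : ℝ → ℝ} {K : ℝ} (hd : ∀ x, HasDerivAt F (F' x) x)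
    (hF : ∀ x, |F x| ≤ K * decayWeight x) (hF' : ∀ x, |F' x| ≤ K * decayWeight x) (x y : ℝ) :
    |F x - F y| ≤ 16 * K * (min 1 |x - y| * (decayWeight x + decayWeight y)) := by
  have hx := decayWeight_pos x
  have hy := decayWeight_pos y
  have hK : 0 ≤ K := by
    have := (abs_nonneg _).trans (hF x)
    exact nonneg_of_mul_nonneg_left this hx
  rcases le_total 1 |x - y| with h | h
  · rw [min_eq_left h]
    have := abs_sub (F x) (F y)
    nlinarith [hF x, hF y, mul_nonneg hK hx.le, mul_nonneg hK hy.le]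
  · rw [min_eq_right h]
    have hb := (convex_uIcc y x).norm_image_sub_le_of_norm_hasDerivWithin_le
      (f := F) (f' := F') (C := 16 * K * decayWeight x)
      (fun z _ => (hd z).hasDerivWithinAt) (fun z hz => by
        have h1 : |x - z| ≤ |x - y| := by
          rw [abs_sub_comm x z]
          rw [uIcc_comm] at hz
          have := abs_sub_left_of_mem_uIcc hz
          rwa [abs_sub_comm x y]
        calc ‖F' z‖ ≤ K * decayWeight z := hF' z
          _ ≤ K * (16 * decayWeight x) := by
            gcongr; exact decayWeight_le_of_abs_sub_le (h1.trans h)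
          _ = _ := by ring) left_mem_uIcc right_mem_uIcc
    rw [Real.norm_eq_abs, Real.norm_eq_abs] at hb
    have : 0 ≤ K * |x - y| * decayWeight y := by positivity
    nlinarith

lemma integral_pow_mul_deriv_eq_zero {χ : ℝ → ℝ} (hχ : ContDiff ℝ 1 χ) (hc : HasCompactSupport χ)
    {m : ℕ} (hm : ∀ n < m, ∫ y, y ^ n * χ y = 0) : ∀ n < m + 1, ∫ y, y ^ n * deriv χ y = 0 := by
  intro n hn
  have hd : ∀ y, HasDerivAt χ (deriv χ y) y := fun y =>
    (hχ.differentiable one_ne_zero y).hasDerivAt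
  have hcd : Continuous (deriv χ) := hχ.continuous_deriv le_rfl
  have hibp := integral_mul_deriv_eq_deriv_mul_of_integrable
    (u := fun y : ℝ => y ^ n) (u' := fun y => (n : ℝ) * y ^ (n - 1)) (v := χ) (v' := deriv χ)
    (fun y _ => hasDerivAt_pow n y) (fun y _ => hd y)
    (Continuous.integrable_of_hasCompactSupport (by fun_prop) hc.deriv.mul_left)
    (Continuous.integrable_of_hasCompactSupport
      ((continuous_const.mul (continuous_pow _)).mul hχ.continuous) hc.mul_left)
    (Continuous.integrable_of_hasCompactSupport ((continuous_pow _).mul hχ.continuous) hc.mul_left)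
  rw [hibp]
  cases n with
  | zero => simp
  | succ n =>
    have := hm n (by omega)
    simp_rw [mul_assoc]
    rw [integral_const_mul]
    simp [this]

/-! ### Inversion of the fractional integral -/

lemma posPow_mul {c : ℝ} (hc : 0 < c) (x κ : ℝ) : posPow (c * x) κ = c ^ κ * posPow x κ := by
  rcases le_or_gt x 0 with h | h
  · rw [posPow_of_nonpos h, posPow_of_nonpos (mul_nonpos_of_nonneg_of_nonpos hc.le h), mul_zero]
  · rw [posPow_of_pos h, posPow_of_pos (mul_pos hc h), Real.mul_rpow hc.le h.le]

/-- The value `B(1 + κ, 1 - κ)` of the Beta function, as the integral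
`∫_0^1 t^κ (1 - t)^(-κ) dt`. -/
noncomputable def betaConst (κ : ℝ) : ℝ := ∫ t : ℝ, posPow t κ * posPow (1 - t) (-κ)

lemma integrable_posPow_mul_posPow_one_sub {κ : ℝ} (h0 : 0 ≤ κ) (h1 : κ < 1) :
    Integrable fun t => posPow t κ * posPow (1 - t) (-κ) := by
  have hi : Integrable (indicator (Icc 0 1) fun t => posPow t (-κ)) := by
    rw [integrable_indicator_iff measurableSet_Icc]
    exact integrableOn_posPow (by linarith) 0 1
  have h2 : Integrable fun t => posPow (1 - t) κ * posPow t (-κ) := by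
    refine hi.mono' (((measurable_posPow κ).comp (measurable_const.sub measurable_id)).mul
      (measurable_posPow (-κ))).aestronglyMeasurable (Eventually.of_forall fun t => ?_)
    rw [Real.norm_of_nonneg (mul_nonneg (posPow_nonneg _ _) (posPow_nonneg _ _))]
    by_cases ht : t ∈ Icc (0 : ℝ) 1
    · rw [indicator_of_mem ht]
      refine mul_le_of_le_one_left (posPow_nonneg _ _) ?_
      rcases le_or_gt (1 - t) 0 with h | h
      · rw [posPow_of_nonpos h]; norm_num
      · rw [posPow_of_pos h]
        exact Real.rpow_le_one h.le (by linarith [ht.1]) h0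
    · rw [indicator_of_notMem ht]
      rcases le_or_gt t 0 with h | h
      · rw [posPow_of_nonpos h, mul_zero]
      · rw [posPow_of_nonpos, zero_mul]
        by_contra hn
        exact ht ⟨h.le, by linarith⟩
  simpa using h2.comp_sub_left 1

lemma half_le_betaConst {κ : ℝ} (h0 : 0 ≤ κ) (h1 : κ < 1) : 1 / 2 ≤ betaConst κ := by
  have h2 : ∫ t in Ioo (0 : ℝ) 1, t = 1 / 2 := by
    rw [← integral_Ioc_eq_integral_Ioo, ← intervalIntegral.integral_of_le zero_le_one, integral_id]
    norm_num
  rw [← h2, betaConst, ← integral_indicator measurableSet_Ioo]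
  refine integral_mono ?_ (integrable_posPow_mul_posPow_one_sub h0 h1) fun t => ?_
  · rw [integrable_indicator_iff measurableSet_Ioo]
    exact continuous_id.integrableOn_Icc.mono_set Ioo_subset_Icc_self
  · by_cases ht : t ∈ Ioo (0 : ℝ) 1
    · rw [indicator_of_mem ht]
      simp only
      rw [posPow_of_pos ht.1, posPow_of_pos (by linarith [ht.2])]
      have e1 : t ≤ t ^ κ := by
        simpa using Real.rpow_le_rpow_of_exponent_ge ht.1 ht.2.le h1.le
      have e2 : 1 ≤ (1 - t) ^ (-κ) :=
        Real.one_le_rpow_of_pos_of_le_one_of_nonpos (by linarith [ht.2]) (by linarith [ht.1])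
          (by linarith)
      nlinarith [ht.1]
    · rw [indicator_of_notMem ht]
      exact mul_nonneg (posPow_nonneg _ _) (posPow_nonneg _ _)

lemma posPow_mul_posPow_comp_affine {κ s r : ℝ} (hsr : s < r) (t : ℝ) :
    posPow ((s + (r - s) * t) - s) κ * posPow (r - (s + (r - s) * t)) (-κ) =
      posPow t κ * posPow (1 - t) (-κ) := by
  have hc : 0 < r - s := by linarith
  rw [show (s + (r - s) * t) - s = (r - s) * t by ring,
    show r - (s + (r - s) * t) = (r - s) * (1 - t) by ring, posPow_mul hc, posPow_mul hc]
  have : (r - s) ^ κ * (r - s) ^ (-κ) = 1 := by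
    rw [← Real.rpow_add hc]; simp
  linear_combination (posPow t κ * posPow (1 - t) (-κ)) * this

lemma posPow_sub_mul_posPow_sub_eq_zero {s r : ℝ} (hsr : r ≤ s) (κ u : ℝ) :
    posPow (u - s) κ * posPow (r - u) (-κ) = 0 := by
  rcases le_or_gt u s with h | h
  · rw [posPow_of_nonpos (by linarith), zero_mul]
  · rw [posPow_of_nonpos (x := r - u) (by linarith), mul_zero]

lemma integrable_posPow_mul_posPow {κ : ℝ} (h0 : 0 ≤ κ) (h1 : κ < 1) (s r : ℝ) :
    Integrable fun u => posPow (u - s) κ * posPow (r - u) (-κ) := by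
  rcases le_or_gt r s with h | h
  · simp_rw [posPow_sub_mul_posPow_sub_eq_zero h]
    exact integrable_zero _ _ _
  · have hc : r - s ≠ 0 := by linarith
    have h2 : Integrable fun u => posPow ((s + u) - s) κ * posPow (r - (s + u)) (-κ) := by
      rw [← integrable_comp_mul_left_iff _ hc]
      simp_rw [posPow_mul_posPow_comp_affine h]
      exact integrable_posPow_mul_posPow_one_sub h0 h1
    simpa using h2.comp_add_left (-s)

/-- The convolution of `(x)_+^κ` and `(x)_+^(-κ)` is `B(1 + κ, 1 - κ) (x)_+`. -/
lemma integral_posPow_mul_posPow (κ s r : ℝ) :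
    ∫ u, posPow (u - s) κ * posPow (r - u) (-κ) = betaConst κ * posPow (r - s) 1 := by
  rcases le_or_gt r s with h | h
  · simp_rw [posPow_sub_mul_posPow_sub_eq_zero h]
    rw [posPow_of_nonpos (by linarith)]; simp
  · have hc : 0 < r - s := by linarith
    have e1 := integral_add_left_eq_self (μ := volume)
      (fun u => posPow (u - s) κ * posPow (r - u) (-κ)) s
    have e2 := Measure.integral_comp_mul_left
      (fun u => posPow ((s + u) - s) κ * posPow (r - (s + u)) (-κ)) (r - s)
    simp_rw [posPow_mul_posPow_comp_affine h] at e2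
    rw [e1, abs_of_pos (inv_pos.2 hc), smul_eq_mul] at e2
    rw [betaConst, e2, posPow_of_pos hc, Real.rpow_one]
    field_simp

lemma integral_posPow_one_mul_deriv_deriv {g : ℝ → ℝ} (hg : ContDiff ℝ 2 g)
    (hc : HasCompactSupport g) (s : ℝ) :
    ∫ r, posPow (r - s) 1 * deriv (deriv g) r = g s := by
  have hg1 : ContDiff ℝ 1 (deriv g) := by
    have : ContDiff ℝ (1 + 1) g := by simpa [one_add_one_eq_two] using hg
    exact this.deriv'
  have hcc : Continuous (deriv (deriv g)) := hg1.continuous_deriv le_rfl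
  have hi : IntegrableOn (fun r => (r - s) * deriv (deriv g) r) (Ioi s) :=
    (Continuous.integrable_of_hasCompactSupport (by fun_prop) hc.deriv.deriv.mul_left).integrableOn
  have h1 : ∫ r, posPow (r - s) 1 * deriv (deriv g) r = ∫ r in Ioi s, (r - s) * deriv (deriv g) r := by
    rw [← integral_indicator measurableSet_Ioi]
    congr 1; ext r
    by_cases h : s < r
    · rw [indicator_of_mem (mem_Ioi.2 h), posPow_of_pos (by linarith), Real.rpow_one]
    · rw [indicator_of_notMem (by simpa using h), posPow_of_nonpos (by linarith), zero_mul]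
  have hd : ∀ r ∈ Ici s, HasDerivAt (fun r => (r - s) * deriv g r - g r)
      ((r - s) * deriv (deriv g) r) r := by
    intro r _
    have e1 : HasDerivAt g (deriv g r) r := (hg.differentiable two_ne_zero r).hasDerivAt
    have e2 : HasDerivAt (deriv g) (deriv (deriv g) r) r :=
      (hg1.differentiable one_ne_zero r).hasDerivAt
    convert! (((hasDerivAt_id r).sub_const s).mul e2).sub e1 using 1
    simp
  have hcs : HasCompactSupport fun r => (r - s) * deriv g r - g r := by
    exact (hc.deriv.mul_left (f := fun r => r - s)).sub hc
  have ht : Tendsto (fun r => (r - s) * deriv g r - g r) atTop (𝓝 0) :=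
    hcs.is_zero_at_infty.mono_left atTop_le_cocompact
  rw [h1, integral_Ioi_of_hasDerivAt_of_tendsto' hd hi ht]
  simp

/-- Fractional integration of order `κ + 1` followed by the adjoint of fractional differentiation
of the same order: `∫ (I^κ f)(u) (I^(-κ)_- g'')(u) du = B(1 + κ, 1 - κ) ∫ f g`. -/
theorem integral_fracInt_mul_fracInt {κ : ℝ} (h0 : 0 ≤ κ) (h1 : κ < 1) {f g : ℝ → ℝ}
    (hf : Continuous f) (hfc : HasCompactSupport f) (hg : ContDiff ℝ 2 g)
    (hgc : HasCompactSupport g) :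
    ∫ u, fracInt κ f u * fracInt (-κ) (fun y => deriv (deriv g) (-y)) (-u) =
      betaConst κ * ∫ s, f s * g s := by
  set k := deriv (deriv g) with hk
  have hkc : Continuous k := by
    have : ContDiff ℝ (1 + 1) g := by simpa [one_add_one_eq_two] using hg
    exact this.deriv'.continuous_deriv le_rfl
  have hks : HasCompactSupport k := hgc.deriv.deriv
  -- Fubini: integrate in `u` first, where the convolution of the two kernels appears
  set A : ℝ → ℝ × ℝ → ℝ := fun u p =>
    (posPow (u - p.1) κ * posPow (p.2 - u) (-κ)) * (f p.1 * k p.2) with hA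
  -- the result of the integration in `u` is continuous with compact support, hence integrable
  have hfk : Continuous fun p : ℝ × ℝ => posPow (p.2 - p.1) 1 * (f p.1 * k p.2) := by
    have : ∀ x, posPow x 1 = max x 0 := by
      intro x
      rcases le_or_gt x 0 with h | h
      · rw [posPow_of_nonpos h, max_eq_right h]
      · rw [posPow_of_pos h, max_eq_left h.le, Real.rpow_one]
    simp_rw [this]
    fun_prop
  have hfks : HasCompactSupport fun p : ℝ × ℝ => posPow (p.2 - p.1) 1 * (f p.1 * k p.2) := by
    refine HasCompactSupport.intro (hfc.isCompact.prod hks.isCompact) fun p hp => ?_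
    rw [mem_prod, not_and_or] at hp
    rcases hp with h | h
    · rw [image_eq_zero_of_notMem_tsupport h]; ring
    · rw [image_eq_zero_of_notMem_tsupport h]; ring
  have hfki := hfk.integrable_of_hasCompactSupport hfks (μ := volume)
  have hmeas : Measurable (Function.uncurry A) := by
    have e1 : Measurable fun q : ℝ × ℝ × ℝ => posPow (q.1 - q.2.1) κ :=
      (measurable_posPow κ).comp (by fun_prop)
    have e2 : Measurable fun q : ℝ × ℝ × ℝ => posPow (q.2.2 - q.1) (-κ) :=
      (measurable_posPow (-κ)).comp (by fun_prop)
    have e3 : Measurable fun q : ℝ × ℝ × ℝ => f q.2.1 * k q.2.2 :=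
      (by fun_prop : Continuous fun q : ℝ × ℝ × ℝ => f q.2.1 * k q.2.2).measurable
    exact (e1.mul e2).mul e3
  have hint : Integrable (Function.uncurry A) (volume.prod volume) := by
    rw [integrable_prod_iff' hmeas.aestronglyMeasurable]
    constructor
    · exact Eventually.of_forall fun p =>
        (integrable_posPow_mul_posPow h0 h1 p.1 p.2).mul_const (f p.1 * k p.2)
    · have : (fun p : ℝ × ℝ => ∫ u, ‖Function.uncurry A (u, p)‖) =
          fun p => betaConst κ * ‖posPow (p.2 - p.1) 1 * (f p.1 * k p.2)‖ := by
        ext p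
        simp only [Function.uncurry_apply_pair, hA, norm_mul (_ * _) (f p.1 * k p.2)]
        rw [integral_mul_const]
        simp_rw [Real.norm_of_nonneg (mul_nonneg (posPow_nonneg _ _) (posPow_nonneg _ _))]
        rw [integral_posPow_mul_posPow, norm_mul (posPow _ _),
          Real.norm_of_nonneg (posPow_nonneg _ _)]
        ring
      rw [this]
      exact hfki.norm.const_mul _
  have hL : ∀ u, fracInt κ f u * fracInt (-κ) (fun y => k (-y)) (-u) = ∫ p, A u p := by
    intro u
    have e2 : fracInt (-κ) (fun y => k (-y)) (-u) = ∫ r, posPow (r - u) (-κ) * k r := by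
      rw [fracInt_eq, ← integral_neg_eq_self]
      congr 1; ext y; simp only [neg_neg]; congr 2; ring
    rw [fracInt_eq, e2, ← integral_prod_mul]
    rw [Measure.volume_eq_prod]
    congr 1; ext p; simp only [hA]; ring
  simp_rw [hL]
  rw [integral_integral_swap hint]
  have hR : ∀ p : ℝ × ℝ, ∫ u, A u p = betaConst κ * (posPow (p.2 - p.1) 1 * (f p.1 * k p.2)) := by
    intro p
    simp only [hA]
    rw [integral_mul_const, integral_posPow_mul_posPow]; ring
  simp_rw [hR]
  rw [integral_const_mul]
  congr 1
  rw [Measure.volume_eq_prod, integral_prod _ (by rwa [← Measure.volume_eq_prod])]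
  congr 1; ext s
  rw [← integral_posPow_one_mul_deriv_deriv hg hgc s, ← integral_const_mul]
  congr 1; ext r; simp only [hk]; ring

lemma fracInt_comp_affine {c : ℝ} (hc : 0 < c) (d κ : ℝ) (χ : ℝ → ℝ) (u : ℝ) :
    fracInt κ (fun s => χ (c * s - d)) u = c ^ (-(1 + κ)) * fracInt κ χ (c * u - d) := by
  unfold fracInt
  have e2 := Measure.integral_comp_mul_left (fun s => posPow s κ * χ ((c * u - d) - s)) c
  simp_rw [posPow_mul hc] at e2
  rw [abs_of_pos (inv_pos.2 hc), smul_eq_mul] at e2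
  have e3 : c ^ (-(1 + κ)) = (c ^ κ)⁻¹ * c⁻¹ := by
    rw [← Real.rpow_neg hc.le, ← Real.rpow_neg_one c, ← Real.rpow_add hc]; congr 1; ring
  rw [e3, mul_assoc, ← e2, ← integral_const_mul]
  congr 1; ext s
  have : (c ^ κ) ≠ 0 := (Real.rpow_pos_of_pos hc κ).ne'
  field_simp
  ring_nf

/-- The fractional derivative of the wavelet that is biorthogonal, up to normalization, to the
fractional integral `fracInt κ ψ`: the function `x ↦ ∫ (s)_+^(-κ) ψ''(x + s) ds`, written as a
fractional integral by means of two reflections. -/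
noncomputable def dualWavelet (κ : ℝ) (ψ : ℝ → ℝ) (x : ℝ) : ℝ :=
  fracInt (-κ) (fun y => deriv (deriv ψ) (-y)) (-x)

lemma deriv_comp_affine (ψ : ℝ → ℝ) (c d : ℝ) :
    deriv (fun s => ψ (c * s - d)) = fun s => c * deriv ψ (c * s - d) := by
  ext s
  have := deriv_comp_mul_left c (fun y => ψ (y - d)) s
  simp only [smul_eq_mul] at this
  rw [this, deriv_comp_sub_const]

theorem integral_fracInt_mul_dualWavelet {κ : ℝ} (h0 : 0 ≤ κ) (h1 : κ < 1) {ψ : ℝ → ℝ}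
    (hψ : ContDiff ℝ 2 ψ) (hc : HasCompactSupport ψ) {c c' : ℝ} (hc0 : 0 < c) (hc0' : 0 < c')
    (d d' : ℝ) :
    ∫ u, fracInt κ ψ (c' * u - d') * dualWavelet κ ψ (c * u - d) =
      c' ^ (1 + κ) * c ^ (-(1 + κ)) * betaConst κ *
        ∫ s, ψ (c' * s - d') * ψ (c * s - d) := by
  have hcomp : ∀ c d : ℝ, 0 < c → HasCompactSupport fun s => ψ (c * s - d) := by
    intro c d hc0
    have := hc.comp_homeomorph ((Homeomorph.mulLeft₀ c hc0.ne').trans (Homeomorph.subRight d))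
    exact this
  have key := integral_fracInt_mul_fracInt h0 h1 (f := fun s => ψ (c' * s - d'))
    (g := fun s => ψ (c * s - d)) (hψ.continuous.comp (by fun_prop)) (hcomp c' d' hc0')
    (hψ.comp (by fun_prop)) (hcomp c d hc0)
  rw [mul_assoc, ← key, ← integral_const_mul]
  congr 1; ext u
  have e1 : deriv (deriv fun s => ψ (c * s - d)) = fun s => c ^ 2 * deriv (deriv ψ) (c * s - d) := by
    rw [deriv_comp_affine]
    ext s
    rw [deriv_const_mul_field, deriv_comp_affine (deriv ψ)]; ring
  have e2 : fracInt (-κ) (fun y => deriv (deriv fun s => ψ (c * s - d)) (-y)) (-u) =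
      c ^ 2 * (c ^ (-(1 - κ)) * dualWavelet κ ψ (c * u - d)) := by
    have := fracInt_comp_affine hc0 (-d) (-κ) (fun y => deriv (deriv ψ) (-y)) (-u)
    have e4 : -(c * u - d) = c * -u - -d := by ring
    unfold dualWavelet
    rw [e4, show -(1 - κ) = -(1 + -κ) by ring, ← this, e1]
    unfold fracInt
    rw [← integral_const_mul]
    congr 1; ext s
    have e5 : c * -(-u - s) - d = -(c * (-u - s) - -d) := by ring
    simp only [e5]; ring
  rw [e2, fracInt_comp_affine hc0']
  have e6 : c ^ (-(1 + κ)) * (c ^ 2 * c ^ (-(1 - κ))) = 1 := by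
    rw [← Real.rpow_natCast, ← Real.rpow_add hc0, ← Real.rpow_add hc0]
    rw [show -(1 + κ) + (((2 : ℕ) : ℝ) + -(1 - κ)) = 0 by push_cast; ring, Real.rpow_zero]
  have e7 : c' ^ (1 + κ) * c' ^ (-(1 + κ)) = 1 := by
    rw [← Real.rpow_add hc0', add_neg_cancel, Real.rpow_zero]
  calc fracInt κ ψ (c' * u - d') * dualWavelet κ ψ (c * u - d)
      = (c ^ (-(1 + κ)) * (c ^ 2 * c ^ (-(1 - κ)))) * (c' ^ (1 + κ) * c' ^ (-(1 + κ))) *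
        (fracInt κ ψ (c' * u - d') * dualWavelet κ ψ (c * u - d)) := by rw [e6, e7]; ring
    _ = _ := by ring

/-! ### Decay of the fractional integrals of the wavelet -/

lemma exists_support_radius {f : ℝ → ℝ} (hf : HasCompactSupport f) :
    ∃ R : ℝ, 1 ≤ R ∧ ∀ x, R ≤ |x| → f x = 0 := by
  obtain ⟨R, hR⟩ := hf.isCompact.isBounded.subset_closedBall 0
  refine ⟨max 1 (R + 1), le_max_left _ _, fun x hx => ?_⟩
  by_contra hne
  have h1 := hR (subset_tsupport f (Function.mem_support.2 hne))
  rw [mem_closedBall_zero_iff, Real.norm_eq_abs] at h1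
  linarith [le_max_right 1 (R + 1)]

lemma integral_pow_mul_comp_neg_eq_zero {χ : ℝ → ℝ} {n : ℕ} (h : ∫ y, y ^ n * χ y = 0) :
    ∫ y, y ^ n * χ (-y) = 0 := by
  rw [← integral_neg_eq_self]
  simp only [neg_neg]
  have e : ∀ y : ℝ, (-y) ^ n * χ y = (-1) ^ n * (y ^ n * χ y) := fun y => by rw [neg_pow]; ring
  simp_rw [e]
  rw [integral_const_mul, h, mul_zero]

/-- The uniform estimates, for exponents `κ` in `[κ₁, κ₂] ⊂ (0, 1)`, on the fractional integrals
of a wavelet and on the dual functions, and the cancellation of the dual functions. -/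
theorem IsCompactMotherWavelet.exists_fracInt_bounds {ψ : ℝ → ℝ} (hψ : IsCompactMotherWavelet ψ)
    {κ₁ κ₂ : ℝ} (h₁ : 0 < κ₁) (h₂ : κ₂ < 1) :
    ∃ K, 0 ≤ K ∧
      (∀ κ ∈ Icc κ₁ κ₂, ∀ x y, |fracInt κ ψ x - fracInt κ ψ y| ≤
        K * (min 1 |x - y| * (decayWeight x + decayWeight y))) ∧
      (∀ κ ∈ Icc κ₁ κ₂, ∀ κ' ∈ Icc κ₁ κ₂, ∀ x y,
        |(fracInt κ ψ x - fracInt κ' ψ x) - (fracInt κ ψ y - fracInt κ' ψ y)| ≤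
        K * |κ - κ'| * (min 1 |x - y| * (decayWeight x + decayWeight y))) ∧
      (∀ κ ∈ Icc κ₁ κ₂, ∀ x, |dualWavelet κ ψ x| ≤ K * decayWeight x) ∧
      (∀ κ ∈ Icc κ₁ κ₂, Continuous (dualWavelet κ ψ)) ∧
      (∀ κ ∈ Icc κ₁ κ₂, ∫ x, dualWavelet κ ψ x = 0) := by
  obtain ⟨Q, hQ, hm, -⟩ := hψ.moments
  have hd0 := hψ.contDiff
  have hd1 : ContDiff ℝ 2 (deriv ψ) := by
    have : ContDiff ℝ (2 + 1) ψ := by simpa [two_add_one_eq_three] using hd0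
    exact this.deriv'
  have hd2 : ContDiff ℝ 1 (deriv (deriv ψ)) := by
    have : ContDiff ℝ (1 + 1) (deriv ψ) := by simpa [one_add_one_eq_two] using hd1
    exact this.deriv'
  have hc0 := hψ.hasCompactSupport
  have hc1 : HasCompactSupport (deriv ψ) := hc0.deriv
  have hc2 : HasCompactSupport (deriv (deriv ψ)) := hc1.deriv
  have hm1 := integral_pow_mul_deriv_eq_zero (hd0.of_le (by norm_num)) hc0 hm
  have hm2 := integral_pow_mul_deriv_eq_zero (hd1.of_le (by norm_num)) hc1 hm1
  obtain ⟨R₀, hR₀, hs0⟩ := exists_support_radius hc0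
  obtain ⟨R₁, hR₁, hs1⟩ := exists_support_radius hc1
  obtain ⟨R₂, hR₂, hs2⟩ := exists_support_radius hc2
  obtain ⟨A, hA0, hA⟩ := exists_abs_fracInt_le hR₀ hd0.continuous hs0
    (fun n hn => hm n (by omega)) (by linarith : -1 < κ₁) h₂.le
  obtain ⟨A', hA0', hA'⟩ := exists_abs_fracInt_le hR₁ hd1.continuous hs1
    (fun n hn => hm1 n (by omega)) (by linarith : -1 < κ₁) h₂.le
  obtain ⟨B, hB0, hB⟩ := exists_abs_fracInt_sub_le hR₀ hd0.continuous hs0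
    (fun n hn => hm n (by omega)) h₁ h₂.le
  obtain ⟨B', hB0', hB'⟩ := exists_abs_fracInt_sub_le hR₁ hd1.continuous hs1
    (fun n hn => hm1 n (by omega)) h₁ h₂.le
  -- the dual function is a derivative: `ψ''(-y)` has the compactly supported primitive `-ψ'(-y)`,
  -- whose fractional integral decays as well, so that the integral of the dual function vanishes
  have hr1 : ContDiff ℝ 1 fun y => -deriv ψ (-y) :=
    ((hd1.of_le (by norm_num)).comp contDiff_neg).neg
  have hdr : deriv (fun y => -deriv ψ (-y)) = fun y => deriv (deriv ψ) (-y) := by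
    ext y
    have e := ((hd1.differentiable two_ne_zero (-y)).hasDerivAt.comp y (hasDerivAt_neg y)).neg
    convert! e.deriv using 1
    simp
  have hcr : HasCompactSupport fun y => -deriv ψ (-y) :=
    (hc1.comp_homeomorph (Homeomorph.neg ℝ)).neg
  have hcr2 : HasCompactSupport fun y => deriv (deriv ψ) (-y) :=
    hc2.comp_homeomorph (Homeomorph.neg ℝ)
  obtain ⟨D, hD0, hD⟩ := exists_abs_fracInt_le (χ := fun y => deriv (deriv ψ) (-y)) hR₂
    (hd2.continuous.comp continuous_neg) (fun x hx => hs2 _ (by rwa [abs_neg]))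
    (fun n hn => integral_pow_mul_comp_neg_eq_zero (hm2 n (by omega)))
    (by linarith : -1 < -κ₂) (by linarith : -κ₁ ≤ 1)
  obtain ⟨D', hD0', hD'⟩ := exists_abs_fracInt_le (χ := fun y => -deriv ψ (-y)) hR₁
    hr1.continuous (fun x hx => by rw [hs1 _ (by rwa [abs_neg]), neg_zero])
    (fun n hn => by
      have := integral_pow_mul_comp_neg_eq_zero (hm1 n (by omega))
      simp only [mul_neg]
      rw [integral_neg, this, neg_zero])
    (by linarith : -1 < -κ₂) (by linarith : -κ₁ ≤ 1)
  have hderiv : ∀ κ ∈ Icc κ₁ κ₂, ∀ x, HasDerivAt (fracInt (-κ) fun y => -deriv ψ (-y))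
      (fracInt (-κ) (fun y => deriv (deriv ψ) (-y)) x) x := by
    intro κ hκ x
    have := fracInt_hasDerivAt (κ := -κ) (by linarith [hκ.2]) hr1 hcr x
    rwa [hdr] at this
  have hneg : ∀ κ ∈ Icc κ₁ κ₂, -κ ∈ Icc (-κ₂) (-κ₁) := fun κ hκ =>
    ⟨by linarith [hκ.2], by linarith [hκ.1]⟩
  have hcont : ∀ κ ∈ Icc κ₁ κ₂, Continuous (fracInt (-κ) fun y => deriv (deriv ψ) (-y)) := by
    intro κ hκ
    exact hcr2.continuous_convolution_right (ContinuousLinearMap.mul ℝ ℝ)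
      (locallyIntegrable_posPow (by linarith [hκ.2])) (hd2.continuous.comp continuous_neg)
  refine ⟨max (16 * max A A') (max (16 * max B B') D), by positivity, fun κ hκ x y => ?_,
    fun κ hκ κ' hκ' x y => ?_, fun κ hκ x => ?_, fun κ hκ => ?_, fun κ hκ => ?_⟩
  · have hw := decayWeight_pos x
    have hw' := decayWeight_pos y
    refine (abs_sub_le_of_abs_deriv_le (K := max A A')
      (fun z => fracInt_hasDerivAt (κ := κ) (by linarith [hκ.1])
      (hd0.of_le (by norm_num)) hc0 z) (fun z => (hA κ hκ z).trans ?_)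
      (fun z => (hA' κ hκ z).trans ?_) x y).trans ?_
    · have := (decayWeight_pos z).le
      gcongr; exact le_max_left _ _
    · have := (decayWeight_pos z).le
      gcongr; exact le_max_right _ _
    · gcongr; exact le_max_left _ _
  · have hw := decayWeight_pos x
    have hw' := decayWeight_pos y
    refine (abs_sub_le_of_abs_deriv_le (K := max B B' * |κ - κ'|)
      (F := fun z => fracInt κ ψ z - fracInt κ' ψ z)
      (F' := fun z => fracInt κ (deriv ψ) z - fracInt κ' (deriv ψ) z)
      (fun z => (fracInt_hasDerivAt (κ := κ) (by linarith [hκ.1])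
      (hd0.of_le (by norm_num)) hc0 z).sub (fracInt_hasDerivAt (κ := κ') (by linarith [hκ'.1])
      (hd0.of_le (by norm_num)) hc0 z)) (fun z => (hB κ hκ κ' hκ' z).trans ?_)
      (fun z => (hB' κ hκ κ' hκ' z).trans ?_) x y).trans ?_
    · have := (decayWeight_pos z).le
      gcongr; exact le_max_left _ _
    · have := (decayWeight_pos z).le
      gcongr; exact le_max_right _ _
    · rw [← mul_assoc 16]
      gcongr; exact (le_max_left _ _).trans (le_max_right _ _)
  · have hw := decayWeight_pos x
    refine (hD (-κ) (hneg κ hκ) (-x)).trans ?_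
    rw [decayWeight_neg]
    gcongr; exact (le_max_right _ _).trans (le_max_right _ _)
  · exact (hcont κ hκ).comp continuous_neg
  · have hlim : ∀ l : Filter ℝ, Tendsto (fun x : ℝ => |x|) l atTop →
        Tendsto (fracInt (-κ) fun y => -deriv ψ (-y)) l (𝓝 0) := by
      intro l hl
      have h4 : Tendsto decayWeight l (𝓝 0) := by
        unfold decayWeight
        exact ((tendsto_pow_atTop four_ne_zero).comp
          (tendsto_atTop_add_const_left _ 1 hl)).inv_tendsto_atTop
      have h5 := h4.const_mul D'
      rw [mul_zero] at h5
      exact squeeze_zero_norm (hD' (-κ) (hneg κ hκ)) h5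
    have hint : Integrable (fracInt (-κ) fun y => deriv (deriv ψ) (-y)) := by
      have hw : Integrable fun x : ℝ => D * (1 + ‖x‖) ^ (-4 : ℝ) :=
        (integrable_one_add_norm (by norm_num)).const_mul D
      refine hw.mono' (hcont κ hκ).aestronglyMeasurable (Eventually.of_forall fun x => ?_)
      refine (hD (-κ) (hneg κ hκ) x).trans_eq ?_
      rw [Real.rpow_neg (by positivity)]
      norm_cast
    have := integral_of_hasDerivAt_of_tendsto (hderiv κ hκ) hint
      (hlim _ tendsto_abs_atBot_atTop) (hlim _ tendsto_abs_atTop_atTop)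
    unfold dualWavelet
    rw [integral_neg_eq_self, this, sub_zero]

/-! ### Summation of the dominating double series -/

/-- The general term of the double series that dominates the increments of the random wavelet
series: `a ≤ b` bound the Hurst parameter, the factors `2^(2e|j|)` and `(1 + |k|)^q` come from the
growth of the coefficients and `min(1, 2^j |u - u'|)` from the regularity of the wavelet. -/
noncomputable def dominatingTerm (a b e q u u' : ℝ) (p : ℤ × ℤ) : ℝ :=
  max ((2 : ℝ) ^ (-((p.1 : ℝ) * a))) ((2 : ℝ) ^ (-((p.1 : ℝ) * b))) *
    (2 : ℝ) ^ (2 * e * |(p.1 : ℝ)|) * (1 + |(p.2 : ℝ)|) ^ q *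
    (min 1 |((2 : ℝ) ^ p.1 * u - p.2) - ((2 : ℝ) ^ p.1 * u' - p.2)| *
      (decayWeight ((2 : ℝ) ^ p.1 * u - p.2) + decayWeight ((2 : ℝ) ^ p.1 * u' - p.2)))

lemma dominatingTerm_nonneg (a b e q u u' : ℝ) (p : ℤ × ℤ) : 0 ≤ dominatingTerm a b e q u u' p := by
  unfold dominatingTerm
  have := (decayWeight_pos ((2 : ℝ) ^ p.1 * u - p.2)).le
  have := (decayWeight_pos ((2 : ℝ) ^ p.1 * u' - p.2)).le
  positivity

lemma summable_cubic_decay : Summable fun k : ℤ => ((1 + |(k : ℝ)|) ^ 3)⁻¹ := by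
  have h : Summable fun n : ℕ => ((1 + (n : ℝ)) ^ 3)⁻¹ := by
    have := (summable_nat_add_iff 1).2 (Real.summable_nat_pow_inv.2 (by norm_num : 1 < 3))
    refine this.congr fun n => ?_
    push_cast; ring_nf
  refine Summable.of_nat_of_neg ?_ ?_
  · simpa using h
  · simpa using h

lemma summable_two_rpow_neg_abs {e : ℝ} (he : 0 < e) :
    Summable fun j : ℤ => (2 : ℝ) ^ (-(e * |(j : ℝ)|)) := by
  have h : Summable fun n : ℕ => (2 : ℝ) ^ (-(e * (n : ℝ))) := by
    have h1 : (2 : ℝ) ^ (-e) < 1 := Real.rpow_lt_one_of_one_lt_of_neg (by norm_num) (by linarith)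
    refine (summable_geometric_of_lt_one (by positivity) h1).congr fun n => ?_
    rw [← Real.rpow_natCast, ← Real.rpow_mul (by norm_num)]
    ring_nf
  refine Summable.of_nat_of_neg ?_ ?_
  · simpa using h
  · simpa using h

lemma rpow_mul_decayWeight_le {q : ℝ} (hq0 : 0 ≤ q) (hq1 : q ≤ 1) (x : ℝ) (k : ℤ) :
    (1 + |(k : ℝ)|) ^ q * decayWeight (x - k) ≤
      8 * (1 + |x|) ^ q * ((1 + |((k - ⌊x⌋ : ℤ) : ℝ)|) ^ 3)⁻¹ := by
  have h1 : 1 + |(k : ℝ)| ≤ (1 + |x|) * (1 + |x - k|) := by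
    have : |(k : ℝ)| ≤ |x| + |x - k| := by
      have := abs_sub x (x - k)
      simpa using this
    nlinarith [mul_nonneg (abs_nonneg x) (abs_nonneg (x - k))]
  have h2 : (1 + |(k : ℝ)|) ^ q ≤ (1 + |x|) ^ q * (1 + |x - k|) := by
    calc (1 + |(k : ℝ)|) ^ q ≤ ((1 + |x|) * (1 + |x - k|)) ^ q := by gcongr
      _ = (1 + |x|) ^ q * (1 + |x - k|) ^ q := Real.mul_rpow (by positivity) (by positivity)
      _ ≤ (1 + |x|) ^ q * (1 + |x - k|) ^ (1 : ℝ) := by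
        gcongr
        linarith [abs_nonneg (x - k)]
      _ = _ := by rw [Real.rpow_one]
  have h3 : 1 + |((k - ⌊x⌋ : ℤ) : ℝ)| ≤ 2 * (1 + |x - k|) := by
    have e1 := Int.fract_nonneg x
    have e2 := Int.fract_lt_one x
    have e3 : ((k - ⌊x⌋ : ℤ) : ℝ) = Int.fract x - (x - k) := by
      rw [← Int.self_sub_floor]; push_cast; ring
    have e4 := abs_sub (Int.fract x) (x - k)
    rw [e3]
    rw [abs_of_nonneg e1] at e4
    linarith [abs_nonneg (x - k)]
  have h4 : ((1 + |x - k|) ^ 3)⁻¹ ≤ 8 * ((1 + |((k - ⌊x⌋ : ℤ) : ℝ)|) ^ 3)⁻¹ := by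
    rw [← div_eq_mul_inv, inv_le_comm₀ (by positivity) (by positivity), inv_div,
      div_le_iff₀ (by norm_num)]
    calc _ ≤ (2 * (1 + |x - k|)) ^ 3 := by gcongr
      _ = _ := by ring
  calc (1 + |(k : ℝ)|) ^ q * decayWeight (x - k)
      ≤ ((1 + |x|) ^ q * (1 + |x - k|)) * decayWeight (x - k) := by
        gcongr; exact (decayWeight_pos _).le
    _ = (1 + |x|) ^ q * ((1 + |x - k|) ^ 3)⁻¹ := by
        unfold decayWeight
        have : 1 + |x - k| ≠ 0 := by positivity
        field_simp
    _ ≤ (1 + |x|) ^ q * (8 * ((1 + |((k - ⌊x⌋ : ℤ) : ℝ)|) ^ 3)⁻¹) := by gcongr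
    _ = _ := by ring

lemma min_one_le_rpow {x θ : ℝ} (hx : 0 ≤ x) (h0 : 0 ≤ θ) (h1 : θ ≤ 1) : min 1 x ≤ x ^ θ := by
  rcases le_total 1 x with h | h
  · rw [min_eq_left h]; exact Real.one_le_rpow h h0
  · rw [min_eq_right h]
    rcases hx.eq_or_lt with h' | h'
    · rw [← h']; exact Real.rpow_nonneg le_rfl _
    · simpa using Real.rpow_le_rpow_of_exponent_ge h' h h1

lemma scale_factor_le {a b e q θ : ℝ} (hab : a ≤ b) (he : 0 < e) (hq0 : 0 ≤ q) (hq1 : q ≤ 1)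
    (hθ0 : 0 ≤ θ) (hθ1 : θ ≤ 1) (ha : θ + q + 3 * e ≤ a) (hb : b + 3 * e ≤ 1) (j : ℤ) {h : ℝ}
    (hh : 0 ≤ h) (u : ℝ) :
    max ((2 : ℝ) ^ (-((j : ℝ) * a))) ((2 : ℝ) ^ (-((j : ℝ) * b))) *
      (2 : ℝ) ^ (2 * e * |(j : ℝ)|) * min 1 ((2 : ℝ) ^ j * h) * (1 + |(2 : ℝ) ^ j * u|) ^ q ≤
    (2 : ℝ) ^ (-(e * |(j : ℝ)|)) * (h ^ θ + h) * (1 + |u|) := by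
  have h2 : (1 : ℝ) ≤ 2 := by norm_num
  have hu1 : (1 + |u|) ^ q ≤ 1 + |u| := by
    simpa using Real.rpow_le_rpow_of_exponent_le (by linarith [abs_nonneg u]) hq1
  have hhθ : 0 ≤ h ^ θ := Real.rpow_nonneg hh _
  rw [← Real.rpow_intCast 2 j]
  -- for `j ≥ 0` the bound `min 1 x ≤ x ^ θ` leaves the exponent `-a + 2 e + θ + q ≤ -e`; for `j ≤ 0`
  -- the bound `min 1 x ≤ x` leaves the factor `2 ^ (j (1 - b - 2 e))`
  rcases le_total 0 (j : ℝ) with hj | hj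
  · rw [abs_of_nonneg hj, max_eq_left (Real.rpow_le_rpow_of_exponent_le h2 (by nlinarith))]
    have e1 : min 1 ((2 : ℝ) ^ (j : ℝ) * h) ≤ (2 : ℝ) ^ ((j : ℝ) * θ) * h ^ θ := by
      refine (min_one_le_rpow (by positivity) hθ0 hθ1).trans_eq ?_
      rw [Real.mul_rpow (by positivity) hh, Real.rpow_mul (by norm_num)]
    have e2 : (1 + |(2 : ℝ) ^ (j : ℝ) * u|) ^ q ≤ (2 : ℝ) ^ ((j : ℝ) * q) * (1 + |u|) := by
      have : 1 + |(2 : ℝ) ^ (j : ℝ) * u| ≤ (2 : ℝ) ^ (j : ℝ) * (1 + |u|) := by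
        rw [abs_mul, abs_of_pos (by positivity : (0 : ℝ) < 2 ^ (j : ℝ))]
        have : (1 : ℝ) ≤ 2 ^ (j : ℝ) := Real.one_le_rpow h2 hj
        linarith
      calc _ ≤ ((2 : ℝ) ^ (j : ℝ) * (1 + |u|)) ^ q := by gcongr
        _ = (2 : ℝ) ^ ((j : ℝ) * q) * (1 + |u|) ^ q := by
          rw [Real.mul_rpow (by positivity) (by positivity), Real.rpow_mul (by norm_num)]
        _ ≤ _ := by gcongr
    have e3 : (2 : ℝ) ^ (-((j : ℝ) * a)) * (2 : ℝ) ^ (2 * e * (j : ℝ)) * (2 : ℝ) ^ ((j : ℝ) * θ) *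
        (2 : ℝ) ^ ((j : ℝ) * q) ≤ (2 : ℝ) ^ (-(e * (j : ℝ))) := by
      rw [← Real.rpow_add (by norm_num), ← Real.rpow_add (by norm_num),
        ← Real.rpow_add (by norm_num)]
      exact Real.rpow_le_rpow_of_exponent_le h2 (by nlinarith)
    calc _ ≤ (2 : ℝ) ^ (-((j : ℝ) * a)) * (2 : ℝ) ^ (2 * e * (j : ℝ)) *
          ((2 : ℝ) ^ ((j : ℝ) * θ) * h ^ θ) * ((2 : ℝ) ^ ((j : ℝ) * q) * (1 + |u|)) := by gcongr
      _ = ((2 : ℝ) ^ (-((j : ℝ) * a)) * (2 : ℝ) ^ (2 * e * (j : ℝ)) * (2 : ℝ) ^ ((j : ℝ) * θ) *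
        (2 : ℝ) ^ ((j : ℝ) * q)) * h ^ θ * (1 + |u|) := by ring
      _ ≤ (2 : ℝ) ^ (-(e * (j : ℝ))) * h ^ θ * (1 + |u|) := by gcongr
      _ ≤ _ := by gcongr; linarith
  · rw [abs_of_nonpos hj, max_eq_right (Real.rpow_le_rpow_of_exponent_le h2 (by nlinarith))]
    have e1 : min 1 ((2 : ℝ) ^ (j : ℝ) * h) ≤ (2 : ℝ) ^ (j : ℝ) * h := min_le_right _ _
    have e2 : (1 + |(2 : ℝ) ^ (j : ℝ) * u|) ^ q ≤ 1 + |u| := by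
      have : 1 + |(2 : ℝ) ^ (j : ℝ) * u| ≤ 1 + |u| := by
        rw [abs_mul, abs_of_pos (by positivity : (0 : ℝ) < 2 ^ (j : ℝ))]
        have : (2 : ℝ) ^ (j : ℝ) ≤ 1 := Real.rpow_le_one_of_one_le_of_nonpos h2 hj
        nlinarith [abs_nonneg u]
      exact (Real.rpow_le_rpow (by positivity) this hq0).trans hu1
    have e3 : (2 : ℝ) ^ (-((j : ℝ) * b)) * (2 : ℝ) ^ (2 * e * -(j : ℝ)) * (2 : ℝ) ^ (j : ℝ) ≤
        (2 : ℝ) ^ (-(e * -(j : ℝ))) := by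
      rw [← Real.rpow_add (by norm_num), ← Real.rpow_add (by norm_num)]
      exact Real.rpow_le_rpow_of_exponent_le h2 (by nlinarith)
    calc _ ≤ (2 : ℝ) ^ (-((j : ℝ) * b)) * (2 : ℝ) ^ (2 * e * -(j : ℝ)) *
          ((2 : ℝ) ^ (j : ℝ) * h) * (1 + |u|) := by gcongr
      _ = ((2 : ℝ) ^ (-((j : ℝ) * b)) * (2 : ℝ) ^ (2 * e * -(j : ℝ)) * (2 : ℝ) ^ (j : ℝ)) *
          h * (1 + |u|) := by ring
      _ ≤ (2 : ℝ) ^ (-(e * -(j : ℝ))) * h * (1 + |u|) := by gcongr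
      _ ≤ _ := by gcongr; linarith

lemma dominatingTerm_le {a b e q θ : ℝ} (hab : a ≤ b) (he : 0 < e) (hq0 : 0 ≤ q)
    (hq1 : q ≤ 1) (hθ0 : 0 ≤ θ) (hθ1 : θ ≤ 1) (ha : θ + q + 3 * e ≤ a) (hb : b + 3 * e ≤ 1)
    (u u' : ℝ) (j k : ℤ) :
    dominatingTerm a b e q u u' (j, k) ≤
      8 * ((|u - u'| ^ θ + |u - u'|) * (2 + |u| + |u'|)) * (2 : ℝ) ^ (-(e * |(j : ℝ)|)) *
      (((1 + |((k - ⌊(2 : ℝ) ^ j * u⌋ : ℤ) : ℝ)|) ^ 3)⁻¹ +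
        ((1 + |((k - ⌊(2 : ℝ) ^ j * u'⌋ : ℤ) : ℝ)|) ^ 3)⁻¹) := by
  have hdiff : |((2 : ℝ) ^ j * u - k) - ((2 : ℝ) ^ j * u' - k)| = (2 : ℝ) ^ j * |u - u'| := by
    rw [sub_sub_sub_cancel_right, ← mul_sub, abs_mul, abs_of_pos (by positivity)]
  have hh : 0 ≤ |u - u'| := abs_nonneg _
  have f1 := scale_factor_le hab he hq0 hq1 hθ0 hθ1 ha hb j hh u
  have f2 := scale_factor_le hab he hq0 hq1 hθ0 hθ1 ha hb j hh u'
  have w1 := rpow_mul_decayWeight_le hq0 hq1 ((2 : ℝ) ^ j * u) k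
  have w2 := rpow_mul_decayWeight_le hq0 hq1 ((2 : ℝ) ^ j * u') k
  simp only [dominatingTerm, hdiff]
  have hs₁ : 0 ≤ ((1 + |((k - ⌊(2 : ℝ) ^ j * u⌋ : ℤ) : ℝ)|) ^ 3)⁻¹ := by positivity
  have hs₂ : 0 ≤ ((1 + |((k - ⌊(2 : ℝ) ^ j * u'⌋ : ℤ) : ℝ)|) ^ 3)⁻¹ := by positivity
  have ht : 0 ≤ (2 : ℝ) ^ (-(e * |(j : ℝ)|)) * (|u - u'| ^ θ + |u - u'|) := by positivity
  have hM : 0 ≤ max ((2 : ℝ) ^ (-((j : ℝ) * a))) ((2 : ℝ) ^ (-((j : ℝ) * b))) *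
    (2 : ℝ) ^ (2 * e * |(j : ℝ)|) * min 1 ((2 : ℝ) ^ j * |u - u'|) := by positivity
  have hu := abs_nonneg u
  have hu' := abs_nonneg u'
  have v1 := mul_le_mul_of_nonneg_left w1 hM
  have v2 := mul_le_mul_of_nonneg_left w2 hM
  have v3 := mul_le_mul_of_nonneg_right
    (f1.trans (mul_le_mul_of_nonneg_left (by linarith : 1 + |u| ≤ 2 + |u| + |u'|) ht)) hs₁
  have v4 := mul_le_mul_of_nonneg_right
    (f2.trans (mul_le_mul_of_nonneg_left (by linarith : 1 + |u'| ≤ 2 + |u| + |u'|) ht)) hs₂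
  linarith

/-- The dominating double series converges, and its sum is Hölder of order `θ` in `|u - u'|`
locally, with polynomial growth at infinity. -/
theorem exists_tsum_dominatingTerm_le {a b e q θ : ℝ} (hab : a ≤ b) (he : 0 < e) (hq0 : 0 ≤ q)
    (hq1 : q ≤ 1) (hθ0 : 0 ≤ θ) (hθ1 : θ ≤ 1) (ha : θ + q + 3 * e ≤ a) (hb : b + 3 * e ≤ 1) :
    ∃ C, 0 ≤ C ∧ ∀ u u' : ℝ, Summable (dominatingTerm a b e q u u') ∧
      ∑' p, dominatingTerm a b e q u u' p ≤
        C * ((|u - u'| ^ θ + |u - u'|) * (2 + |u| + |u'|)) := by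
  set s : ℤ → ℝ := fun k => ((1 + |(k : ℝ)|) ^ 3)⁻¹ with hs
  set t : ℤ → ℝ := fun j => (2 : ℝ) ^ (-(e * |(j : ℝ)|)) with ht
  have hs0 : ∀ k, 0 ≤ s k := fun k => by positivity
  have ht0 : ∀ j, 0 ≤ t j := fun j => by positivity
  have hS0 : 0 ≤ ∑' k, s k := tsum_nonneg hs0
  have hT0 : 0 ≤ ∑' j, t j := tsum_nonneg ht0
  refine ⟨16 * (∑' j, t j) * ∑' k, s k, by positivity, fun u u' => ?_⟩
  set B := (|u - u'| ^ θ + |u - u'|) * (2 + |u| + |u'|) with hB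
  have hB0 : 0 ≤ B := by positivity
  set g : ℤ × ℤ → ℝ := fun p => 8 * B * t p.1 *
    (s (p.2 - ⌊(2 : ℝ) ^ p.1 * u⌋) + s (p.2 - ⌊(2 : ℝ) ^ p.1 * u'⌋)) with hg
  have hle : ∀ p, dominatingTerm a b e q u u' p ≤ g p := fun p =>
    dominatingTerm_le hab he hq0 hq1 hθ0 hθ1 ha hb u u' p.1 p.2
  have hs_sum : Summable s := summable_cubic_decay
  have ht_sum : Summable t := summable_two_rpow_neg_abs he
  clear_value s t B
  have hshift : ∀ n : ℤ, HasSum (fun k => s (k - n)) (∑' k, s k) := fun n =>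
    (Equiv.subRight n).hasSum_iff.2 hs_sum.hasSum
  have hinner : ∀ j, HasSum (fun k => g (j, k)) (8 * B * t j * ((∑' k, s k) + ∑' k, s k)) :=
    fun j => ((hshift ⌊(2 : ℝ) ^ j * u⌋).add (hshift ⌊(2 : ℝ) ^ j * u'⌋)).mul_left (8 * B * t j)
  have hg0 : 0 ≤ g := fun p => mul_nonneg (mul_nonneg (by positivity) (ht0 _))
    (add_nonneg (hs0 _) (hs0 _))
  have hg_sum : Summable g := by
    rw [summable_prod_of_nonneg hg0]
    refine ⟨fun j => (hinner j).summable, ?_⟩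
    simp_rw [fun j => (hinner j).tsum_eq]
    exact (ht_sum.mul_left _).mul_right _
  have hd_sum : Summable (dominatingTerm a b e q u u') :=
    Summable.of_nonneg_of_le (dominatingTerm_nonneg a b e q u u') hle hg_sum
  refine ⟨hd_sum, (hd_sum.tsum_le_tsum hle hg_sum).trans_eq ?_⟩
  rw [hg_sum.tsum_prod]
  simp_rw [fun j => (hinner j).tsum_eq]
  rw [tsum_mul_right, tsum_mul_left]
  ring

/-! ### Growth of the coefficients -/

lemma exists_one_add_rpow_le {p e : ℝ} (hp : 0 < p) (he : 0 < e) :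
    ∃ C, 0 ≤ C ∧ ∀ x : ℝ, 0 ≤ x → (1 + x) ^ p ≤ C * 2 ^ (e * x) := by
  have hl : 0 < Real.log 2 := Real.log_pos (by norm_num)
  set c := e * Real.log 2 / p with hc
  have hc0 : 0 < c := by positivity
  refine ⟨(1 + 1 / c) ^ p, by positivity, fun x hx => ?_⟩
  have h1 : 1 + x ≤ (1 + 1 / c) * Real.exp (c * x) := by
    have e1 := Real.add_one_le_exp (c * x)
    have e2 : 1 ≤ Real.exp (c * x) := Real.one_le_exp (by positivity)
    have e3 : x ≤ 1 / c * Real.exp (c * x) := by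
      rw [one_div, ← div_eq_inv_mul, le_div_iff₀ hc0]; linarith
    linarith
  calc (1 + x) ^ p ≤ ((1 + 1 / c) * Real.exp (c * x)) ^ p := by gcongr
    _ = (1 + 1 / c) ^ p * Real.exp (c * x * p) := by
      rw [Real.mul_rpow (by positivity) (Real.exp_pos _).le, ← Real.exp_mul]
    _ = _ := by
      rw [Real.rpow_def_of_pos (by norm_num : (0 : ℝ) < 2)]
      congr 2
      rw [hc]; field_simp

lemma exists_log_rpow_le {p e : ℝ} (hp : 0 < p) (he : 0 < e) :
    ∃ C, 0 ≤ C ∧ ∀ x : ℝ, 0 ≤ x → Real.log (2 + x) ^ p ≤ C * (1 + x) ^ e := by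
  have hc0 : 0 < e / p := by positivity
  refine ⟨(2 ^ (e / p) / (e / p)) ^ p, by positivity, fun x hx => ?_⟩
  have h1 : Real.log (2 + x) ≤ (2 ^ (e / p) / (e / p)) * (1 + x) ^ (e / p) := by
    calc Real.log (2 + x) ≤ (2 + x) ^ (e / p) / (e / p) :=
          Real.log_le_rpow_div (by linarith) hc0
      _ ≤ (2 * (1 + x)) ^ (e / p) / (e / p) := by gcongr; linarith
      _ = _ := by rw [Real.mul_rpow (by norm_num) (by linarith)]; ring
  have h0 : 0 ≤ Real.log (2 + x) := Real.log_nonneg (by linarith)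
  calc Real.log (2 + x) ^ p ≤ ((2 ^ (e / p) / (e / p)) * (1 + x) ^ (e / p)) ^ p := by gcongr
    _ = _ := by
      rw [Real.mul_rpow (by positivity) (by positivity), ← Real.rpow_mul (by positivity) (e / p) p]
      congr 2
      field_simp

/-- On the slow growth event the coefficients grow at most like `2^(e|j|) (1 + |k|)^(1/α + e)`. -/
lemma exists_waveletCoeff_bound {Ω : Type*} [MeasurableSpace Ω] {P : Measure Ω} {α : ℝ}
    (hα : 0 < α) {Z : Set ℝ → Ω → ℝ} {ψ : ℝ → ℝ} {ω : Ω} (hω : ω ∈ slowGrowthEvent P α Z ψ)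
    {e : ℝ} (he : 0 < e) :
    ∃ C, 0 ≤ C ∧ ∀ j k : ℤ, |waveletCoeff P α Z ψ j k ω| ≤
      C * 2 ^ (e * |(j : ℝ)|) * (1 + |(k : ℝ)|) ^ (1 / α + e) := by
  obtain ⟨C, hC⟩ := hω 1 one_pos
  have hp : 0 < 1 / α + 1 := by positivity
  obtain ⟨C₁, hC₁, h₁⟩ := exists_one_add_rpow_le hp he
  obtain ⟨C₂, hC₂, h₂⟩ := exists_log_rpow_le hp he
  refine ⟨|C| * C₁ * C₂, by positivity, fun j k => (hC j k).trans ?_⟩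
  have hl : 0 ≤ Real.log (2 + |(k : ℝ)|) := Real.log_nonneg (by linarith [abs_nonneg (k : ℝ)])
  calc _ ≤ |C| * (C₁ * 2 ^ (e * |(j : ℝ)|)) * (1 + |(k : ℝ)|) ^ (1 / α) *
        (C₂ * (1 + |(k : ℝ)|) ^ e) := by
        gcongr
        · exact le_abs_self C
        · exact h₁ _ (abs_nonneg _)
        · exact h₂ _ (abs_nonneg _)
    _ = |C| * C₁ * C₂ * 2 ^ (e * |(j : ℝ)|) *
        ((1 + |(k : ℝ)|) ^ (1 / α) * (1 + |(k : ℝ)|) ^ e) := by ring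
    _ = _ := by rw [← Real.rpow_add (by positivity)]

/-! ### Wavelet series with slowly growing coefficients -/

/-- The general term of the wavelet series of the field, for an array `ε` of coefficients. -/
noncomputable def seriesTerm (α : ℝ) (ψ : ℝ → ℝ) (ε : ℤ → ℤ → ℝ) (u v : ℝ) (p : ℤ × ℤ) : ℝ :=
  (2 : ℝ) ^ (-((p.1 : ℝ) * v)) * ε p.1 p.2 *
    (waveletPsi α ψ ((2 : ℝ) ^ p.1 * u - p.2) v - waveletPsi α ψ (-(p.2 : ℝ)) v)

/-- The sum of the wavelet series with coefficients `ε`. -/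
noncomputable def waveletSeries (α : ℝ) (ψ : ℝ → ℝ) (ε : ℤ → ℤ → ℝ) (u v : ℝ) : ℝ :=
  ∑' p, seriesTerm α ψ ε u v p

/-- The array `ε` is `O(2^(e|j|) (1 + |k|)^(1/α + e))` for every `e > 0`. -/
def SlowlyGrowing (α : ℝ) (ε : ℤ → ℤ → ℝ) : Prop :=
  ∀ e : ℝ, 0 < e → ∃ C, 0 ≤ C ∧ ∀ j k : ℤ,
    |ε j k| ≤ C * 2 ^ (e * |(j : ℝ)|) * (1 + |(k : ℝ)|) ^ (1 / α + e)

section Series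

variable {α : ℝ} {ψ : ℝ → ℝ} {ε : ℤ → ℤ → ℝ} {a b : ℝ}

lemma waveletPsi_eq_fracInt (x v : ℝ) : waveletPsi α ψ x v = fracInt (v - 1 / α) ψ x := rfl

lemma exists_growth_parameter {θ : ℝ} (hα : 1 < α) (hb : b < 1)
    (hθ : θ < a - 1 / α) :
    ∃ e, 0 < e ∧ 1 / α + e ≤ 1 ∧ θ + (1 / α + e) + 3 * e ≤ a ∧ b + 3 * e ≤ 1 := by
  have h1 : 1 / α < 1 := by rw [div_lt_one (by linarith)]; exact hα
  refine ⟨min (1 - 1 / α) (min ((a - 1 / α - θ) / 4) ((1 - b) / 3)), ?_, ?_, ?_, ?_⟩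
  · exact lt_min (by linarith) (lt_min (by linarith) (by linarith))
  · linarith [min_le_left (1 - 1 / α) (min ((a - 1 / α - θ) / 4) ((1 - b) / 3))]
  · linarith [(min_le_right (1 - 1 / α) (min ((a - 1 / α - θ) / 4) ((1 - b) / 3))).trans
      (min_le_left _ _)]
  · linarith [(min_le_right (1 - 1 / α) (min ((a - 1 / α - θ) / 4) ((1 - b) / 3))).trans
      (min_le_right _ _)]

lemma two_rpow_neg_le_max {v : ℝ} (hv : v ∈ Icc a b) (j : ℤ) :
    (2 : ℝ) ^ (-((j : ℝ) * v)) ≤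
      max ((2 : ℝ) ^ (-((j : ℝ) * a))) ((2 : ℝ) ^ (-((j : ℝ) * b))) := by
  rcases le_total 0 (j : ℝ) with h | h
  · exact le_max_of_le_left (Real.rpow_le_rpow_of_exponent_le (by norm_num)
      (by nlinarith [hv.1]))
  · exact le_max_of_le_right (Real.rpow_le_rpow_of_exponent_le (by norm_num)
      (by nlinarith [hv.2]))

lemma abs_two_rpow_sub_le {v v' e : ℝ} (he : 0 < e) (hv : v ∈ Icc a b) (hv' : v' ∈ Icc a b)
    (j : ℤ) :
    |(2 : ℝ) ^ (-((j : ℝ) * v)) - (2 : ℝ) ^ (-((j : ℝ) * v'))| ≤ |v - v'| *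
      ((1 / e) * 2 ^ (e * |(j : ℝ)|) *
        max ((2 : ℝ) ^ (-((j : ℝ) * a))) ((2 : ℝ) ^ (-((j : ℝ) * b)))) := by
  have hl : 0 < Real.log 2 := Real.log_pos (by norm_num)
  refine (abs_rpow_sub_rpow_le (by norm_num) _ _).trans ?_
  have h1 : |(-((j : ℝ) * v)) - (-((j : ℝ) * v'))| = |(j : ℝ)| * |v - v'| := by
    rw [← abs_mul, ← abs_neg]; congr 1; ring
  have h2 : |(j : ℝ)| * Real.log 2 ≤ (1 / e) * 2 ^ (e * |(j : ℝ)|) := by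
    rw [Real.rpow_def_of_pos (by norm_num : (0 : ℝ) < 2), one_div, ← div_eq_inv_mul,
      le_div_iff₀ he]
    linarith [Real.add_one_le_exp (Real.log 2 * (e * |(j : ℝ)|))]
  rw [h1, abs_of_pos hl]
  calc _ = |v - v'| * ((|(j : ℝ)| * Real.log 2) *
        max ((2 : ℝ) ^ (-((j : ℝ) * v))) ((2 : ℝ) ^ (-((j : ℝ) * v')))) := by ring
    _ ≤ _ := mul_le_mul_of_nonneg_left (mul_le_mul h2
      (max_le (two_rpow_neg_le_max hv j) (two_rpow_neg_le_max hv' j)) (by positivity)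
      (by positivity)) (abs_nonneg _)

lemma seriesTerm_zero (v : ℝ) (p : ℤ × ℤ) : seriesTerm α ψ ε 0 v p = 0 := by
  simp [seriesTerm]

/-- The increments in `u` of the general term are dominated, uniformly in `v`. -/
lemma exists_seriesTerm_sub_le (hψ : IsCompactMotherWavelet ψ) (hε : SlowlyGrowing α ε)
    (ha : 1 / α < a) (hb : b - 1 / α < 1) {e : ℝ} (he : 0 < e) :
    ∃ C, 0 ≤ C ∧ ∀ v ∈ Icc a b, ∀ u u' p,
      |seriesTerm α ψ ε u v p - seriesTerm α ψ ε u' v p| ≤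
        C * dominatingTerm a b e (1 / α + e) u u' p := by
  obtain ⟨K, hK, hF, -⟩ := hψ.exists_fracInt_bounds (κ₁ := a - 1 / α) (κ₂ := b - 1 / α)
    (by linarith) hb
  obtain ⟨C, hC, hεC⟩ := hε e he
  refine ⟨C * K, by positivity, fun v hv u u' p => ?_⟩
  have hκ : v - 1 / α ∈ Icc (a - 1 / α) (b - 1 / α) := ⟨by linarith [hv.1], by linarith [hv.2]⟩
  have h1 := hF _ hκ ((2 : ℝ) ^ p.1 * u - p.2) ((2 : ℝ) ^ p.1 * u' - p.2)
  have h2 : seriesTerm α ψ ε u v p - seriesTerm α ψ ε u' v p =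
      (2 : ℝ) ^ (-((p.1 : ℝ) * v)) * ε p.1 p.2 *
      (fracInt (v - 1 / α) ψ ((2 : ℝ) ^ p.1 * u - p.2) -
        fracInt (v - 1 / α) ψ ((2 : ℝ) ^ p.1 * u' - p.2)) := by
    simp only [seriesTerm, waveletPsi_eq_fracInt]; ring
  have hp : (0 : ℝ) < 2 ^ (-((p.1 : ℝ) * v)) := by positivity
  have hw := (decayWeight_pos ((2 : ℝ) ^ p.1 * u - p.2)).le
  have hw' := (decayWeight_pos ((2 : ℝ) ^ p.1 * u' - p.2)).le
  have h3 : (2 : ℝ) ^ (e * |(p.1 : ℝ)|) ≤ 2 ^ (2 * e * |(p.1 : ℝ)|) :=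
    Real.rpow_le_rpow_of_exponent_le (by norm_num) (by nlinarith [abs_nonneg (p.1 : ℝ)])
  rw [h2, abs_mul, abs_mul, abs_of_pos hp]
  calc _ ≤ max ((2 : ℝ) ^ (-((p.1 : ℝ) * a))) ((2 : ℝ) ^ (-((p.1 : ℝ) * b))) *
        (C * 2 ^ (2 * e * |(p.1 : ℝ)|) * (1 + |(p.2 : ℝ)|) ^ (1 / α + e)) *
        (K * (min 1 |((2 : ℝ) ^ p.1 * u - p.2) - ((2 : ℝ) ^ p.1 * u' - p.2)| *
      (decayWeight ((2 : ℝ) ^ p.1 * u - p.2) + decayWeight ((2 : ℝ) ^ p.1 * u' - p.2)))) := by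
        gcongr
        · exact two_rpow_neg_le_max hv p.1
        · exact (hεC p.1 p.2).trans (by gcongr)
    _ = _ := by simp only [dominatingTerm]; ring

/-- The general term is Lipschitz in `v`, with a dominated constant. -/
lemma exists_seriesTerm_sub_le_right (hψ : IsCompactMotherWavelet ψ) (hε : SlowlyGrowing α ε)
    (ha : 1 / α < a) (hb : b - 1 / α < 1) {e : ℝ} (he : 0 < e) :
    ∃ C, 0 ≤ C ∧ ∀ v ∈ Icc a b, ∀ v' ∈ Icc a b, ∀ u p,
      |seriesTerm α ψ ε u v p - seriesTerm α ψ ε u v' p| ≤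
        C * |v - v'| * dominatingTerm a b e (1 / α + e) u 0 p := by
  obtain ⟨K, hK, hF, hG, -⟩ := hψ.exists_fracInt_bounds (κ₁ := a - 1 / α) (κ₂ := b - 1 / α)
    (by linarith) hb
  obtain ⟨C, hC, hεC⟩ := hε e he
  refine ⟨C * K * (1 / e + 1), by positivity, fun v hv v' hv' u p => ?_⟩
  have hκ : v - 1 / α ∈ Icc (a - 1 / α) (b - 1 / α) := ⟨by linarith [hv.1], by linarith [hv.2]⟩
  have hκ' : v' - 1 / α ∈ Icc (a - 1 / α) (b - 1 / α) :=
    ⟨by linarith [hv'.1], by linarith [hv'.2]⟩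
  set x := (2 : ℝ) ^ p.1 * u - p.2 with hx
  set y := (2 : ℝ) ^ p.1 * 0 - p.2 with hy
  have hy' : -(p.2 : ℝ) = y := by rw [hy]; ring
  have h1 := hF _ hκ x y
  have h1' := hG _ hκ _ hκ' x y
  have h2 : seriesTerm α ψ ε u v p - seriesTerm α ψ ε u v' p =
      ε p.1 p.2 * (((2 : ℝ) ^ (-((p.1 : ℝ) * v)) - (2 : ℝ) ^ (-((p.1 : ℝ) * v'))) *
        (fracInt (v - 1 / α) ψ x - fracInt (v - 1 / α) ψ y) +
        (2 : ℝ) ^ (-((p.1 : ℝ) * v')) *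
        ((fracInt (v - 1 / α) ψ x - fracInt (v' - 1 / α) ψ x) -
          (fracInt (v - 1 / α) ψ y - fracInt (v' - 1 / α) ψ y))) := by
    simp only [seriesTerm, waveletPsi_eq_fracInt, hy']; ring
  have h4 := abs_two_rpow_sub_le he hv hv' p.1
  have h5 := two_rpow_neg_le_max hv' p.1
  have h6 : (v - 1 / α) - (v' - 1 / α) = v - v' := by ring
  rw [h6] at h1'
  have hp : (0 : ℝ) < 2 ^ (-((p.1 : ℝ) * v')) := by positivity
  set m := max ((2 : ℝ) ^ (-((p.1 : ℝ) * a))) ((2 : ℝ) ^ (-((p.1 : ℝ) * b))) with hm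
  have hm0 : 0 ≤ m := by positivity
  set w := min 1 |x - y| * (decayWeight x + decayWeight y) with hw
  have hw0 : 0 ≤ w := by
    have := (decayWeight_pos x).le
    have := (decayWeight_pos y).le
    positivity
  set E := (2 : ℝ) ^ (e * |(p.1 : ℝ)|) with hE
  have hE1 : 1 ≤ E := Real.one_le_rpow (by norm_num) (by positivity)
  have hEE : (2 : ℝ) ^ (2 * e * |(p.1 : ℝ)|) = E * E := by
    rw [hE, ← Real.rpow_add (by norm_num)]; ring_nf
  have hdom : dominatingTerm a b e (1 / α + e) u 0 p =
      m * (E * E) * (1 + |(p.2 : ℝ)|) ^ (1 / α + e) * w := by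
    rw [← hEE]; simp only [dominatingTerm, hm, hw, hx, hy]
  rw [h2, abs_mul, hdom]
  calc _ ≤ (C * E * (1 + |(p.2 : ℝ)|) ^ (1 / α + e)) *
        (|v - v'| * ((1 / e) * E * m) * (K * w) + m * (K * |v - v'| * w)) := by
        refine mul_le_mul (hεC p.1 p.2) ((abs_add_le _ _).trans ?_) (abs_nonneg _) (by positivity)
        rw [abs_mul, abs_mul, abs_of_pos hp]
        gcongr
    _ ≤ (C * E * (1 + |(p.2 : ℝ)|) ^ (1 / α + e)) *
        (|v - v'| * ((1 / e) * E * m) * (K * w) + (m * E) * (K * |v - v'| * w)) := by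
        gcongr
        exact le_mul_of_one_le_right hm0 hE1
    _ = _ := by ring

lemma waveletSeries_sub_eq {v : ℝ} {u u' : ℝ} (h : Summable (seriesTerm α ψ ε u v))
    (h' : Summable (seriesTerm α ψ ε u' v)) :
    waveletSeries α ψ ε u v - waveletSeries α ψ ε u' v =
      ∑' p, (seriesTerm α ψ ε u v p - seriesTerm α ψ ε u' v p) :=
  (h.tsum_sub h').symm

/-- The wavelet series converges absolutely, and its increments in `u` satisfy a Hölder condition
of every order `θ < a - 1/α`, uniformly in `v ∈ [a, b]`. -/
theorem exists_waveletSeries_bounds (hψ : IsCompactMotherWavelet ψ) (hε : SlowlyGrowing α ε)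
    (hα : 1 < α) (ha : 1 / α < a) (hab : a ≤ b) (hb : b < 1) {θ : ℝ} (hθ0 : 0 ≤ θ)
    (hθ : θ < a - 1 / α) :
    ∃ C, 0 ≤ C ∧ ∀ v ∈ Icc a b,
      (∀ u, Summable (seriesTerm α ψ ε u v)) ∧
      ∀ u u', Summable (fun p => |seriesTerm α ψ ε u v p - seriesTerm α ψ ε u' v p|) ∧
        ∑' p, |seriesTerm α ψ ε u v p - seriesTerm α ψ ε u' v p| ≤
          C * ((|u - u'| ^ θ + |u - u'|) * (2 + |u| + |u'|)) ∧
        |waveletSeries α ψ ε u v - waveletSeries α ψ ε u' v| ≤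
          C * ((|u - u'| ^ θ + |u - u'|) * (2 + |u| + |u'|)) := by
  have hα' : 0 < 1 / α := by positivity
  obtain ⟨e, he, he1, he2, he3⟩ := exists_growth_parameter hα hb hθ
  obtain ⟨C₁, hC₁, h₁⟩ := exists_seriesTerm_sub_le hψ hε ha (b := b) (by linarith) he
  obtain ⟨C₂, hC₂, h₂⟩ := exists_tsum_dominatingTerm_le hab he (by linarith) he1 hθ0
    (by linarith) he2 he3
  refine ⟨C₁ * C₂, by positivity, fun v hv => ?_⟩
  have hsum : ∀ u u', Summable fun p => |seriesTerm α ψ ε u v p - seriesTerm α ψ ε u' v p| :=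
    fun u u' => Summable.of_nonneg_of_le (fun _ => abs_nonneg _) (fun p => h₁ v hv u u' p)
      ((h₂ u u').1.mul_left _)
  have hs : ∀ u, Summable (seriesTerm α ψ ε u v) := fun u => by
    have := (hsum u 0).of_abs
    simpa [seriesTerm_zero] using this
  refine ⟨hs, fun u u' => ⟨hsum u u', ?_⟩⟩
  have hle : ∑' p, |seriesTerm α ψ ε u v p - seriesTerm α ψ ε u' v p| ≤
      C₁ * C₂ * ((|u - u'| ^ θ + |u - u'|) * (2 + |u| + |u'|)) := by
    refine ((hsum u u').tsum_le_tsum (fun p => h₁ v hv u u' p) ((h₂ u u').1.mul_left _)).trans ?_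
    rw [tsum_mul_left, mul_assoc]
    exact mul_le_mul_of_nonneg_left (h₂ u u').2 hC₁
  refine ⟨hle, ?_⟩
  rw [waveletSeries_sub_eq (hs u) (hs u')]
  refine le_trans ?_ hle
  have := norm_tsum_le_tsum_norm (f := fun p => seriesTerm α ψ ε u v p - seriesTerm α ψ ε u' v p)
    (hsum u u')
  simpa using this

/-- The wavelet series is Lipschitz in `v ∈ [a, b]`, locally uniformly in `u`. -/
theorem exists_waveletSeries_sub_right_le (hψ : IsCompactMotherWavelet ψ)
    (hε : SlowlyGrowing α ε) (hα : 1 < α) (ha : 1 / α < a) (hab : a ≤ b) (hb : b < 1) :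
    ∃ C, 0 ≤ C ∧ ∀ v ∈ Icc a b, ∀ v' ∈ Icc a b, ∀ u,
      |waveletSeries α ψ ε u v - waveletSeries α ψ ε u v'| ≤
        C * |v - v'| * ((1 + |u|) * (2 + |u|)) := by
  have hα' : 0 < 1 / α := by positivity
  obtain ⟨e, he, he1, he2, he3⟩ := exists_growth_parameter (a := a) (θ := 0) hα hb (by linarith)
  obtain ⟨C₁, hC₁, h₁⟩ := exists_seriesTerm_sub_le_right hψ hε ha (b := b) (by linarith) he
  obtain ⟨C₂, hC₂, h₂⟩ := exists_tsum_dominatingTerm_le hab he (by linarith) he1 le_rfl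
    (by linarith) he2 he3
  obtain ⟨C₃, hC₃, h₃⟩ := exists_waveletSeries_bounds hψ hε hα ha hab hb le_rfl (by linarith)
  refine ⟨C₁ * C₂, by positivity, fun v hv v' hv' u => ?_⟩
  have hsum : Summable fun p => |seriesTerm α ψ ε u v p - seriesTerm α ψ ε u v' p| :=
    Summable.of_nonneg_of_le (fun _ => abs_nonneg _) (fun p => h₁ v hv v' hv' u p)
      ((h₂ u 0).1.mul_left _)
  have e1 : waveletSeries α ψ ε u v - waveletSeries α ψ ε u v' =
      ∑' p, (seriesTerm α ψ ε u v p - seriesTerm α ψ ε u v' p) :=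
    (((h₃ v hv).1 u).tsum_sub ((h₃ v' hv').1 u)).symm
  rw [e1]
  have e2 := norm_tsum_le_tsum_norm
    (f := fun p => seriesTerm α ψ ε u v p - seriesTerm α ψ ε u v' p) hsum
  refine e2.trans ((hsum.tsum_le_tsum (fun p => h₁ v hv v' hv' u p)
    ((h₂ u 0).1.mul_left _)).trans ?_)
  rw [tsum_mul_left]
  have e3 := (h₂ u 0).2
  simp only [sub_zero, Real.rpow_zero, abs_zero, add_zero] at e3
  calc _ ≤ C₁ * |v - v'| * (C₂ * ((1 + |u|) * (2 + |u|))) := by gcongr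
    _ = _ := by ring

end Series

/-! ### Recovery of the coefficients from the sum of the wavelet series -/

section Recovery

variable {α : ℝ} {ψ : ℝ → ℝ} {ε : ℤ → ℤ → ℝ} {a b : ℝ}

lemma integrable_one_add_abs_inv_sq : Integrable fun x : ℝ => ((1 + |x|) ^ 2)⁻¹ := by
  have h : Integrable fun x : ℝ => (1 + ‖x‖) ^ (-2 : ℝ) := integrable_one_add_norm (by norm_num)
  refine h.congr (Eventually.of_forall fun x => ?_)
  simp only [Real.norm_eq_abs]
  rw [Real.rpow_neg (by positivity)]
  norm_cast

lemma integrable_comp_affine {f : ℝ → ℝ} (hf : Integrable f) {c : ℝ} (hc : c ≠ 0) (d : ℝ) :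
    Integrable fun u => f (c * u - d) :=
  (hf.comp_sub_right d).comp_mul_left' hc

lemma integral_comp_affine (f : ℝ → ℝ) {c : ℝ} (hc : 0 < c) (d : ℝ) :
    ∫ u, f (c * u - d) = c⁻¹ * ∫ x, f x := by
  have := Measure.integral_comp_mul_left (fun x => f (x - d)) c
  rw [this, integral_sub_right_eq_self (fun x => f x) d, abs_of_pos (inv_pos.2 hc), smul_eq_mul]

lemma IsCompactMotherWavelet.integral_mul_eq (hψ : IsCompactMotherWavelet ψ) (j k j' k' : ℤ) :
    ∫ t : ℝ, ψ ((2 : ℝ) ^ j' * t - k') * ψ ((2 : ℝ) ^ j * t - k) =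
      if (j', k') = (j, k) then ((2 : ℝ) ^ j)⁻¹ else 0 := by
  have h := hψ.orthonormal j' k' j k
  have e : ∀ t : ℝ, ((2 : ℝ) ^ ((j' : ℝ) / 2) * ψ ((2 : ℝ) ^ j' * t - k')) *
      ((2 : ℝ) ^ ((j : ℝ) / 2) * ψ ((2 : ℝ) ^ j * t - k)) =
      ((2 : ℝ) ^ ((j' : ℝ) / 2) * (2 : ℝ) ^ ((j : ℝ) / 2)) *
        (ψ ((2 : ℝ) ^ j' * t - k') * ψ ((2 : ℝ) ^ j * t - k)) := fun t => by ring
  simp_rw [e] at h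
  rw [integral_const_mul] at h
  by_cases hjk : j' = j ∧ k' = k
  · rw [if_pos hjk] at h
    rw [if_pos (by rw [hjk.1, hjk.2])]
    have e2 : (2 : ℝ) ^ ((j' : ℝ) / 2) * (2 : ℝ) ^ ((j : ℝ) / 2) = (2 : ℝ) ^ j := by
      rw [hjk.1, ← Real.rpow_add (by norm_num), add_halves, Real.rpow_intCast]
    rw [e2] at h
    exact eq_inv_of_mul_eq_one_right h
  · rw [if_neg hjk] at h
    rw [if_neg (by simpa [Prod.ext_iff] using hjk)]
    exact (mul_eq_zero.1 h).resolve_left (by positivity)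

/-- A locally bounded function of at most quadratic growth is integrable against the dual
function; the bound is written for the function that arises from increments of the series. -/
lemma integrable_growth_mul_decayWeight {c : ℝ} (hc : 0 < c) (d t K : ℝ) :
    Integrable fun u => ((1 + |u - t|) * (2 + |u| + |t|)) * (K * decayWeight (c * u - d)) := by
  set M := (1 + |d| / c + |t| + 1 / c) with hM
  have hM0 : 0 ≤ M := by positivity
  have h1 : Integrable fun u => (4 * M ^ 2 * |K|) * ((1 + |c * u - d|) ^ 2)⁻¹ :=
    (integrable_comp_affine integrable_one_add_abs_inv_sq hc.ne' d).const_mul _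
  refine h1.mono' ?_ (Eventually.of_forall fun u => ?_)
  · refine Continuous.aestronglyMeasurable ?_
    have : ∀ u, (1 + |c * u - d|) ^ 4 ≠ 0 := fun u => by positivity
    unfold decayWeight
    fun_prop (disch := assumption)
  · set x := c * u - d with hx
    have hu : u = x / c + d / c := by rw [hx]; field_simp; ring
    have hx0 := abs_nonneg x
    have hu' : |u| ≤ |x| / c + |d| / c := by
      rw [hu]
      refine (abs_add_le _ _).trans_eq ?_
      rw [abs_div, abs_div, abs_of_pos hc]
    have hut : |u - t| ≤ |u| + |t| := abs_sub _ _
    have hdc : 0 ≤ |d| / c := by positivity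
    have hc1 : 0 ≤ 1 / c := by positivity
    have hxc : |x| / c = |x| * (1 / c) := by ring
    have key : 1 + |u| + |t| ≤ M * (1 + |x|) := by
      rw [hM]
      nlinarith [abs_nonneg t, mul_nonneg hx0 (abs_nonneg t), mul_nonneg hx0 hdc]
    have hw := (decayWeight_pos x).le
    have h5 : (1 + |u - t|) * (2 + |u| + |t|) ≤ 4 * M ^ 2 * (1 + |x|) ^ 2 := by
      calc (1 + |u - t|) * (2 + |u| + |t|) ≤ (2 * (M * (1 + |x|))) * (2 * (M * (1 + |x|))) := by
            gcongr
            · linarith [abs_nonneg t, abs_nonneg u]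
            · linarith [abs_nonneg t, abs_nonneg u]
        _ = _ := by ring
    rw [Real.norm_eq_abs, abs_mul, abs_mul K, abs_of_nonneg hw,
      abs_of_nonneg (by positivity : 0 ≤ (1 + |u - t|) * (2 + |u| + |t|))]
    calc _ ≤ (4 * M ^ 2 * (1 + |x|) ^ 2) * (|K| * decayWeight x) := by gcongr
      _ = _ := by
        unfold decayWeight
        have : 1 + |x| ≠ 0 := by positivity
        field_simp

/-- Biorthogonality: integrating the increments of the wavelet series against the dual function of
index `(j, k)` isolates the coefficient `ε j k`. -/
theorem integral_waveletSeries_sub_mul_dualWavelet (hψ : IsCompactMotherWavelet ψ)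
    (hε : SlowlyGrowing α ε) (hα : 1 < α) {v : ℝ} (hv : 1 / α < v) (hv1 : v < 1) (j k : ℤ)
    (t : ℝ) :
    ∫ u, (waveletSeries α ψ ε u v - waveletSeries α ψ ε t v) *
        dualWavelet (v - 1 / α) ψ ((2 : ℝ) ^ j * u - k) =
      (2 : ℝ) ^ (-((j : ℝ) * v)) * ε j k * (betaConst (v - 1 / α) * ((2 : ℝ) ^ j)⁻¹) := by
  have hα' : 0 < 1 / α := by positivity
  set κ := v - 1 / α with hκ
  have hκ0 : 0 < κ := by linarith
  have hκ1 : κ < 1 := by linarith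
  have hκm : κ ∈ Icc κ κ := ⟨le_rfl, le_rfl⟩
  have hvm : v ∈ Icc v v := ⟨le_rfl, le_rfl⟩
  obtain ⟨K, hK, hF, -, hD, hDc, hD0⟩ := hψ.exists_fracInt_bounds hκ0 hκ1
  obtain ⟨C, hC, hX⟩ := exists_waveletSeries_bounds hψ hε hα hv le_rfl hv1 le_rfl (by linarith)
  obtain ⟨hsum, hinc⟩ := hX v hvm
  have hc : ∀ i : ℤ, (0 : ℝ) < (2 : ℝ) ^ i := fun i => by positivity
  set g : ℝ → ℝ := fun u => dualWavelet κ ψ ((2 : ℝ) ^ j * u - k) with hg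
  have hgc : Continuous g := (hDc κ hκm).comp (by fun_prop)
  have hDi : Integrable (dualWavelet κ ψ) := by
    refine (integrable_one_add_abs_inv_sq.const_mul K).mono' (hDc κ hκm).aestronglyMeasurable
      (Eventually.of_forall fun x => (hD κ hκm x).trans ?_)
    unfold decayWeight
    gcongr
    · linarith [abs_nonneg x]
    · norm_num
  have hgi : Integrable g := integrable_comp_affine hDi (hc j).ne' _
  have hg0 : ∫ u, g u = 0 := by
    rw [hg, integral_comp_affine _ (hc j), hD0 κ hκm, mul_zero]
  have hFc : Continuous (fracInt κ ψ) := continuous_iff_continuousAt.2 fun x =>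
    (fracInt_hasDerivAt (by linarith) (hψ.contDiff.of_le (by norm_num))
      hψ.hasCompactSupport x).continuousAt
  set f : ℤ × ℤ → ℝ → ℝ := fun p u =>
    (seriesTerm α ψ ε u v p - seriesTerm α ψ ε t v p) * g u with hf
  have hf_eq : ∀ p u, f p u = (2 : ℝ) ^ (-((p.1 : ℝ) * v)) * ε p.1 p.2 *
      ((fracInt κ ψ ((2 : ℝ) ^ p.1 * u - p.2) - fracInt κ ψ ((2 : ℝ) ^ p.1 * t - p.2)) * g u) := by
    intro p u
    simp only [hf, seriesTerm, waveletPsi_eq_fracInt, ← hκ]; ring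
  have hfc : ∀ p, Continuous (f p) := by
    intro p
    rw [show f p = _ from funext (hf_eq p)]
    have : Continuous fun u : ℝ => fracInt κ ψ ((2 : ℝ) ^ p.1 * u - p.2) :=
      hFc.comp (by fun_prop)
    fun_prop
  have hS : ∀ u, HasSum (fun p => f p u)
      ((waveletSeries α ψ ε u v - waveletSeries α ψ ε t v) * g u) := fun u =>
    ((hsum u).hasSum.sub (hsum t).hasSum).mul_right _
  -- absolute convergence: the increments of the series grow at most quadratically (order `θ = 0`),
  -- which the decay of the dual function compensates
  have hfin : ∑' p, ∫⁻ u, ‖f p u‖ₑ ≠ ∞ := by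
    rw [← lintegral_tsum fun p => (hfc p).measurable.enorm.aemeasurable]
    have hG := (integrable_growth_mul_decayWeight (hc j) k t K).const_mul C
    refine ne_of_lt (lt_of_le_of_lt (lintegral_mono fun u => ?_) hG.lintegral_lt_top)
    have h1 : ∀ p, ‖f p u‖ₑ = ENNReal.ofReal |f p u| := fun p => Real.enorm_eq_ofReal_abs _
    have h2 : Summable fun p => |f p u| := by
      simp only [hf, abs_mul]
      exact (hinc u t).1.mul_right _
    simp_rw [h1]
    rw [← ENNReal.ofReal_tsum_of_nonneg (fun p => abs_nonneg _) h2]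
    refine ENNReal.ofReal_le_ofReal ?_
    simp only [hf, abs_mul]
    rw [tsum_mul_right]
    have h3 := (hinc u t).2.1
    rw [Real.rpow_zero] at h3
    have h4 := hD κ hκm ((2 : ℝ) ^ j * u - k)
    calc _ ≤ (C * ((1 + |u - t|) * (2 + |u| + |t|))) *
          (K * decayWeight ((2 : ℝ) ^ j * u - k)) := by
          gcongr
      _ = _ := by ring
  have hint := integral_tsum (μ := volume) (fun p => (hfc p).aestronglyMeasurable) hfin
  simp_rw [fun u => (hS u).tsum_eq] at hint
  rw [hint]
  have hterm : ∀ p, ∫ u, f p u = if p = (j, k) then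
      (2 : ℝ) ^ (-((j : ℝ) * v)) * ε j k * (betaConst κ * ((2 : ℝ) ^ j)⁻¹) else 0 := by
    rintro ⟨j', k'⟩
    simp_rw [hf_eq, sub_mul]
    have hb : Integrable fun u => fracInt κ ψ ((2 : ℝ) ^ j' * u - k') * g u := by
      refine hgi.bdd_mul (c := |fracInt κ ψ 0| + K * 2)
        (hFc.comp (by fun_prop)).aestronglyMeasurable (Eventually.of_forall fun u => ?_)
      set x := (2 : ℝ) ^ j' * u - k'
      have h1 := hF κ hκm x 0
      have h2 : min 1 |x - 0| * (decayWeight x + decayWeight 0) ≤ 1 * (1 + 1) := by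
        have := (decayWeight_pos x).le
        have := (decayWeight_pos 0).le
        gcongr
        · exact min_le_left _ _
        · exact decayWeight_le_one _
        · exact decayWeight_le_one _
      have h3 : |fracInt κ ψ x| ≤ |fracInt κ ψ 0| + |fracInt κ ψ x - fracInt κ ψ 0| := by
        have := abs_add_le (fracInt κ ψ 0) (fracInt κ ψ x - fracInt κ ψ 0)
        simpa using this
      rw [Real.norm_eq_abs]
      nlinarith [mul_le_mul_of_nonneg_left h2 hK]
    rw [integral_const_mul, integral_sub hb (hgi.const_mul _), integral_const_mul, hg0, mul_zero,
      sub_zero, hg, integral_fracInt_mul_dualWavelet hκ0.le hκ1 (hψ.contDiff.of_le (by norm_num))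
        hψ.hasCompactSupport (hc j) (hc j'), hψ.integral_mul_eq]
    split_ifs with h
    · obtain ⟨rfl, rfl⟩ := Prod.mk.inj h
      have : ((2 : ℝ) ^ j') ^ (1 + κ) * ((2 : ℝ) ^ j') ^ (-(1 + κ)) = 1 := by
        rw [← Real.rpow_add (hc j'), add_neg_cancel, Real.rpow_zero]
      rw [this, one_mul]
    · simp
  simp_rw [hterm]
  rw [tsum_ite_eq]

/-- If, at the dyadic point `t = k / 2^j`, the series with parameter `v` satisfies a Hölder
condition of order `γ`, then the coefficient `ε j k` is small. -/
theorem exists_abs_coeff_le (hψ : IsCompactMotherWavelet ψ) (hε : SlowlyGrowing α ε)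
    (hα : 1 < α) (ha : 1 / α < a) (hb : b < 1) {γ : ℝ} (hγ0 : 0 ≤ γ) (hγ1 : γ ≤ 1) :
    ∃ C, 0 ≤ C ∧ ∀ v ∈ Icc a b, ∀ (j : ℕ) (k : ℤ) (D : ℝ), 0 ≤ D →
      (∀ u, |waveletSeries α ψ ε u v - waveletSeries α ψ ε ((k : ℝ) / 2 ^ j) v| ≤
        D * (|u - (k : ℝ) / 2 ^ j| ^ γ + |u - (k : ℝ) / 2 ^ j| ^ 2)) →
      |ε j k| ≤ C * D * 2 ^ ((j : ℝ) * (v - γ)) := by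
  have hα' : 0 < 1 / α := by positivity
  obtain ⟨K, hK, -, -, hD, -, -⟩ := hψ.exists_fracInt_bounds (κ₁ := a - 1 / α) (κ₂ := b - 1 / α)
    (by linarith) (by linarith)
  set W := ∫ x : ℝ, ((1 + |x|) ^ 2)⁻¹ with hW
  have hW0 : 0 ≤ W := integral_nonneg fun x => by positivity
  refine ⟨4 * K * W, by positivity, fun v hv j k D hD0 h => ?_⟩
  have hκ : v - 1 / α ∈ Icc (a - 1 / α) (b - 1 / α) := ⟨by linarith [hv.1], by linarith [hv.2]⟩
  set t := (k : ℝ) / 2 ^ j with ht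
  set c : ℝ := 2 ^ j with hc
  have hc0 : 0 < c := by positivity
  have hc1 : 1 ≤ c := one_le_pow₀ (by norm_num)
  have key := integral_waveletSeries_sub_mul_dualWavelet hψ hε hα (by linarith [hv.1] : 1 / α < v)
    (by linarith [hv.2]) j k t
  have hcz : (2 : ℝ) ^ (j : ℤ) = c := by rw [zpow_natCast]
  rw [hcz] at key
  have hcg : 0 < c ^ (-γ) := by positivity
  have hbound : |∫ u, (waveletSeries α ψ ε u v - waveletSeries α ψ ε t v) *
        dualWavelet (v - 1 / α) ψ (c * u - k)| ≤ (2 * D * K * c ^ (-γ)) * (c⁻¹ * W) := by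
    rw [hW, ← integral_comp_affine _ hc0 k, ← integral_const_mul, ← Real.norm_eq_abs]
    refine norm_integral_le_of_norm_le ((integrable_comp_affine integrable_one_add_abs_inv_sq
      hc0.ne' k).const_mul _) (Eventually.of_forall fun u => ?_)
    -- in the variable `x = 2^j u - k` the Hölder condition at `t` is homogeneous, since `u - t = x / 2^j`
    set x := c * u - k with hx
    have hut : u - t = x / c := by rw [hx, ht]; field_simp
    have h1 := h u
    have h2 := hD _ hκ x
    have h3 : |u - t| ^ γ + |u - t| ^ 2 ≤ 2 * c ^ (-γ) * (1 + |x|) ^ 2 := by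
      rw [hut, abs_div, abs_of_pos hc0]
      have hx0 := abs_nonneg x
      have e1 : (|x| / c) ^ γ ≤ c ^ (-γ) * (1 + |x|) ^ 2 := by
        rw [Real.div_rpow hx0 hc0.le, Real.rpow_neg hc0.le, div_eq_inv_mul]
        gcongr
        calc |x| ^ γ ≤ (1 + |x|) ^ γ := by gcongr; linarith
          _ ≤ (1 + |x|) ^ (2 : ℝ) := by
            apply Real.rpow_le_rpow_of_exponent_le <;> linarith
          _ = _ := by norm_cast
      have e2 : (|x| / c) ^ 2 ≤ c ^ (-γ) * (1 + |x|) ^ 2 := by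
        have e3 : c⁻¹ ^ 2 ≤ c ^ (-γ) := by
          have : c⁻¹ ^ 2 = c ^ (-2 : ℝ) := by
            rw [Real.rpow_neg hc0.le, inv_pow]; norm_cast
          rw [this]
          exact Real.rpow_le_rpow_of_exponent_le hc1 (by linarith)
        rw [div_eq_inv_mul, mul_pow]
        gcongr
        linarith
      linarith
    rw [Real.norm_eq_abs, abs_mul]
    calc _ ≤ (D * (2 * c ^ (-γ) * (1 + |x|) ^ 2)) * (K * decayWeight x) := by
          refine mul_le_mul (h1.trans (mul_le_mul_of_nonneg_left h3 hD0)) h2 (abs_nonneg _) ?_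
          positivity
      _ = _ := by
        unfold decayWeight
        have : 1 + |x| ≠ 0 := by positivity
        field_simp
  rw [key] at hbound
  have hB := half_le_betaConst (κ := v - 1 / α) (by linarith [hv.1]) (by linarith [hv.2])
  have hp : (0 : ℝ) < 2 ^ (-(((j : ℤ) : ℝ) * v)) := by positivity
  rw [abs_mul, abs_mul, abs_mul, abs_of_pos hp, abs_of_pos (inv_pos.2 hc0),
    abs_of_pos (by linarith : 0 < betaConst (v - 1 / α))] at hbound
  have h5 : (2 : ℝ) ^ (-(((j : ℤ) : ℝ) * v)) * |ε j k| * (1 / 2 * c⁻¹) ≤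
      (2 * D * K * c ^ (-γ)) * (c⁻¹ * W) := by
    refine le_trans ?_ hbound
    gcongr
  have h6 : (2 : ℝ) ^ ((j : ℝ) * (v - γ)) * 2 ^ (-(((j : ℤ) : ℝ) * v)) = c ^ (-γ) := by
    rw [← Real.rpow_add (by norm_num), hc, ← Real.rpow_natCast, ← Real.rpow_mul (by norm_num)]
    congr 1
    push_cast; ring
  rw [← h6] at h5
  have h7 : (2 : ℝ) ^ (-(((j : ℤ) : ℝ) * v)) * (1 / 2 * c⁻¹) * |ε j k| ≤
      (2 : ℝ) ^ (-(((j : ℤ) : ℝ) * v)) * (1 / 2 * c⁻¹) *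
        (4 * K * W * D * 2 ^ ((j : ℝ) * (v - γ))) := by
    linarith
  exact le_of_mul_le_mul_left h7 (by positivity)

end Recovery

/-! ### Hölder exponents of the paths -/

lemma holderOnWith_of_abs_sub_le {f : ℝ → ℝ} {s : Set ℝ} {C : ℝ} {r : ℝ≥0}
    (h : ∀ x ∈ s, ∀ y ∈ s, |f x - f y| ≤ C * |x - y| ^ (r : ℝ)) :
    HolderOnWith C.toNNReal r f s := by
  intro x hx y hy
  rw [edist_dist, edist_dist, Real.dist_eq, Real.dist_eq,
    ENNReal.ofReal_rpow_of_nonneg (abs_nonneg _) r.coe_nonneg, ← ENNReal.ofReal_coe_nnreal (p := C.toNNReal),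
    ← ENNReal.ofReal_mul (by positivity)]
  refine ENNReal.ofReal_le_ofReal ((h x hx y hy).trans ?_)
  gcongr
  exact Real.le_coe_toNNReal C

lemma HolderOnWith.abs_sub_le {f : ℝ → ℝ} {s : Set ℝ} {C r : ℝ≥0} (h : HolderOnWith C r f s)
    {x y : ℝ} (hx : x ∈ s) (hy : y ∈ s) : |f x - f y| ≤ C * |x - y| ^ (r : ℝ) := by
  have := h.dist_le hx hy
  rwa [Real.dist_eq, Real.dist_eq] at this

lemma exists_holderOnWith_of_lt_localHolderExponent {f : ℝ → ℝ} {t₀ x : ℝ} (hx : 0 ≤ x)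
    (h : ENNReal.ofReal x < localHolderExponent f t₀) :
    ∃ M₁ M₂ : ℝ, M₁ < t₀ ∧ t₀ < M₂ ∧ ∃ C ρ : ℝ≥0, x < ρ ∧ HolderOnWith C ρ f (Icc M₁ M₂) := by
  simp only [localHolderExponent, uniformHolderExponent, lt_iSup_iff] at h
  obtain ⟨M₁, M₂, ⟨h1, h2⟩, ρ, ⟨C, hC⟩, hρ⟩ := h
  refine ⟨M₁, M₂, h1, h2, C, ρ, ?_, hC⟩
  rw [← ENNReal.ofReal_coe_nnreal] at hρ
  exact (ENNReal.ofReal_lt_ofReal_iff_of_nonneg hx).1 hρ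

lemma le_localHolderExponent {f : ℝ → ℝ} {t₀ M₁ M₂ : ℝ} (h₁ : M₁ < t₀) (h₂ : t₀ < M₂)
    {C ρ : ℝ≥0} (h : HolderOnWith C ρ f (Icc M₁ M₂)) :
    (ρ : ℝ≥0∞) ≤ localHolderExponent f t₀ := by
  unfold localHolderExponent uniformHolderExponent
  refine le_iSup₂_of_le M₁ M₂ (le_iSup_of_le ⟨h₁, h₂⟩ ?_)
  exact le_iSup₂_of_le ρ ⟨C, h⟩ le_rfl

section Paths

variable {α : ℝ} {ψ : ℝ → ℝ} {ε : ℤ → ℤ → ℝ} {a b : ℝ} {H : ℝ → ℝ}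

theorem continuous_waveletSeries_comp (hψ : IsCompactMotherWavelet ψ) (hε : SlowlyGrowing α ε)
    (hα : 1 < α) (ha : 1 / α < a) (hb : b < 1) (hH : Continuous H) (hHm : ∀ t, H t ∈ Icc a b) :
    Continuous fun t => waveletSeries α ψ ε t (H t) := by
  have hab : a ≤ b := (hHm 0).1.trans (hHm 0).2
  set θ := (a - 1 / α) / 2 with hθ
  have hθ0 : 0 < θ := by linarith
  obtain ⟨C₁, hC₁, h₁⟩ := exists_waveletSeries_bounds hψ hε hα ha hab hb hθ0.le (by linarith)
  obtain ⟨C₂, hC₂, h₂⟩ := exists_waveletSeries_sub_right_le hψ hε hα ha hab hb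
  rw [continuous_iff_continuousAt]
  intro t
  have hlim : Tendsto (fun s => C₁ * ((|s - t| ^ θ + |s - t|) * (2 + |s| + |t|)) +
      C₂ * |H s - H t| * ((1 + |t|) * (2 + |t|))) (𝓝 t) (𝓝 0) := by
    have hc : Continuous fun s => C₁ * ((|s - t| ^ θ + |s - t|) * (2 + |s| + |t|)) +
        C₂ * |H s - H t| * ((1 + |t|) * (2 + |t|)) := by
      have : Continuous fun s => |s - t| ^ θ :=
        (Real.continuous_rpow_const hθ0.le).comp (by fun_prop)
      fun_prop
    have := hc.tendsto t
    simpa [Real.zero_rpow hθ0.ne'] using this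
  rw [ContinuousAt, tendsto_iff_norm_sub_tendsto_zero]
  refine squeeze_zero (fun _ => norm_nonneg _) (fun s => ?_) hlim
  have e1 := ((h₁ (H s) (hHm s)).2 s t).2.2
  have e2 := h₂ (H s) (hHm s) (H t) (hHm t) t
  calc _ = |(waveletSeries α ψ ε s (H s) - waveletSeries α ψ ε t (H s)) +
        (waveletSeries α ψ ε t (H s) - waveletSeries α ψ ε t (H t))| := by
        rw [Real.norm_eq_abs]; congr 1; ring
    _ ≤ _ := (abs_add_le _ _).trans (add_le_add e1 e2)

/-- A power of a number in `[0, 1]` decreases with the exponent, also at `0` if both exponents are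
positive. -/
lemma rpow_le_rpow_of_le_one {x r r' : ℝ} (hx0 : 0 ≤ x) (hx1 : x ≤ 1) (hr : 0 ≤ r) (h : r ≤ r') :
    x ^ r' ≤ x ^ r :=
  Real.rpow_le_rpow_of_exponent_ge_of_imp hx0 hx1 h (by intro _ h0; linarith)

lemma exists_small_interval {M₁ M₂ t₀ x : ℝ} (h₁ : M₁ < t₀) (h₂ : t₀ < M₂) {p : ℝ → Prop}
    (hp : ∀ᶠ t in 𝓝 t₀, p t) (hx : 0 < x) :
    ∃ δ, 0 < δ ∧ δ ≤ x ∧ Icc (t₀ - δ) (t₀ + δ) ⊆ Icc M₁ M₂ ∧ ∀ t ∈ Icc (t₀ - δ) (t₀ + δ), p t := by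
  obtain ⟨η, hη, hpη⟩ := Metric.eventually_nhds_iff.1 hp
  refine ⟨min x (min (η / 2) (min (t₀ - M₁) (M₂ - t₀))), ?_, min_le_left _ _, ?_, ?_⟩
  · exact lt_min hx (lt_min (by linarith) (lt_min (by linarith) (by linarith)))
  all_goals
    set δ := min x (min (η / 2) (min (t₀ - M₁) (M₂ - t₀))) with hδ
    have d2 : δ ≤ η / 2 := (min_le_right _ _).trans (min_le_left _ _)
    have d3 : δ ≤ t₀ - M₁ := (min_le_right _ _).trans ((min_le_right _ _).trans (min_le_left _ _))
    have d4 : δ ≤ M₂ - t₀ := (min_le_right _ _).trans ((min_le_right _ _).trans (min_le_right _ _))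
    intro t ht
  · exact ⟨by linarith [ht.1], by linarith [ht.2]⟩
  · apply hpη
    rw [Real.dist_eq]
    exact lt_of_le_of_lt (abs_le.2 ⟨by linarith [ht.1], by linarith [ht.2]⟩)
      (by linarith : δ < η)

/-- The local Hölder exponent of the path at `t₀` is at least `H(t₀) - 1/α`. -/
theorem le_localHolderExponent_waveletSeries (hψ : IsCompactMotherWavelet ψ)
    (hε : SlowlyGrowing α ε) (hα : 1 < α) (hα₂ : α < 2) (ha : 1 / α < a) (hb : b < 1)
    (hH : Continuous H) (hHm : ∀ t, H t ∈ Icc a b) {t₀ : ℝ}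
    (ht₀ : ENNReal.ofReal (1 / α) < localHolderExponent H t₀) :
    ENNReal.ofReal (H t₀ - 1 / α) ≤
      localHolderExponent (fun t => waveletSeries α ψ ε t (H t)) t₀ := by
  have hα' : 0 < 1 / α := by positivity
  have hα2 : 1 / 2 < 1 / α := one_div_lt_one_div_of_lt (by linarith) hα₂
  obtain ⟨M₁, M₂, hM₁, hM₂, CH, ρ, hρ, hHol⟩ :=
    exists_holderOnWith_of_lt_localHolderExponent hα'.le ht₀
  refine ENNReal.le_of_forall_nnreal_lt fun r hr => ?_
  have hr' : (r : ℝ) < H t₀ - 1 / α := by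
    rw [← ENNReal.ofReal_coe_nnreal] at hr
    exact (ENNReal.ofReal_lt_ofReal_iff_of_nonneg r.2).1 hr
  have hr0 : (0 : ℝ) ≤ r := r.2
  -- near `t₀` the parameter stays above `a'`, and `r < a' - 1/α`
  set a' := max a ((r + 1 / α + H t₀) / 2) with ha'
  have haa : a ≤ a' := le_max_left _ _
  have har : (r : ℝ) < a' - 1 / α := by
    linarith [le_max_right a ((r + 1 / α + H t₀) / 2)]
  have hev : ∀ᶠ t in 𝓝 t₀, (r + 1 / α + H t₀) / 2 < H t :=
    hH.continuousAt.eventually_const_lt (by linarith)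
  obtain ⟨δ, hδ, hδ1, hsub, hJ⟩ := exists_small_interval hM₁ hM₂ hev (by norm_num : (0:ℝ) < 1 / 2)
  have hHJ : ∀ t ∈ Icc (t₀ - δ) (t₀ + δ), H t ∈ Icc a' b := fun t ht =>
    ⟨max_le (hHm t).1 (hJ t ht).le, (hHm t).2⟩
  have hab : a' ≤ b := by
    have := hHJ t₀ ⟨by linarith, by linarith⟩
    exact this.1.trans this.2
  obtain ⟨C₁, hC₁, h₁⟩ := exists_waveletSeries_bounds hψ hε hα (ha.trans_le haa) hab hb hr0 har
  obtain ⟨C₂, hC₂, h₂⟩ := exists_waveletSeries_sub_right_le hψ hε hα (ha.trans_le haa) hab hb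
  set B := |t₀| + 1 with hB
  have hBt : ∀ t ∈ Icc (t₀ - δ) (t₀ + δ), |t| ≤ B := by
    intro t ht
    have : |t - t₀| ≤ 1 := abs_le.2 ⟨by linarith [ht.1], by linarith [ht.2]⟩
    have := abs_sub_abs_le_abs_sub t t₀
    linarith
  refine le_localHolderExponent (M₁ := t₀ - δ) (M₂ := t₀ + δ) (by linarith) (by linarith)
    (holderOnWith_of_abs_sub_le (C := C₁ * (2 * (2 + B + B)) + C₂ * CH * ((1 + B) * (2 + B)))
    fun x hx y hy => ?_)
  have hxy : |x - y| ≤ 1 := abs_le.2 ⟨by linarith [hx.1, hy.2], by linarith [hx.2, hy.1]⟩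
  have hxy0 := abs_nonneg (x - y)
  have e1 := ((h₁ (H x) (hHJ x hx)).2 x y).2.2
  have e2 := h₂ (H x) (hHJ x hx) (H y) (hHJ y hy) y
  have e3 := hHol.abs_sub_le (hsub hx) (hsub hy)
  -- `r < H t₀ - 1/α < 1 - 1/α < 1/2 < 1/α < ρ`
  have e4 : |x - y| ^ (ρ : ℝ) ≤ |x - y| ^ (r : ℝ) :=
    rpow_le_rpow_of_le_one hxy0 hxy hr0 (by linarith [(hHm t₀).2])
  have e5 : |x - y| ≤ |x - y| ^ (r : ℝ) := by
    simpa using rpow_le_rpow_of_le_one hxy0 hxy hr0 (by linarith [(hHm t₀).2] : (r : ℝ) ≤ 1)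
  have hB0 : 0 ≤ B := by positivity
  have hp0 : 0 ≤ |x - y| ^ (r : ℝ) := Real.rpow_nonneg hxy0 _
  calc _ = |(waveletSeries α ψ ε x (H x) - waveletSeries α ψ ε y (H x)) +
        (waveletSeries α ψ ε y (H x) - waveletSeries α ψ ε y (H y))| := by congr 1; ring
    _ ≤ C₁ * ((|x - y| ^ (r : ℝ) + |x - y|) * (2 + |x| + |y|)) +
        C₂ * |H x - H y| * ((1 + |y|) * (2 + |y|)) :=
        (abs_add_le _ _).trans (add_le_add e1 e2)
    _ ≤ C₁ * ((|x - y| ^ (r : ℝ) + |x - y| ^ (r : ℝ)) * (2 + B + B)) +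
        C₂ * (CH * |x - y| ^ (r : ℝ)) * ((1 + B) * (2 + B)) := by
        have b1 := hBt x hx
        have b2 := hBt y hy
        gcongr
        exact e3.trans (by gcongr)
    _ = _ := by ring

/-- If the path `u ↦ X u (H u)` and the parameter `H` are Hölder of orders at least `γ` on
`[t₀ - δ, t₀ + δ]`, then so is `X · (H t)` at every `t` near `t₀`, with a constant that does not
depend on `t`; far from `t` its increments grow at most quadratically. -/
lemma exists_frozen_increment_le {X : ℝ → ℝ → ℝ} {C₁ C₂ CY CH γ ρ ρH t₀ δ : ℝ} (hC₁ : 0 ≤ C₁)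
    (hC₂ : 0 ≤ C₂) (hCY : 0 ≤ CY) (hCH : 0 ≤ CH) (hδ : 0 < δ) (hδ1 : δ ≤ 1 / 2) (hγ : 0 ≤ γ)
    (hγρ : γ ≤ ρ) (hγH : γ ≤ ρH)
    (h₁ : ∀ t u u', |X u (H t) - X u' (H t)| ≤ C₁ * ((1 + |u - u'|) * (2 + |u| + |u'|)))
    (h₂ : ∀ t t' u, |X u (H t) - X u (H t')| ≤ C₂ * |H t - H t'| * ((1 + |u|) * (2 + |u|)))
    (hY : ∀ u ∈ Icc (t₀ - δ) (t₀ + δ), ∀ t ∈ Icc (t₀ - δ) (t₀ + δ),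
      |X u (H u) - X t (H t)| ≤ CY * |u - t| ^ ρ)
    (hHol : ∀ u ∈ Icc (t₀ - δ) (t₀ + δ), ∀ t ∈ Icc (t₀ - δ) (t₀ + δ),
      |H u - H t| ≤ CH * |u - t| ^ ρH) :
    ∃ D, 0 ≤ D ∧ ∀ t ∈ Icc (t₀ - δ / 2) (t₀ + δ / 2), ∀ u,
      |X u (H t) - X t (H t)| ≤ D * (|u - t| ^ γ + |u - t| ^ 2) := by
  set B := |t₀| + 1 with hB
  have hB0 : 0 ≤ B := by positivity
  have hBt : ∀ t ∈ Icc (t₀ - δ) (t₀ + δ), |t| ≤ B := by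
    intro t ht
    have : |t - t₀| ≤ 1 := abs_le.2 ⟨by linarith [ht.1], by linarith [ht.2]⟩
    have := abs_sub_abs_le_abs_sub t t₀
    linarith
  set D₁ := CY + C₂ * CH * ((1 + B) * (2 + B)) with hD₁
  set D₂ := C₁ * ((1 / (δ / 2) + 1) * ((2 + 2 * B) * (1 / (δ / 2)) + 1)) with hD₂
  have hD₁0 : 0 ≤ D₁ := by positivity
  have hD₂0 : 0 ≤ D₂ := by positivity
  refine ⟨D₁ + D₂, by positivity, fun t ht u => ?_⟩
  have htJ : t ∈ Icc (t₀ - δ) (t₀ + δ) := ⟨by linarith [ht.1], by linarith [ht.2]⟩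
  have hx0 := abs_nonneg (u - t)
  have hxγ : 0 ≤ |u - t| ^ γ := Real.rpow_nonneg hx0 _
  have hx2 : 0 ≤ |u - t| ^ 2 := by positivity
  by_cases hu : u ∈ Icc (t₀ - δ) (t₀ + δ)
  · have hut : |u - t| ≤ 1 := abs_le.2 ⟨by linarith [hu.1, htJ.2], by linarith [hu.2, htJ.1]⟩
    have e1 := hY u hu t htJ
    have e2 := h₂ t u u
    have e3 := hHol u hu t htJ
    have e4 : |u - t| ^ ρ ≤ |u - t| ^ γ := rpow_le_rpow_of_le_one hx0 hut hγ hγρ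
    have e5 : |u - t| ^ ρH ≤ |u - t| ^ γ := rpow_le_rpow_of_le_one hx0 hut hγ hγH
    have e6 : |X u (H t) - X t (H t)| ≤
        D₁ * |u - t| ^ γ := by
      calc _ = |(X u (H t) - X u (H u)) +
            (X u (H u) - X t (H t))| := by congr 1; ring
        _ ≤ C₂ * |H t - H u| * ((1 + |u|) * (2 + |u|)) + CY * |u - t| ^ ρ :=
            (abs_add_le _ _).trans (add_le_add e2 e1)
        _ ≤ C₂ * (CH * |u - t| ^ γ) * ((1 + B) * (2 + B)) + CY * |u - t| ^ γ := by
            have b1 := hBt u hu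
            rw [abs_sub_comm (H t)]
            gcongr
            exact e3.trans (by gcongr)
        _ = _ := by rw [hD₁]; ring
    refine e6.trans ?_
    nlinarith [mul_nonneg hD₁0 hx2, mul_nonneg hD₂0 hxγ, mul_nonneg hD₂0 hx2]
  · have hx : δ / 2 ≤ |u - t| := by
      by_contra! hlt
      have := abs_lt.1 hlt
      exact hu ⟨by linarith [ht.1], by linarith [ht.2]⟩
    have e1 := h₁ t u t
    have hone : 1 ≤ 1 / (δ / 2) * |u - t| := by
      rw [one_div, ← div_eq_inv_mul, one_le_div (by linarith)]
      exact hx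
    have hb1 := hBt t htJ
    have hu' : |u| ≤ |u - t| + |t| := by
      have := abs_add_le (u - t) t
      simpa using this
    have e2 : 1 + |u - t| ≤ (1 / (δ / 2) + 1) * |u - t| := by linarith
    have e3 : 2 + |u| + |t| ≤ ((2 + 2 * B) * (1 / (δ / 2)) + 1) * |u - t| := by
      have := mul_le_mul_of_nonneg_left hone (by linarith : 0 ≤ 2 + 2 * B)
      linarith
    have e4 : |X u (H t) - X t (H t)| ≤
        D₂ * |u - t| ^ 2 := by
      calc _ ≤ C₁ * (((1 / (δ / 2) + 1) * |u - t|) *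
            (((2 + 2 * B) * (1 / (δ / 2)) + 1) * |u - t|)) := e1.trans (by gcongr)
        _ = _ := by rw [hD₂]; ring
    refine e4.trans ?_
    nlinarith [mul_nonneg hD₁0 hx2, mul_nonneg hD₂0 hxγ, mul_nonneg hD₁0 hxγ]

/-- The local Hölder exponent of the path at `t₀` is at most `H(t₀) - 1/α`, provided that in every
interval the coefficients `ε j k` with `k / 2^j` in the interval reach size almost `2^(j/α)`. -/
theorem localHolderExponent_waveletSeries_le (hψ : IsCompactMotherWavelet ψ)
    (hε : SlowlyGrowing α ε) (hα : 1 < α) (hα₂ : α < 2) (ha : 1 / α < a) (hb : b < 1)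
    (hH : Continuous H) (hHm : ∀ t, H t ∈ Icc a b)
    (hlarge : ∀ p q : ℚ, p < q → ∀ N C : ℕ, ∃ (j : ℕ) (k : ℤ),
      (k : ℝ) / 2 ^ j ∈ Icc (p : ℝ) q ∧
      (C : ℝ) * 2 ^ ((j : ℝ) * (1 / α - 1 / ((N : ℝ) + 1))) < |ε j k|) {t₀ : ℝ}
    (ht₀ : ENNReal.ofReal (1 / α) < localHolderExponent H t₀) :
    localHolderExponent (fun t => waveletSeries α ψ ε t (H t)) t₀ ≤
      ENNReal.ofReal (H t₀ - 1 / α) := by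
  have hα' : 0 < 1 / α := by positivity
  have hα1 : 1 / α < 1 := by rw [div_lt_one (by linarith)]; exact hα
  have hα2 : 1 / 2 < 1 / α := one_div_lt_one_div_of_lt (by linarith) hα₂
  have hab : a ≤ b := (hHm 0).1.trans (hHm 0).2
  obtain ⟨M₁, M₂, hM₁, hM₂, CH, ρH, hρH, hHol⟩ :=
    exists_holderOnWith_of_lt_localHolderExponent hα'.le ht₀
  have h0 : 0 < H t₀ - 1 / α := by linarith [(hHm t₀).1]
  by_contra! hcon
  obtain ⟨N₁, N₂, hN₁, hN₂, CY, ρ, hρ, hY⟩ :=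
    exists_holderOnWith_of_lt_localHolderExponent h0.le hcon
  -- a common order of the path and of `H`; it exceeds `H t₀ - 1/α` because `H t₀ < 1 < 2/α`
  set γ := min (ρ : ℝ) (1 / α) with hγ
  have hγ0 : H t₀ - 1 / α < γ := lt_min hρ (by linarith [(hHm t₀).2])
  have hγ1 : γ ≤ 1 := (min_le_right _ _).trans hα1.le
  have hγρ : γ ≤ ρ := min_le_left _ _
  have hγH : γ ≤ ρH := (min_le_right _ _).trans hρH.le
  have hγnn : 0 ≤ γ := by linarith
  set η := (γ - (H t₀ - 1 / α)) / 2 with hη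
  have hη0 : 0 < η := by linarith
  have hev : ∀ᶠ t in 𝓝 t₀, H t < H t₀ + η := hH.continuousAt.eventually_lt_const (by linarith)
  obtain ⟨δ, hδ, hδ1, hsub, hJ⟩ := exists_small_interval (max_lt hM₁ hN₁) (lt_min hM₂ hN₂) hev
    (by norm_num : (0 : ℝ) < 1 / 2)
  have hsubM : Icc (t₀ - δ) (t₀ + δ) ⊆ Icc M₁ M₂ :=
    hsub.trans (Icc_subset_Icc (le_max_left _ _) (min_le_left _ _))
  have hsubN : Icc (t₀ - δ) (t₀ + δ) ⊆ Icc N₁ N₂ :=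
    hsub.trans (Icc_subset_Icc (le_max_right _ _) (min_le_right _ _))
  obtain ⟨C₁, hC₁, h₁⟩ := exists_waveletSeries_bounds hψ hε hα ha hab hb le_rfl (by linarith)
  obtain ⟨C₂, hC₂, h₂⟩ := exists_waveletSeries_sub_right_le hψ hε hα ha hab hb
  obtain ⟨C₃, hC₃, h₃⟩ := exists_abs_coeff_le hψ hε hα ha hb hγnn hγ1
  obtain ⟨D, hD, hmain⟩ := exists_frozen_increment_le (X := waveletSeries α ψ ε) (H := H) (t₀ := t₀)
    hC₁ hC₂ CY.coe_nonneg CH.coe_nonneg hδ hδ1 hγnn hγρ hγH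
    (fun t u u' => by
      have := ((h₁ (H t) (hHm t)).2 u u').2.2
      rwa [Real.rpow_zero] at this)
    (fun t t' u => h₂ (H t) (hHm t) (H t') (hHm t') u)
    (fun u hu t ht => hY.abs_sub_le (hsubN hu) (hsubN ht))
    (fun u hu t ht => hHol.abs_sub_le (hsubM hu) (hsubM ht))
  obtain ⟨p, hp1, hp2⟩ := exists_rat_btwn (by linarith : t₀ - δ / 2 < t₀)
  obtain ⟨q, hq1, hq2⟩ := exists_rat_btwn (by linarith : t₀ < t₀ + δ / 2)
  obtain ⟨N, hN⟩ := exists_nat_one_div_lt hη0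
  obtain ⟨C, hC⟩ := exists_nat_ge (C₃ * D)
  obtain ⟨j, k, hjk, hbig⟩ := hlarge p q (by exact_mod_cast hp2.trans hq1) N C
  have htk : (k : ℝ) / 2 ^ j ∈ Icc (t₀ - δ / 2) (t₀ + δ / 2) :=
    ⟨hp1.le.trans hjk.1, hjk.2.trans hq2.le⟩
  have hsmall := h₃ (H ((k : ℝ) / 2 ^ j)) (hHm _) j k D hD (hmain _ htk)
  have hexp : (2 : ℝ) ^ ((j : ℝ) * (H ((k : ℝ) / 2 ^ j) - γ)) ≤
      2 ^ ((j : ℝ) * (1 / α - 1 / ((N : ℝ) + 1))) := by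
    apply Real.rpow_le_rpow_of_exponent_le (by norm_num)
    have := hJ ((k : ℝ) / 2 ^ j) ⟨by linarith [htk.1], by linarith [htk.2]⟩
    apply mul_le_mul_of_nonneg_left _ (Nat.cast_nonneg j)
    linarith
  refine absurd hbig (not_lt.2 (hsmall.trans ?_))
  gcongr

end Paths

/-! ### Integrals of simple functions -/

/-- The exponent of the characteristic function of `Z A` at `θ`. -/
noncomputable def stableExponent (α : ℝ) (β : ℝ → ℝ) (A : Set ℝ) (θ : ℝ) : ℂ :=
  -((|θ| ^ α : ℝ) : ℂ) * (((volume A).toReal : ℂ) -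
    Complex.I * ((Real.sign θ * Real.tan (Real.pi * α / 2) * ∫ s in A, β s : ℝ) : ℂ))

lemma stableExponent_re (α : ℝ) (β : ℝ → ℝ) (A : Set ℝ) (θ : ℝ) :
    (stableExponent α β A θ).re = -(|θ| ^ α * volume.real A) := by
  unfold stableExponent
  generalize Real.sign θ * Real.tan (Real.pi * α / 2) * ∫ s in A, β s = r
  rw [← Complex.ofReal_neg, Complex.re_ofReal_mul]
  simp [measureReal_def]

lemma norm_stableExponent_le {α : ℝ} {β : ℝ → ℝ} (hβ : ∀ s, β s ∈ Icc (-1 : ℝ) 1) {A : Set ℝ}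
    (hA : volume A < ∞) (θ : ℝ) :
    ‖stableExponent α β A θ‖ ≤
      (1 + |Real.tan (Real.pi * α / 2)|) * (|θ| ^ α * volume.real A) := by
  have h1 : |∫ s in A, β s| ≤ volume.real A := by
    have := norm_setIntegral_le_of_norm_le_const (μ := volume) (f := β) (C := 1) hA
      (fun x _ => abs_le.2 (hβ x))
    simpa using this
  have h2 : |Real.sign θ| ≤ 1 := by
    rcases Real.sign_apply_eq θ with h | h | h <;> rw [h] <;> norm_num
  have h0 : 0 ≤ |θ| ^ α := by positivity
  have hm : 0 ≤ volume.real A := measureReal_nonneg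
  unfold stableExponent
  rw [norm_mul, norm_neg, Complex.norm_real, Real.norm_of_nonneg h0]
  have h3 : ‖(((volume A).toReal : ℂ) -
      Complex.I * ((Real.sign θ * Real.tan (Real.pi * α / 2) * ∫ s in A, β s : ℝ) : ℂ))‖ ≤
      volume.real A + |Real.tan (Real.pi * α / 2)| * volume.real A := by
    refine (norm_sub_le _ _).trans ?_
    rw [norm_mul, Complex.norm_I, one_mul, Complex.norm_real, Complex.norm_real,
      Real.norm_of_nonneg ENNReal.toReal_nonneg, Real.norm_eq_abs, abs_mul, abs_mul]
    have : |Real.sign θ| * |Real.tan (Real.pi * α / 2)| * |∫ s in A, β s| ≤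
        1 * |Real.tan (Real.pi * α / 2)| * volume.real A := by gcongr
    rw [one_mul] at this
    exact add_le_add le_rfl this
  calc _ ≤ |θ| ^ α * (volume.real A + |Real.tan (Real.pi * α / 2)| * volume.real A) := by gcongr
    _ = _ := by ring

lemma norm_one_sub_exp_le {z : ℂ} (hz : z.re ≤ 0) : ‖1 - Complex.exp z‖ ≤ 2 * ‖z‖ := by
  rw [norm_sub_rev]
  rcases le_total ‖z‖ 1 with h | h
  · exact Complex.norm_exp_sub_one_le h
  · refine (norm_sub_le _ _).trans ?_
    rw [Complex.norm_exp, norm_one]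
    linarith [Real.exp_le_one_iff.2 hz]

lemma charFun_map_eq_integral {Ω : Type*} [MeasurableSpace Ω] {P : Measure Ω} {X : Ω → ℝ}
    (hX : AEMeasurable X P) (θ : ℝ) :
    charFun (P.map X) θ = ∫ ω, Complex.exp (((θ * X ω : ℝ) : ℂ) * Complex.I) ∂P := by
  rw [charFun_apply_real, integral_map hX (by fun_prop)]
  push_cast
  rfl

namespace IsStableRandomMeasure

variable {Ω : Type*} [MeasurableSpace Ω] {P : Measure Ω} {α : ℝ} {β : ℝ → ℝ}
  {Z : Set ℝ → Ω → ℝ}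

lemma ae_empty (hZ : IsStableRandomMeasure P α β Z) : ∀ᵐ ω ∂P, Z ∅ ω = 0 := by
  have h := hZ.sigma_additive (fun _ => ∅) (fun _ => MeasurableSet.empty) (by simp)
    (fun _ _ _ => by simp)
  filter_upwards [h] with ω hω
  simp only [Finset.sum_const, Finset.card_range, nsmul_eq_mul, iUnion_empty] at hω
  have h2 := ((tendsto_add_atTop_iff_nat 1).2 hω).sub hω
  have h3 : (fun n : ℕ => ((n + 1 : ℕ) : ℝ) * Z ∅ ω - (n : ℝ) * Z ∅ ω) = fun _ => Z ∅ ω := by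
    ext n; push_cast; ring
  rw [h3, sub_self] at h2
  exact tendsto_const_nhds_iff.1 h2

lemma ae_union (hZ : IsStableRandomMeasure P α β Z) {A B : Set ℝ} (hA : MeasurableSet A)
    (hB : MeasurableSet B) (hA' : volume A < ∞) (hB' : volume B < ∞) (hd : Disjoint A B) :
    ∀ᵐ ω ∂P, Z (A ∪ B) ω = Z A ω + Z B ω := by
  set S : ℕ → Set ℝ := fun n => if n = 0 then A else if n = 1 then B else ∅ with hS
  have hU : ⋃ n, S n = A ∪ B := by
    ext x
    simp only [mem_iUnion, mem_union]
    constructor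
    · rintro ⟨n, hn⟩
      simp only [hS] at hn
      split_ifs at hn
      · exact Or.inl hn
      · exact Or.inr hn
      · exact absurd hn (notMem_empty x)
    · rintro (h | h)
      · exact ⟨0, by simpa [hS] using h⟩
      · exact ⟨1, by simpa [hS] using h⟩
  have h := hZ.sigma_additive S
    (fun n => by simp only [hS]; split_ifs <;> simp [hA, hB])
    (by rw [hU]; exact (measure_union_le _ _).trans_lt (ENNReal.add_lt_top.2 ⟨hA', hB'⟩))
    (fun n m hnm => by
      simp only [hS]
      split_ifs with h1 h2 h3 h4 h5 <;> first | exact hd | exact hd.symm | omega | simp)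
  filter_upwards [h, hZ.ae_empty] with ω hω h0
  rw [hU] at hω
  refine tendsto_nhds_unique hω (tendsto_const_nhds.congr' ?_)
  filter_upwards [eventually_ge_atTop 2] with n hn
  obtain ⟨m, rfl⟩ := Nat.exists_eq_add_of_le' hn
  rw [Finset.sum_range_succ', Finset.sum_range_succ']
  have : ∀ i, Z (S (i + 1 + 1)) ω = 0 := fun i => by
    have : S (i + 1 + 1) = ∅ := by simp [hS]
    rw [this, h0]
  simp only [this, Finset.sum_const_zero]
  simp [hS, add_comm]

lemma ae_biUnion (hZ : IsStableRandomMeasure P α β Z) {ι : Type*} (s : Finset ι) (A : ι → Set ℝ)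
    (hA : ∀ i ∈ s, MeasurableSet (A i)) (hA' : ∀ i ∈ s, volume (A i) < ∞)
    (hd : (s : Set ι).PairwiseDisjoint A) :
    ∀ᵐ ω ∂P, Z (⋃ i ∈ s, A i) ω = ∑ i ∈ s, Z (A i) ω := by
  classical
  induction s using Finset.induction_on with
  | empty => simpa using hZ.ae_empty
  | insert i s hi ih =>
    have ih' := ih (fun k hk => hA k (Finset.mem_insert_of_mem hk))
      (fun k hk => hA' k (Finset.mem_insert_of_mem hk))
      (hd.subset (by simp))
    have hu := hZ.ae_union (A := A i) (B := ⋃ k ∈ s, A k) (hA i (Finset.mem_insert_self _ _))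
      (s.measurableSet_biUnion fun k hk => hA k (Finset.mem_insert_of_mem hk))
      (hA' i (Finset.mem_insert_self _ _))
      (measure_biUnion_lt_top s.finite_toSet fun k hk => hA' k (Finset.mem_insert_of_mem hk))
      (by
        rw [disjoint_iUnion₂_right]
        intro k hk
        exact hd (by simp) (by simp [hk]) (by rintro rfl; exact hi hk))
    filter_upwards [ih', hu] with ω h1 h2
    rw [Finset.set_biUnion_insert, h2, h1, Finset.sum_insert hi]

/-- The integral of a simple function may be computed from any finer partition. -/
lemma ae_simpleStableIntegral_map (hZ : IsStableRandomMeasure P α β Z) {γ : Type*}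
    (f : SimpleFunc ℝ γ) (φ : γ → ℝ) (hf : ∀ y, φ y ≠ 0 → volume (f ⁻¹' {y}) < ∞) :
    ∀ᵐ ω ∂P, simpleStableIntegral Z (f.map φ) ω = ∑ y ∈ f.range, φ y * Z (f ⁻¹' {y}) ω := by
  classical
  have h : ∀ c : ℝ, c ≠ 0 → ∀ᵐ ω ∂P,
      Z (f.map φ ⁻¹' {c}) ω = ∑ y ∈ f.range with φ y = c, Z (f ⁻¹' {y}) ω := by
    intro c hc
    have e : f.map φ ⁻¹' {c} = ⋃ y ∈ f.range.filter fun y => φ y = c, f ⁻¹' {y} := by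
      rw [SimpleFunc.map_preimage_singleton]
      ext x; simp
    rw [e]
    refine hZ.ae_biUnion _ _ (fun y _ => f.measurableSet_preimage _) (fun y hy => hf y ?_) ?_
    · rw [(Finset.mem_filter.1 hy).2]; exact hc
    · intro y _ y' _ hne
      exact (disjoint_singleton.2 hne).preimage f
  have h' : ∀ᵐ ω ∂P, ∀ c ∈ (f.map φ).range, c ≠ 0 →
      Z (f.map φ ⁻¹' {c}) ω = ∑ y ∈ f.range with φ y = c, Z (f ⁻¹' {y}) ω := by
    rw [Filter.eventually_all_finset]
    intro c _
    by_cases hc : c = 0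
    · simp [hc]
    · filter_upwards [h c hc] with ω hω _ using hω
  filter_upwards [h'] with ω hω
  unfold simpleStableIntegral
  rw [SimpleFunc.range_map]
  refine Finset.sum_image' _ fun y hy => ?_
  by_cases hy0 : φ y = 0
  · rw [hy0, zero_mul]
    refine (Finset.sum_eq_zero fun z hz => ?_).symm
    rw [(Finset.mem_filter.1 hz).2, zero_mul]
  · rw [hω (φ y) (by rw [SimpleFunc.range_map]; exact Finset.mem_image_of_mem _ hy) hy0,
      Finset.mul_sum]
    refine Finset.sum_congr rfl fun z hz => ?_
    rw [(Finset.mem_filter.1 hz).2]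

lemma ae_simpleStableIntegral_sub (hZ : IsStableRandomMeasure P α β Z) {g h : SimpleFunc ℝ ℝ}
    (hg : ∀ y, y ≠ 0 → volume (g ⁻¹' {y}) < ∞) (hh : ∀ y, y ≠ 0 → volume (h ⁻¹' {y}) < ∞) :
    ∀ᵐ ω ∂P, simpleStableIntegral Z (g - h) ω =
      simpleStableIntegral Z g ω - simpleStableIntegral Z h ω := by
  have hfin : ∀ y : ℝ × ℝ, y ≠ 0 → volume (g.pair h ⁻¹' {y}) < ∞ := by
    intro y hy
    by_cases h1 : y.1 = 0
    · have h2 : y.2 ≠ 0 := fun h2 => hy (Prod.ext h1 h2)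
      refine (measure_mono fun x hx => ?_).trans_lt (hh y.2 h2)
      simp only [mem_preimage, mem_singleton_iff, SimpleFunc.pair_apply] at hx ⊢
      rw [← hx]
    · refine (measure_mono fun x hx => ?_).trans_lt (hg y.1 h1)
      simp only [mem_preimage, mem_singleton_iff, SimpleFunc.pair_apply] at hx ⊢
      rw [← hx]
  have e1 := hZ.ae_simpleStableIntegral_map (g.pair h) Prod.fst
    fun y hy => hfin y (by rintro rfl; simp at hy)
  have e2 := hZ.ae_simpleStableIntegral_map (g.pair h) Prod.snd
    fun y hy => hfin y (by rintro rfl; simp at hy)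
  have e3 := hZ.ae_simpleStableIntegral_map (g.pair h) (fun y => y.1 - y.2)
    fun y hy => hfin y (by rintro rfl; simp at hy)
  have r1 : (g.pair h).map Prod.fst = g := by ext x; simp
  have r2 : (g.pair h).map Prod.snd = h := by ext x; simp
  have r3 : (g.pair h).map (fun y => y.1 - y.2) = g - h := by ext x; simp
  rw [r1] at e1
  rw [r2] at e2
  rw [r3] at e3
  filter_upwards [e1, e2, e3] with ω h1 h2 h3
  rw [h1, h2, h3, ← Finset.sum_sub_distrib]
  exact Finset.sum_congr rfl fun y _ => by ring

/-- The joint characteristic function of the values of `Z` on disjoint sets. -/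
lemma integral_exp_sum (hZ : IsStableRandomMeasure P α β Z) {ι : Type*} [Fintype ι]
    (A : ι → Set ℝ) (hA : ∀ i, MeasurableSet (A i)) (hA' : ∀ i, volume (A i) < ∞)
    (hd : Pairwise fun i i' => Disjoint (A i) (A i')) (c : ι → ℝ) :
    ∫ ω, Complex.exp (((∑ i, c i * Z (A i) ω : ℝ) : ℂ) * Complex.I) ∂P =
      Complex.exp (∑ i, stableExponent α β (A i) (c i)) := by
  set e := Fintype.equivFin ι
  have hind : iIndepFun (fun i => Z (A i)) P := by
    have h1 := hZ.indep (Fintype.card ι) (fun n => A (e.symm n)) (fun n => hA _) (fun n => hA' _)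
      (fun n m hnm => hd (e.symm.injective.ne hnm))
    have h2 := h1.precomp e.injective
    simpa using h2
  have hind2 : iIndepFun (fun i ω => Complex.exp (((c i * Z (A i) ω : ℝ) : ℂ) * Complex.I)) P :=
    hind.comp (fun i x => Complex.exp (((c i * x : ℝ) : ℂ) * Complex.I)) fun i => by fun_prop
  have hm : ∀ i, Measurable (Z (A i)) := fun i => hZ.measurable _ (hA i) (hA' i)
  have e1 : ∀ ω, Complex.exp (((∑ i, c i * Z (A i) ω : ℝ) : ℂ) * Complex.I) =
      ∏ i, Complex.exp (((c i * Z (A i) ω : ℝ) : ℂ) * Complex.I) := by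
    intro ω
    rw [← Complex.exp_sum, Complex.ofReal_sum, Finset.sum_mul]
  simp_rw [e1]
  rw [hind2.integral_fun_prod_eq_prod_integral fun i =>
    (by have := hm i; fun_prop : Measurable _).aestronglyMeasurable, Complex.exp_sum]
  refine Finset.prod_congr rfl fun i _ => ?_
  rw [← charFun_map_eq_integral (hm i).aemeasurable, hZ.charFun_eq _ (hA i) (hA' i)]
  rfl

end IsStableRandomMeasure

/-- The non-zero values of a simple function. -/
noncomputable def nonzeroRange (g : SimpleFunc ℝ ℝ) : Finset ℝ := g.range.filter (· ≠ 0)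

lemma simpleStableIntegral_eq {Ω : Type*} (Z : Set ℝ → Ω → ℝ) (g : SimpleFunc ℝ ℝ) (ω : Ω) :
    simpleStableIntegral Z g ω = ∑ c : nonzeroRange g, (c : ℝ) * Z (g ⁻¹' {(c : ℝ)}) ω := by
  unfold simpleStableIntegral
  rw [Finset.sum_coe_sort (nonzeroRange g) fun c => c * Z (g ⁻¹' {c}) ω, nonzeroRange,
    Finset.sum_filter_of_ne]
  intro c _ hc h0
  simp [h0] at hc

namespace IsStableRandomMeasure

variable {Ω : Type*} [MeasurableSpace Ω] {P : Measure Ω} {α : ℝ}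
  {β : ℝ → ℝ} {Z : Set ℝ → Ω → ℝ}

lemma measurable_simpleStableIntegral (hZ : IsStableRandomMeasure P α β Z) {g : SimpleFunc ℝ ℝ}
    (hg : ∀ y, y ≠ 0 → volume (g ⁻¹' {y}) < ∞) : Measurable (simpleStableIntegral Z g) := by
  rw [show simpleStableIntegral Z g = _ from funext (simpleStableIntegral_eq Z g)]
  refine Finset.measurable_sum _ fun c _ => (hZ.measurable _ (g.measurableSet_preimage _)
    (hg _ (Finset.mem_filter.1 c.2).2)).const_mul _

lemma charFun_simpleStableIntegral (hZ : IsStableRandomMeasure P α β Z) {g : SimpleFunc ℝ ℝ}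
    (hg : ∀ y, y ≠ 0 → volume (g ⁻¹' {y}) < ∞) (θ : ℝ) :
    charFun (P.map (simpleStableIntegral Z g)) θ =
      Complex.exp (∑ c : nonzeroRange g, stableExponent α β (g ⁻¹' {(c : ℝ)}) (θ * c)) := by
  rw [charFun_map_eq_integral (hZ.measurable_simpleStableIntegral hg).aemeasurable,
    ← hZ.integral_exp_sum (fun c : nonzeroRange g => g ⁻¹' {(c : ℝ)})
      (fun c => g.measurableSet_preimage _) (fun c => hg _ (Finset.mem_filter.1 c.2).2)
      (fun c c' hne => (disjoint_singleton.2 fun h => hne (Subtype.ext h)).preimage g)]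
  simp_rw [simpleStableIntegral_eq, Finset.mul_sum, mul_assoc]

/-- The integrals of simple functions with disjoint supports are independent. -/
lemma integral_exp_sum_simpleStableIntegral (hZ : IsStableRandomMeasure P α β Z) {ι : Type*}
    [Fintype ι] {g : ι → SimpleFunc ℝ ℝ} (hg : ∀ i y, y ≠ 0 → volume (g i ⁻¹' {y}) < ∞)
    (hd : ∀ i i', i ≠ i' → ∀ x, g i x = 0 ∨ g i' x = 0) (θ : ι → ℝ) :
    ∫ ω, Complex.exp (((∑ i, θ i * simpleStableIntegral Z (g i) ω : ℝ) : ℂ) * Complex.I) ∂P =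
      ∏ i, charFun (P.map (simpleStableIntegral Z (g i))) (θ i) := by
  have key := hZ.integral_exp_sum (fun p : (Σ i, nonzeroRange (g i)) => g p.1 ⁻¹' {(p.2 : ℝ)})
    (fun p => (g p.1).measurableSet_preimage _)
    (fun p => hg p.1 _ (Finset.mem_filter.1 p.2.2).2)
    (by
      rintro ⟨i, c⟩ ⟨i', c'⟩ hne
      rw [Set.disjoint_left]
      intro x hx hx'
      simp only [mem_preimage, mem_singleton_iff] at hx hx'
      by_cases h : i = i'
      · subst h
        exact hne (by rw [Subtype.ext (hx.symm.trans hx')])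
      · rcases hd i i' h x with h0 | h0
        · exact (Finset.mem_filter.1 c.2).2 (hx ▸ h0)
        · exact (Finset.mem_filter.1 c'.2).2 (hx' ▸ h0))
    (fun p => θ p.1 * p.2)
  simp_rw [hZ.charFun_simpleStableIntegral (hg _), ← Complex.exp_sum]
  rw [Fintype.sum_sigma] at key
  rw [← key]
  simp_rw [simpleStableIntegral_eq, Finset.mul_sum, Fintype.sum_sigma, mul_assoc]

end IsStableRandomMeasure

/-- The `α`-th power of the `L^α` norm. -/
noncomputable def alphaEnergy (α : ℝ) (f : ℝ → ℝ) : ℝ := (eLpNorm f (ENNReal.ofReal α)).toReal ^ α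

lemma alphaEnergy_eq_integral {α : ℝ} (hα : 0 < α) {f : ℝ → ℝ}
    (hf : MemLp f (ENNReal.ofReal α)) : alphaEnergy α f = ∫ s, |f s| ^ α := by
  unfold alphaEnergy
  have h0 : 0 ≤ ∫ s, |f s| ^ α := integral_nonneg fun _ => by positivity
  rw [hf.eLpNorm_eq_integral_rpow_norm (by simpa using hα) ENNReal.ofReal_ne_top,
    ENNReal.toReal_ofReal hα.le]
  simp only [Real.norm_eq_abs]
  rw [ENNReal.toReal_ofReal (by positivity), Real.rpow_inv_rpow h0 hα.ne']

lemma simpleFunc_measure_lt_top {α : ℝ} (hα : 0 < α) {g : SimpleFunc ℝ ℝ}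
    (hg : MemLp g (ENNReal.ofReal α)) : ∀ y, y ≠ 0 → volume (g ⁻¹' {y}) < ∞ :=
  (SimpleFunc.memLp_iff (by simpa using hα) ENNReal.ofReal_ne_top).1 hg

lemma sum_nonzeroRange_eq_alphaEnergy {α : ℝ} (hα : 0 < α) {g : SimpleFunc ℝ ℝ}
    (hg : MemLp g (ENNReal.ofReal α)) :
    ∑ c : nonzeroRange g, |(c : ℝ)| ^ α * volume.real (g ⁻¹' {(c : ℝ)}) = alphaEnergy α g := by
  have hi : Integrable g := (SimpleFunc.memLp_iff_integrable (by simpa using hα)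
    ENNReal.ofReal_ne_top).1 hg
  have h0 : |(0 : ℝ)| ^ α = 0 := by simp [hα.ne']
  have h1 := SimpleFunc.map_integral g (fun x => |x| ^ α) hi h0
  have h2 : Integrable (g.map fun x => |x| ^ α) := by
    have := hg.integrable_norm_rpow (by simpa using hα) ENNReal.ofReal_ne_top
    rw [ENNReal.toReal_ofReal hα.le] at this
    exact this
  rw [SimpleFunc.integral_eq_integral _ h2] at h1
  rw [alphaEnergy_eq_integral hα hg]
  have h3 : ∫ s, |g s| ^ α = ∫ s, (g.map fun x => |x| ^ α) s := rfl
  rw [h3, h1, Finset.sum_coe_sort (nonzeroRange g) fun c => |c| ^ α * volume.real (g ⁻¹' {c}),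
    nonzeroRange, Finset.sum_filter_of_ne]
  · exact Finset.sum_congr rfl fun c _ => by rw [smul_eq_mul, mul_comm]
  · intro c _ hc hc0
    rw [hc0, h0, zero_mul] at hc
    exact hc rfl

namespace IsStableRandomMeasure

variable {Ω : Type*} [MeasurableSpace Ω] {P : Measure Ω} {α : ℝ}
  {β : ℝ → ℝ} {Z : Set ℝ → Ω → ℝ}

lemma norm_charFun_simpleStableIntegral (hZ : IsStableRandomMeasure P α β Z) (hα : 0 < α)
    {g : SimpleFunc ℝ ℝ} (hg : MemLp g (ENNReal.ofReal α)) (θ : ℝ) :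
    ‖charFun (P.map (simpleStableIntegral Z g)) θ‖ =
      Real.exp (-(|θ| ^ α * alphaEnergy α g)) := by
  rw [hZ.charFun_simpleStableIntegral (simpleFunc_measure_lt_top hα hg), Complex.norm_exp,
    Complex.re_sum, ← sum_nonzeroRange_eq_alphaEnergy hα hg, Finset.mul_sum,
    ← Finset.sum_neg_distrib]
  congr 1
  refine Finset.sum_congr rfl fun c _ => ?_
  rw [stableExponent_re, abs_mul, Real.mul_rpow (abs_nonneg _) (abs_nonneg _), mul_assoc]

lemma norm_one_sub_charFun_simpleStableIntegral_le (hZ : IsStableRandomMeasure P α β Z)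
    (hβ : ∀ s, β s ∈ Icc (-1 : ℝ) 1) (hα : 0 < α) {g : SimpleFunc ℝ ℝ}
    (hg : MemLp g (ENNReal.ofReal α)) (θ : ℝ) :
    ‖1 - charFun (P.map (simpleStableIntegral Z g)) θ‖ ≤
      2 * ((1 + |Real.tan (Real.pi * α / 2)|) * (|θ| ^ α * alphaEnergy α g)) := by
  have hfin := simpleFunc_measure_lt_top hα hg
  rw [hZ.charFun_simpleStableIntegral hfin]
  refine (norm_one_sub_exp_le ?_).trans ?_
  · rw [Complex.re_sum]
    refine Finset.sum_nonpos fun c _ => ?_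
    rw [stableExponent_re]
    have : 0 ≤ |θ * (c : ℝ)| ^ α * volume.real (g ⁻¹' {(c : ℝ)}) :=
      mul_nonneg (by positivity) measureReal_nonneg
    linarith
  · rw [← sum_nonzeroRange_eq_alphaEnergy hα hg]
    gcongr
    rw [Finset.mul_sum, Finset.mul_sum]
    refine norm_sum_le_of_le _ fun c _ => ?_
    refine (norm_stableExponent_le hβ (hfin _ (Finset.mem_filter.1 c.2).2) _).trans_eq ?_
    rw [abs_mul, Real.mul_rpow (abs_nonneg _) (abs_nonneg _)]
    ring

end IsStableRandomMeasure

/-! ### Stochastic integrals -/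

/-- A bound `|1 - φ(θ)| ≤ S |θ|^α` on a characteristic function gives a tail of order `α`. -/
lemma measureReal_abs_gt_le_of_charFun {μ : Measure ℝ} [IsProbabilityMeasure μ] {α S : ℝ}
    (hα : 0 ≤ α) (hα2 : α ≤ 2) (hS : 0 ≤ S)
    (h : ∀ θ, ‖1 - charFun μ θ‖ ≤ S * |θ| ^ α) {r : ℝ} (hr : 0 < r) :
    μ.real {x | r < |x|} ≤ 8 * S * r ^ (-α) := by
  refine (measureReal_abs_gt_le_integral_charFun hr).trans ?_
  have hr' : 0 < r⁻¹ := inv_pos.2 hr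
  have h1 : ‖∫ t in (-2 * r⁻¹)..(2 * r⁻¹), 1 - charFun μ t‖ ≤
      (S * (2 * r⁻¹) ^ α) * |2 * r⁻¹ - -2 * r⁻¹| := by
    refine intervalIntegral.norm_integral_le_of_norm_le_const fun t ht => (h t).trans ?_
    rw [uIoc_of_le (by linarith)] at ht
    gcongr
    exact abs_le.2 ⟨by linarith [ht.1], ht.2⟩
  have h2 : (2 : ℝ) ^ α ≤ 4 := by
    calc (2 : ℝ) ^ α ≤ 2 ^ (2 : ℝ) := Real.rpow_le_rpow_of_exponent_le (by norm_num) hα2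
      _ = 4 := by norm_num
  have h3 : (2 * r⁻¹) ^ α = 2 ^ α * r ^ (-α) := by
    rw [Real.mul_rpow (by norm_num) hr'.le, Real.inv_rpow hr.le, Real.rpow_neg hr.le]
  have h4 : |2 * r⁻¹ - -2 * r⁻¹| = 4 * r⁻¹ := by
    rw [abs_of_pos (by linarith)]; ring
  rw [h3, h4] at h1
  have h5 : 0 ≤ r ^ (-α) := by positivity
  calc _ ≤ 2⁻¹ * r * ((S * (2 ^ α * r ^ (-α))) * (4 * r⁻¹)) := by gcongr
    _ = 2 * S * r ^ (-α) * 2 ^ α := by field_simp; ring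
    _ ≤ 2 * S * r ^ (-α) * 4 := by gcongr
    _ = _ := by ring

/-- The constant in the bound `|1 - E exp(iθ ∫ f dZ)| ≤ C |θ|^α ‖f‖_α^α`. -/
noncomputable def stableConst (α : ℝ) : ℝ := 2 * (1 + |Real.tan (Real.pi * α / 2)|)

lemma stableConst_pos (α : ℝ) : 0 < stableConst α := by unfold stableConst; positivity

/-- The simple functions `g n` converge to `f` in `L^α` at a geometric rate that is fast enough for
the almost sure convergence of their integrals. -/
def FastApprox (α : ℝ) (f : ℝ → ℝ) (g : ℕ → SimpleFunc ℝ ℝ) : Prop :=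
  (∀ n, MemLp (g n) (ENNReal.ofReal α)) ∧
    ∀ n, eLpNorm (fun s => g n s - f s) (ENNReal.ofReal α) ≤ ENNReal.ofReal ((1 / 8) ^ n)

lemma FastApprox.tendsto {α : ℝ} {f : ℝ → ℝ} {g : ℕ → SimpleFunc ℝ ℝ} (h : FastApprox α f g) :
    Tendsto (fun n => eLpNorm (fun s => g n s - f s) (ENNReal.ofReal α)) atTop (𝓝 0) := by
  have h1 : Tendsto (fun n : ℕ => ENNReal.ofReal ((1 / 8) ^ n)) atTop (𝓝 0) := by
    have := ENNReal.tendsto_ofReal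
      (tendsto_pow_atTop_nhds_zero_of_lt_one (by norm_num : (0 : ℝ) ≤ 1 / 8) (by norm_num))
    simpa using this
  exact tendsto_of_tendsto_of_tendsto_of_le_of_le tendsto_const_nhds h1 (fun _ => zero_le) h.2

lemma exists_fastApprox {α : ℝ} {f : ℝ → ℝ} (hf : MemLp f (ENNReal.ofReal α)) {S : Set ℝ}
    (hS : MeasurableSet S) (hfS : ∀ x ∉ S, f x = 0) :
    ∃ g : ℕ → SimpleFunc ℝ ℝ, FastApprox α f g ∧ ∀ n, ∀ x ∉ S, g n x = 0 := by
  have h : ∀ n : ℕ, ∃ g : SimpleFunc ℝ ℝ, eLpNorm (f - ⇑g) (ENNReal.ofReal α) <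
      ENNReal.ofReal ((1 / 8) ^ n) ∧ MemLp g (ENNReal.ofReal α) := fun n =>
    hf.exists_simpleFunc_eLpNorm_sub_lt ENNReal.ofReal_ne_top (by
      rw [Ne, ENNReal.ofReal_eq_zero, not_le]; positivity)
  choose g hg hgm using h
  refine ⟨fun n => (g n).restrict S, ⟨fun n => ?_, fun n => ?_⟩, fun n x hx => ?_⟩
  · rw [SimpleFunc.coe_restrict _ hS]
    exact (hgm n).indicator hS
  · refine (eLpNorm_mono fun x => ?_).trans (hg n).le
    rw [SimpleFunc.restrict_apply _ hS, Pi.sub_apply]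
    by_cases hx : x ∈ S
    · rw [indicator_of_mem hx, norm_sub_rev]
    · rw [indicator_of_notMem hx, hfS x hx]; simp
  · rw [SimpleFunc.restrict_apply _ hS, indicator_of_notMem hx]

lemma tendsto_alphaEnergy {α : ℝ} (hα : 1 ≤ α) {f : ℝ → ℝ} {g : ℕ → SimpleFunc ℝ ℝ}
    (hf : MemLp f (ENNReal.ofReal α)) (hg : ∀ n, MemLp (g n) (ENNReal.ofReal α))
    (h : Tendsto (fun n => eLpNorm (fun s => g n s - f s) (ENNReal.ofReal α)) atTop (𝓝 0)) :
    Tendsto (fun n => alphaEnergy α (g n)) atTop (𝓝 (alphaEnergy α f)) := by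
  have hp : 1 ≤ ENNReal.ofReal α := by simpa using ENNReal.ofReal_le_ofReal hα
  have h1 : Tendsto (fun n => (eLpNorm (fun s => g n s - f s) (ENNReal.ofReal α)).toReal) atTop
      (𝓝 0) := by simpa [Function.comp_def] using (ENNReal.tendsto_toReal ENNReal.zero_ne_top).comp h
  have hd : ∀ n, MemLp (fun s => g n s - f s) (ENNReal.ofReal α) := fun n => (hg n).sub hf
  have h2 : Tendsto (fun n => (eLpNorm (g n) (ENNReal.ofReal α)).toReal) atTop
      (𝓝 (eLpNorm f (ENNReal.ofReal α)).toReal) := by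
    rw [tendsto_iff_norm_sub_tendsto_zero]
    refine squeeze_zero (fun _ => norm_nonneg _) (fun n => ?_) h1
    rw [Real.norm_eq_abs, abs_le]
    have e1 : eLpNorm (g n) (ENNReal.ofReal α) ≤ eLpNorm (fun s => g n s - f s) (ENNReal.ofReal α) +
        eLpNorm f (ENNReal.ofReal α) := by
      have := eLpNorm_add_le (hd n).1 hf.1 hp
      have e : (fun s => g n s - f s) + f = g n := by ext; simp
      rwa [e] at this
    have e2 : eLpNorm f (ENNReal.ofReal α) ≤ eLpNorm (g n) (ENNReal.ofReal α) +
        eLpNorm (fun s => g n s - f s) (ENNReal.ofReal α) := by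
      have := eLpNorm_sub_le (hg n).1 (hd n).1 hp
      have e : (g n : ℝ → ℝ) - (fun s => g n s - f s) = f := by ext; simp
      rwa [e] at this
    have e1' := ENNReal.toReal_mono (ENNReal.add_ne_top.2 ⟨(hd n).2.ne, hf.2.ne⟩) e1
    have e2' := ENNReal.toReal_mono (ENNReal.add_ne_top.2 ⟨(hg n).2.ne, (hd n).2.ne⟩) e2
    rw [ENNReal.toReal_add (hd n).2.ne hf.2.ne] at e1'
    rw [ENNReal.toReal_add (hg n).2.ne (hd n).2.ne] at e2'
    constructor <;> linarith
  exact ((Real.continuous_rpow_const (by linarith)).tendsto _).comp h2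

namespace IsStableRandomMeasure

variable {Ω : Type*} [MeasurableSpace Ω] {P : Measure Ω} [IsProbabilityMeasure P] {α : ℝ}
  {β : ℝ → ℝ} {Z : Set ℝ → Ω → ℝ}

lemma measureReal_simpleStableIntegral_sub_le (hZ : IsStableRandomMeasure P α β Z)
    (hβ : ∀ s, β s ∈ Icc (-1 : ℝ) 1) (hα : 0 < α) (hα2 : α ≤ 2)
    {g h : SimpleFunc ℝ ℝ} (hg : MemLp g (ENNReal.ofReal α)) (hh : MemLp h (ENNReal.ofReal α))
    {r : ℝ} (hr : 0 < r) :
    P.real {ω | r < |simpleStableIntegral Z g ω - simpleStableIntegral Z h ω|} ≤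
      8 * (stableConst α * (eLpNorm (fun s => g s - h s) (ENNReal.ofReal α)).toReal ^ α) *
        r ^ (-α) := by
  have hd : MemLp (g - h : SimpleFunc ℝ ℝ) (ENNReal.ofReal α) := hg.sub hh
  have hm := hZ.measurable_simpleStableIntegral (simpleFunc_measure_lt_top hα hd)
  have hprob : IsProbabilityMeasure (P.map (simpleStableIntegral Z (g - h))) :=
    Measure.isProbabilityMeasure_map hm.aemeasurable
  have he : alphaEnergy α (g - h : SimpleFunc ℝ ℝ) =
      (eLpNorm (fun s => g s - h s) (ENNReal.ofReal α)).toReal ^ α := rfl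
  have he0 : 0 ≤ alphaEnergy α (g - h : SimpleFunc ℝ ℝ) := by unfold alphaEnergy; positivity
  have key := measureReal_abs_gt_le_of_charFun (μ := P.map (simpleStableIntegral Z (g - h)))
    (S := stableConst α * alphaEnergy α (g - h : SimpleFunc ℝ ℝ)) hα.le hα2
    (mul_nonneg (stableConst_pos α).le he0)
    (fun θ => (hZ.norm_one_sub_charFun_simpleStableIntegral_le hβ hα hd θ).trans_eq (by
      unfold stableConst; ring)) hr
  rw [map_measureReal_apply hm (measurableSet_lt measurable_const (by fun_prop)), he] at key
  refine le_trans (le_of_eq ?_) key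
  refine measureReal_congr ?_
  filter_upwards [hZ.ae_simpleStableIntegral_sub (simpleFunc_measure_lt_top hα hg)
    (simpleFunc_measure_lt_top hα hh)] with ω hω
  change (r < |_|) = (r < |_|)
  rw [hω]

/-- Fast approximations have almost surely convergent integrals, by Borel-Cantelli. -/
lemma exists_ae_tendsto_of_fastApprox (hZ : IsStableRandomMeasure P α β Z)
    (hβ : ∀ s, β s ∈ Icc (-1 : ℝ) 1) (hα : 1 ≤ α) (hα2 : α ≤ 2) {f : ℝ → ℝ}
    (hf : MemLp f (ENNReal.ofReal α)) {g : ℕ → SimpleFunc ℝ ℝ} (hg : FastApprox α f g) :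
    ∃ I : Ω → ℝ, Measurable I ∧
      ∀ᵐ ω ∂P, Tendsto (fun n => simpleStableIntegral Z (g n) ω) atTop (𝓝 (I ω)) := by
  have hα0 : 0 < α := by linarith
  have hp : 1 ≤ ENNReal.ofReal α := by simpa using ENNReal.ofReal_le_ofReal hα
  refine measurable_limit_of_tendsto_metrizable_ae (fun n =>
    (hZ.measurable_simpleStableIntegral (simpleFunc_measure_lt_top hα0 (hg.1 n))).aemeasurable) ?_
  -- outside of finitely many of these events the integrals form a Cauchy sequence
  set B : ℕ → Set Ω := fun n => {ω | (1 / 2 : ℝ) ^ n <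
    |simpleStableIntegral Z (g (n + 1)) ω - simpleStableIntegral Z (g n) ω|} with hB
  have hnorm : ∀ n, (eLpNorm (fun s => g (n + 1) s - g n s) (ENNReal.ofReal α)).toReal ≤
      2 * (1 / 8) ^ n := by
    intro n
    have e1 := eLpNorm_sub_le ((hg.1 (n + 1)).sub hf).1 ((hg.1 n).sub hf).1 hp
    have e : (⇑(g (n + 1)) - f) - (⇑(g n) - f) = fun s => g (n + 1) s - g n s := by
      ext s; simp
    rw [e] at e1
    have e2 := e1.trans (add_le_add (hg.2 (n + 1)) (hg.2 n))
    rw [← ENNReal.ofReal_add (by positivity) (by positivity)] at e2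
    refine (ENNReal.toReal_le_of_le_ofReal (by positivity) e2).trans ?_
    have : (1 / 8 : ℝ) ^ (n + 1) ≤ (1 / 8) ^ n :=
      pow_le_pow_of_le_one (by norm_num) (by norm_num) (by omega)
    linarith
  have hPB : ∀ n, P.real (B n) ≤ 32 * stableConst α * (1 / 4) ^ n := by
    intro n
    refine (hZ.measureReal_simpleStableIntegral_sub_le hβ hα0 hα2 (hg.1 (n + 1)) (hg.1 n)
      (by positivity : (0 : ℝ) < (1 / 2) ^ n)).trans ?_
    have h1 : ((2 : ℝ) * (1 / 8) ^ n) ^ α * ((1 / 2 : ℝ) ^ n) ^ (-α) ≤ 4 * (1 / 4) ^ n := by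
      rw [Real.rpow_neg (by positivity), ← Real.inv_rpow (by positivity),
        ← Real.mul_rpow (by positivity) (by positivity)]
      have e1 : (2 : ℝ) * (1 / 8) ^ n * ((1 / 2) ^ n)⁻¹ = 2 * (1 / 4) ^ n := by
        rw [mul_assoc, ← inv_pow, ← mul_pow]; norm_num
      rw [e1, Real.mul_rpow (by norm_num) (by positivity)]
      have e2 : (2 : ℝ) ^ α ≤ 4 := by
        calc (2 : ℝ) ^ α ≤ 2 ^ (2 : ℝ) := Real.rpow_le_rpow_of_exponent_le (by norm_num) hα2
          _ = 4 := by norm_num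
      have e3 : ((1 / 4 : ℝ) ^ n) ^ α ≤ (1 / 4) ^ n := by
        have := Real.rpow_le_rpow_of_exponent_ge (by positivity : (0 : ℝ) < (1 / 4) ^ n)
          (pow_le_one₀ (by norm_num) (by norm_num)) hα
        simpa using this
      gcongr
    have hT := (stableConst_pos α).le
    calc _ ≤ 8 * (stableConst α * (2 * (1 / 8) ^ n) ^ α) * ((1 / 2) ^ n) ^ (-α) := by
          gcongr; exact hnorm n
      _ = 8 * stableConst α * ((2 * (1 / 8) ^ n) ^ α * ((1 / 2) ^ n) ^ (-α)) := by ring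
      _ ≤ 8 * stableConst α * (4 * (1 / 4) ^ n) := by gcongr
      _ = _ := by ring
  have hsum : ∑' n, P (B n) ≠ ∞ := by
    have hs : Summable fun n : ℕ => 32 * stableConst α * (1 / 4 : ℝ) ^ n :=
      (summable_geometric_of_lt_one (by norm_num) (by norm_num)).mul_left _
    refine ne_top_of_le_ne_top hs.tsum_ofReal_ne_top (ENNReal.tsum_le_tsum fun n => ?_)
    rw [← ofReal_measureReal]
    exact ENNReal.ofReal_le_ofReal (hPB n)
  filter_upwards [ae_eventually_notMem hsum] with ω hω
  refine cauchySeq_tendsto_of_complete (cauchySeq_of_summable_dist ?_)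
  refine Summable.of_norm_bounded_eventually_nat
    (summable_geometric_of_lt_one (by norm_num : (0 : ℝ) ≤ 1 / 2) (by norm_num)) ?_
  filter_upwards [hω] with n hn
  rw [Real.norm_of_nonneg dist_nonneg, dist_comm, Real.dist_eq]
  exact not_lt.1 hn

/-- The stochastic integral of a function of `L^α` exists. -/
theorem exists_isStableIntegral (hZ : IsStableRandomMeasure P α β Z)
    (hβ : ∀ s, β s ∈ Icc (-1 : ℝ) 1) (hα : 1 ≤ α) (hα2 : α ≤ 2) {f : ℝ → ℝ}
    (hf : MemLp f (ENNReal.ofReal α)) : ∃ I, IsStableIntegral P α Z f I := by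
  have hα0 : 0 < α := by linarith
  have hp : 1 ≤ ENNReal.ofReal α := by simpa using ENNReal.ofReal_le_ofReal hα
  obtain ⟨g, hg, -⟩ := exists_fastApprox hf MeasurableSet.univ (by simp)
  obtain ⟨I, hI, hlim⟩ := hZ.exists_ae_tendsto_of_fastApprox hβ hα hα2 hf hg
  refine ⟨I, hf, hI, fun h hh hhf => ?_⟩
  -- any other approximating sequence `h` has integrals close in probability to those of `g`
  have hgI : TendstoInMeasure P (fun n => simpleStableIntegral Z (g n)) atTop I :=
    tendstoInMeasure_of_tendsto_ae (fun n => (hZ.measurable_simpleStableIntegral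
      (simpleFunc_measure_lt_top hα0 (hg.1 n))).aestronglyMeasurable) hlim
  have hdist : Tendsto (fun n => (eLpNorm (fun s => h n s - g n s) (ENNReal.ofReal α)).toReal)
      atTop (𝓝 0) := by
    have h1 : Tendsto (fun n => eLpNorm (fun s => h n s - g n s) (ENNReal.ofReal α)) atTop
        (𝓝 0) := by
      have h2 := hhf.add hg.tendsto
      rw [add_zero] at h2
      refine tendsto_of_tendsto_of_tendsto_of_le_of_le tendsto_const_nhds h2
        (fun _ => zero_le) (fun n => ?_)
      have e1 := eLpNorm_sub_le ((hh n).sub hf).1 ((hg.1 n).sub hf).1 hp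
      have e : (⇑(h n) - f) - (⇑(g n) - f) = fun s => h n s - g n s := by ext s; simp
      rwa [e] at e1
    have h3 := (ENNReal.tendsto_toReal ENNReal.zero_ne_top).comp h1
    rwa [ENNReal.toReal_zero] at h3
  rw [tendstoInMeasure_iff_measureReal_norm] at hgI ⊢
  intro δ hδ
  have h1 := hgI (δ / 2) (by linarith)
  have h2 : Tendsto (fun n => 8 * (stableConst α *
      (eLpNorm (fun s => h n s - g n s) (ENNReal.ofReal α)).toReal ^ α) * (δ / 4) ^ (-α)) atTop
      (𝓝 0) := by
    have := (((hdist.rpow_const (Or.inr hα0.le)).const_mul (stableConst α)).const_mul 8).mul_const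
      ((δ / 4) ^ (-α))
    simpa [Real.zero_rpow hα0.ne'] using this
  have h3 := h2.add h1
  rw [add_zero] at h3
  refine squeeze_zero (fun _ => measureReal_nonneg) (fun n => ?_) h3
  refine le_trans ?_ (add_le_add (hZ.measureReal_simpleStableIntegral_sub_le hβ hα0 hα2 (hh n)
    (hg.1 n) (by linarith : 0 < δ / 4)) le_rfl)
  refine le_trans (measureReal_mono ?_) (measureReal_union_le _ _)
  intro ω hω
  simp only [mem_ofPred_eq, mem_union, Real.norm_eq_abs] at hω ⊢
  by_contra! hn
  have := abs_add_le (simpleStableIntegral Z (h n) ω - simpleStableIntegral Z (g n) ω)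
    (simpleStableIntegral Z (g n) ω - I ω)
  rw [sub_add_sub_cancel] at this
  linarith [hn.1, hn.2]

lemma isStableIntegral_stableIntegral (hZ : IsStableRandomMeasure P α β Z)
    (hβ : ∀ s, β s ∈ Icc (-1 : ℝ) 1) (hα : 1 ≤ α) (hα2 : α ≤ 2) {f : ℝ → ℝ}
    (hf : MemLp f (ENNReal.ofReal α)) : IsStableIntegral P α Z f (stableIntegral P α Z f) := by
  have h := hZ.exists_isStableIntegral hβ hα hα2 hf
  unfold stableIntegral
  rw [dif_pos h]
  exact h.choose_spec

lemma ae_tendsto_stableIntegral (hZ : IsStableRandomMeasure P α β Z)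
    (hβ : ∀ s, β s ∈ Icc (-1 : ℝ) 1) (hα : 1 ≤ α) (hα2 : α ≤ 2) {f : ℝ → ℝ} {I : Ω → ℝ}
    (hI : IsStableIntegral P α Z f I) {g : ℕ → SimpleFunc ℝ ℝ} (hg : FastApprox α f g) :
    ∀ᵐ ω ∂P, Tendsto (fun n => simpleStableIntegral Z (g n) ω) atTop (𝓝 (I ω)) := by
  obtain ⟨I', hI', hlim⟩ := hZ.exists_ae_tendsto_of_fastApprox hβ hα hα2 hI.1 hg
  have hgI : TendstoInMeasure P (fun n => simpleStableIntegral Z (g n)) atTop I' :=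
    tendstoInMeasure_of_tendsto_ae (fun n => (hZ.measurable_simpleStableIntegral
      (simpleFunc_measure_lt_top (by linarith) (hg.1 n))).aestronglyMeasurable) hlim
  filter_upwards [hlim, tendstoInMeasure_ae_unique hgI (hI.2.2 g hg.1 hg.tendsto)] with ω h1 h2
  rwa [← h2]

lemma tendsto_charFun_simpleStableIntegral (hZ : IsStableRandomMeasure P α β Z)
    (hβ : ∀ s, β s ∈ Icc (-1 : ℝ) 1) (hα : 1 ≤ α) (hα2 : α ≤ 2) {f : ℝ → ℝ} {I : Ω → ℝ}
    (hI : IsStableIntegral P α Z f I) {g : ℕ → SimpleFunc ℝ ℝ} (hg : FastApprox α f g) (θ : ℝ) :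
    Tendsto (fun n => charFun (P.map (simpleStableIntegral Z (g n))) θ) atTop
      (𝓝 (charFun (P.map I) θ)) := by
  have hm : ∀ n, Measurable (simpleStableIntegral Z (g n)) := fun n =>
    hZ.measurable_simpleStableIntegral (simpleFunc_measure_lt_top (by linarith) (hg.1 n))
  rw [charFun_map_eq_integral hI.2.1.aemeasurable]
  simp_rw [fun n => charFun_map_eq_integral (hm n).aemeasurable (P := P) θ]
  refine tendsto_integral_of_dominated_convergence (fun _ => 1) (fun n => ?_)
    (integrable_const _) (fun n => Eventually.of_forall fun ω => ?_) ?_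
  · have := hm n
    exact (by fun_prop : Measurable _).aestronglyMeasurable
  · rw [Complex.norm_exp_ofReal_mul_I]
  · filter_upwards [hZ.ae_tendsto_stableIntegral hβ hα hα2 hI hg] with ω hω
    have hc : Continuous fun x : ℝ => Complex.exp (((θ * x : ℝ) : ℂ) * Complex.I) := by fun_prop
    exact (hc.tendsto _).comp hω

theorem norm_charFun_stableIntegral (hZ : IsStableRandomMeasure P α β Z)
    (hβ : ∀ s, β s ∈ Icc (-1 : ℝ) 1) (hα : 1 ≤ α) (hα2 : α ≤ 2) {f : ℝ → ℝ} {I : Ω → ℝ}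
    (hI : IsStableIntegral P α Z f I) (θ : ℝ) :
    ‖charFun (P.map I) θ‖ = Real.exp (-(|θ| ^ α * alphaEnergy α f)) := by
  obtain ⟨g, hg, -⟩ := exists_fastApprox hI.1 MeasurableSet.univ (by simp)
  have h1 := (hZ.tendsto_charFun_simpleStableIntegral hβ hα hα2 hI hg θ).norm
  simp_rw [fun n => hZ.norm_charFun_simpleStableIntegral (by linarith) (hg.1 n) θ] at h1
  have h2 := (tendsto_alphaEnergy hα hI.1 hg.1 hg.tendsto).const_mul (|θ| ^ α)
  exact tendsto_nhds_unique h1 ((Real.continuous_exp.tendsto _).comp h2.neg)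

theorem norm_one_sub_charFun_stableIntegral_le (hZ : IsStableRandomMeasure P α β Z)
    (hβ : ∀ s, β s ∈ Icc (-1 : ℝ) 1) (hα : 1 ≤ α) (hα2 : α ≤ 2) {f : ℝ → ℝ} {I : Ω → ℝ}
    (hI : IsStableIntegral P α Z f I) (θ : ℝ) :
    ‖1 - charFun (P.map I) θ‖ ≤ stableConst α * (|θ| ^ α * alphaEnergy α f) := by
  obtain ⟨g, hg, -⟩ := exists_fastApprox hI.1 MeasurableSet.univ (by simp)
  have h1 := ((hZ.tendsto_charFun_simpleStableIntegral hβ hα hα2 hI hg θ).const_sub 1).norm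
  have h2 := ((tendsto_alphaEnergy hα hI.1 hg.1 hg.tendsto).const_mul (|θ| ^ α)).const_mul
    (stableConst α)
  refine le_of_tendsto_of_tendsto' h1 h2 fun n => ?_
  refine (hZ.norm_one_sub_charFun_simpleStableIntegral_le hβ (by linarith) (hg.1 n) θ).trans_eq ?_
  unfold stableConst; ring

/-- The stochastic integrals of functions with disjoint supports are independent. -/
theorem iIndepFun_stableIntegral (hZ : IsStableRandomMeasure P α β Z)
    (hβ : ∀ s, β s ∈ Icc (-1 : ℝ) 1) (hα : 1 ≤ α) (hα2 : α ≤ 2) {ι : Type*} [Fintype ι]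
    {f : ι → ℝ → ℝ} {I : ι → Ω → ℝ} (hI : ∀ i, IsStableIntegral P α Z (f i) (I i))
    (S : ι → Set ℝ) (hS : ∀ i, MeasurableSet (S i)) (hfS : ∀ i, ∀ x ∉ S i, f i x = 0)
    (hd : Pairwise fun i i' => Disjoint (S i) (S i')) : iIndepFun I P := by
  have hα0 : 0 < α := by linarith
  choose g hg hgS using fun i => exists_fastApprox (hI i).1 (hS i) (hfS i)
  have hm : ∀ i n, Measurable (simpleStableIntegral Z (g i n)) := fun i n =>
    hZ.measurable_simpleStableIntegral (simpleFunc_measure_lt_top hα0 ((hg i).1 n))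
  rw [iIndepFun_iff_charFun_pi fun i => (hI i).2.1.aemeasurable]
  intro t
  have hmI : Measurable fun ω => WithLp.toLp 2 fun i => I i ω :=
    (WithLp.measurable_toLp _ _).comp (measurable_pi_lambda _ fun i => (hI i).2.1)
  have e1 : charFun (P.map fun ω => WithLp.toLp 2 fun i => I i ω) t =
      ∫ ω, Complex.exp (((∑ i, t i * I i ω : ℝ) : ℂ) * Complex.I) ∂P := by
    rw [charFun_apply, integral_map hmI.aemeasurable (by fun_prop)]
    simp only [PiLp.inner_apply, RCLike.inner_apply, conj_trivial]
  rw [e1]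
  have l1 : Tendsto (fun n => ∫ ω, Complex.exp
      (((∑ i, t i * simpleStableIntegral Z (g i n) ω : ℝ) : ℂ) * Complex.I) ∂P) atTop
      (𝓝 (∫ ω, Complex.exp (((∑ i, t i * I i ω : ℝ) : ℂ) * Complex.I) ∂P)) := by
    refine tendsto_integral_of_dominated_convergence (fun _ => 1) (fun n => ?_)
      (integrable_const _) (fun n => Eventually.of_forall fun ω => ?_) ?_
    · have := fun i => hm i n
      exact (by fun_prop : Measurable _).aestronglyMeasurable
    · rw [Complex.norm_exp_ofReal_mul_I]
    · have := eventually_countable_forall.2 fun i =>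
        hZ.ae_tendsto_stableIntegral hβ hα hα2 (hI i) (hg i)
      filter_upwards [this] with ω hω
      have hc : Continuous fun x : ℝ => Complex.exp ((x : ℂ) * Complex.I) := by fun_prop
      exact (hc.tendsto _).comp (tendsto_finsetSum _ fun i _ => (hω i).const_mul (t i))
  have l2 := tendsto_finsetProd Finset.univ fun i _ =>
    hZ.tendsto_charFun_simpleStableIntegral hβ hα hα2 (hI i) (hg i) (t i)
  refine tendsto_nhds_unique l1 (l2.congr fun n => ?_)
  refine (hZ.integral_exp_sum_simpleStableIntegral
    (fun i => simpleFunc_measure_lt_top hα0 ((hg i).1 n)) (fun i i' hne x => ?_) t).symm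
  by_cases hx : x ∈ S i
  · exact Or.inr (hgS i' n x fun hx' => (disjoint_left.1 (hd hne)) hx hx')
  · exact Or.inl (hgS i n x hx)

end IsStableRandomMeasure

/-! ### Lower bounds for tails -/

/-- A probability measure whose characteristic function `φ` satisfies
`|φ(θ)| ≤ exp(-N |θ|^α)` and `|1 - φ(θ)| ≤ S |θ|^α`, with `α < 2`, has tails of exact order `α`:
the truncated second moment at level `r`, of order at most `r^(2-α)`, cannot by itself make
`1 - Re φ(κ/r)` of order `(κ/r)^α` when `κ` is small, so that the tail beyond `r` must contribute. -/
lemma exists_le_measureReal_abs_gt {α N S : ℝ} (hα : 0 < α) (hα2 : α < 2) (hN : 0 < N)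
    (hS : 0 ≤ S) : ∃ c, 0 < c ∧ ∀ (μ : Measure ℝ) [IsProbabilityMeasure μ],
      (∀ θ, ‖charFun μ θ‖ ≤ Real.exp (-(|θ| ^ α * N))) →
      (∀ θ, ‖1 - charFun μ θ‖ ≤ S * |θ| ^ α) →
      ∀ r, 0 < r → N ≤ r ^ α → c * r ^ (-α) ≤ μ.real {x | r < |x|} := by
  -- chosen such that `κ^2 S ≤ κ^α N / 12`, which makes the term `3 κ^2 S` below at most `κ^α N / 4`
  set κ : ℝ := min 1 ((N / (12 * (S + 1))) ^ (1 / (2 - α))) with hκ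
  have hκ0 : 0 < κ := lt_min one_pos (by positivity)
  have hκ1 : κ ≤ 1 := min_le_left _ _
  have hκS : κ ^ (2 : ℕ) * S ≤ κ ^ α * (N / 12) := by
    have h1 : κ ^ (2 - α) ≤ N / (12 * (S + 1)) := by
      calc κ ^ (2 - α) ≤ ((N / (12 * (S + 1))) ^ (1 / (2 - α))) ^ (2 - α) :=
            Real.rpow_le_rpow hκ0.le (min_le_right _ _) (by linarith)
        _ = _ := by
            rw [← Real.rpow_mul (by positivity), one_div, inv_mul_cancel₀ (by linarith),
              Real.rpow_one]
    have h2 : κ ^ (2 : ℕ) = κ ^ α * κ ^ (2 - α) := by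
      rw [← Real.rpow_add hκ0, ← Real.rpow_natCast]; norm_num
    have h3 : κ ^ (2 - α) * S ≤ N / 12 := by
      calc κ ^ (2 - α) * S ≤ N / (12 * (S + 1)) * (S + 1) := by gcongr; linarith
        _ = N / 12 := by field_simp
    rw [h2, mul_assoc]
    gcongr
  refine ⟨N * κ ^ α / 8, by positivity, fun μ _ h1 h2 r hr hNr => ?_⟩
  have hint : ∀ t : ℝ, Integrable (fun x => 1 - Real.cos (t * x)) μ := fun t => by
    refine Integrable.of_bound (C := 2) (by fun_prop) (Eventually.of_forall fun x => ?_)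
    rw [Real.norm_eq_abs, abs_le]
    constructor <;> linarith [Real.cos_le_one (t * x), Real.neg_one_le_cos (t * x)]
  have hre : ∀ t : ℝ, ∫ x, (1 - Real.cos (t * x)) ∂μ = (1 - charFun μ t).re := fun t => by
    have e : Integrable (fun x : ℝ => Complex.exp (t * x * Complex.I)) μ := by
      refine Integrable.of_bound (C := 1) (by fun_prop) (Eventually.of_forall fun x => ?_)
      rw [← Complex.ofReal_mul, Complex.norm_exp_ofReal_mul_I]
    have e2 : Integrable (fun x : ℝ => Real.cos (t * x)) μ := by
      refine ((integrable_const (1 : ℝ)).sub (hint t)).congr (Eventually.of_forall fun x => ?_)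
      simp
    rw [Complex.sub_re, Complex.one_re, charFun_apply_real,
      integral_sub (integrable_const _) e2]
    have := integral_re e
    simp only [RCLike.re_to_complex] at this
    rw [← this]
    simp only [integral_const, probReal_univ, smul_eq_mul, mul_one]
    congr 1
    refine integral_congr_ae (Eventually.of_forall fun x => ?_)
    simp only
    rw [← Complex.ofReal_mul, Complex.exp_ofReal_mul_I_re]
  have hθ : 0 < κ / r := div_pos hκ0 hr
  have hpow : (κ / r) ^ α = κ ^ α * r ^ (-α) := by
    rw [Real.div_rpow hκ0.le hr.le, Real.rpow_neg hr.le, div_eq_mul_inv]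
  have hrα : r ^ (-α) * N ≤ 1 := by
    rw [Real.rpow_neg hr.le, inv_mul_le_one₀ (by positivity)]; exact hNr
  have lower : κ ^ α * r ^ (-α) * N / 2 ≤ ∫ x, (1 - Real.cos (κ / r * x)) ∂μ := by
    rw [hre, Complex.sub_re, Complex.one_re]
    have h3 := (Complex.re_le_norm _).trans (h1 (κ / r))
    rw [abs_of_pos hθ, hpow] at h3
    set y := κ ^ α * r ^ (-α) * N with hy
    have hy0 : 0 ≤ y := by positivity
    have hy1 : y ≤ 1 := by
      rw [hy, mul_assoc]
      exact mul_le_one₀ (Real.rpow_le_one hκ0.le hκ1 hα.le) (by positivity) hrα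
    have h4 : Real.exp (-y) ≤ 1 - y / 2 := by
      have h5 : 1 + y ≤ Real.exp y := by linarith [Real.add_one_le_exp y]
      rw [Real.exp_neg, inv_le_iff_one_le_mul₀ (Real.exp_pos y)]
      nlinarith
    linarith
  have upper : ∫ x, (1 - Real.cos (r⁻¹ * x)) ∂μ ≤ S * r ^ (-α) := by
    rw [hre]
    refine (Complex.re_le_norm _).trans ((h2 _).trans_eq ?_)
    rw [abs_of_pos (inv_pos.2 hr), Real.inv_rpow hr.le, Real.rpow_neg hr.le]
  have hm : MeasurableSet {x : ℝ | r < |x|} := measurableSet_lt (by fun_prop) (by fun_prop)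
  have hind : Integrable (indicator {x : ℝ | r < |x|} fun _ => (2 : ℝ)) μ :=
    (integrable_const _).indicator hm
  -- for `|x| ≤ r` the quadratic bounds on the cosine give `1 - cos(κ x / r) ≤ 3 κ^2 (1 - cos(x / r))`
  have split : ∫ x, (1 - Real.cos (κ / r * x)) ∂μ ≤
      2 * μ.real {x | r < |x|} + 3 * κ ^ 2 * ∫ x, (1 - Real.cos (r⁻¹ * x)) ∂μ := by
    have e : ∫ x, indicator {x : ℝ | r < |x|} (fun _ => (2 : ℝ)) x ∂μ =
        2 * μ.real {x | r < |x|} := by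
      rw [integral_indicator hm, setIntegral_const, smul_eq_mul, mul_comm]
    rw [← e, ← integral_const_mul, ← integral_add hind ((hint _).const_mul _)]
    refine integral_mono (hint _) (hind.add ((hint _).const_mul _)) fun x => ?_
    have p1 : 0 ≤ 1 - Real.cos (r⁻¹ * x) := by linarith [Real.cos_le_one (r⁻¹ * x)]
    by_cases hx : x ∈ {x : ℝ | r < |x|}
    · simp only [indicator_of_mem hx]
      have := Real.neg_one_le_cos (κ / r * x)
      have : 0 ≤ 3 * κ ^ 2 * (1 - Real.cos (r⁻¹ * x)) := by positivity
      linarith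
    · simp only [indicator_of_notMem hx, zero_add]
      have hx' : |r⁻¹ * x| ≤ 1 := by
        rw [abs_mul, abs_of_pos (inv_pos.2 hr), inv_mul_le_one₀ hr]
        exact not_lt.1 hx
      have q1 := Real.cos_le_one_sub_mul_cos_sq (hx'.trans (by linarith [Real.pi_gt_three]))
      have q2 := Real.one_sub_sq_div_two_le_cos (x := κ / r * x)
      have q3 : (1 : ℝ) / 6 ≤ 2 / Real.pi ^ 2 := by
        rw [div_le_div_iff₀ (by norm_num) (by positivity)]
        nlinarith [Real.pi_lt_d2, Real.pi_pos]
      have q4 : 1 / 6 * (r⁻¹ * x) ^ 2 ≤ 1 - Real.cos (r⁻¹ * x) := by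
        have := mul_le_mul_of_nonneg_right q3 (sq_nonneg (r⁻¹ * x))
        linarith
      calc 1 - Real.cos (κ / r * x) ≤ (κ / r * x) ^ 2 / 2 := by linarith
        _ = 3 * κ ^ 2 * (1 / 6 * (r⁻¹ * x) ^ 2) := by rw [div_eq_mul_inv κ r]; ring
        _ ≤ _ := by gcongr
  have hfin : 3 * κ ^ 2 * ∫ x, (1 - Real.cos (r⁻¹ * x)) ∂μ ≤ κ ^ α * r ^ (-α) * N / 4 := by
    calc _ ≤ 3 * κ ^ 2 * (S * r ^ (-α)) := by gcongr
      _ = 3 * (κ ^ 2 * S) * r ^ (-α) := by ring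
      _ ≤ 3 * (κ ^ α * (N / 12)) * r ^ (-α) := by gcongr
      _ = _ := by ring
  have : N * κ ^ α / 8 * r ^ (-α) = κ ^ α * r ^ (-α) * N / 8 := by ring
  linarith

/-! ### The laws of the wavelet coefficients -/

namespace IsCompactMotherWavelet

variable {ψ : ℝ → ℝ}

lemma memLp_comp_affine (hψ : IsCompactMotherWavelet ψ) (p : ℝ≥0∞) (j k : ℤ) :
    MemLp (fun s => ψ ((2 : ℝ) ^ j * s - k)) p := by
  have hc : Continuous fun s => ψ ((2 : ℝ) ^ j * s - k) := by
    have := hψ.contDiff.continuous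
    fun_prop
  refine hc.memLp_of_hasCompactSupport ?_
  have h2 : (2 : ℝ) ^ j ≠ 0 := by positivity
  exact hψ.hasCompactSupport.comp_homeomorph
    ((Homeomorph.mulLeft₀ _ h2).trans (Homeomorph.subRight (k : ℝ)))

lemma alphaEnergy_comp_affine (hψ : IsCompactMotherWavelet ψ) {α : ℝ} (hα : 0 < α) (j k : ℤ) :
    alphaEnergy α (fun s => ψ ((2 : ℝ) ^ j * s - k)) = ((2 : ℝ) ^ j)⁻¹ * ∫ s, |ψ s| ^ α := by
  rw [alphaEnergy_eq_integral hα (hψ.memLp_comp_affine _ j k)]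
  exact integral_comp_affine (fun s => |ψ s| ^ α) (by positivity) _

lemma integral_abs_rpow_pos (hψ : IsCompactMotherWavelet ψ) {α : ℝ} (hα : 0 < α) :
    0 < ∫ s, |ψ s| ^ α := by
  have hne : ∃ x, ψ x ≠ 0 := by
    by_contra! h
    have := hψ.integral_mul_eq 0 0 0 0
    simp [h] at this
  obtain ⟨x, hx⟩ := hne
  have hc : Continuous fun s => |ψ s| ^ α :=
    hψ.contDiff.continuous.abs.rpow_const fun _ => Or.inr hα.le
  refine hc.integral_pos_of_hasCompactSupport_nonneg_nonzero ?_ (fun s => by positivity)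
    (x := x) (by positivity)
  refine hψ.hasCompactSupport.comp_left (g := fun y => |y| ^ α) ?_
  simp [Real.zero_rpow hα.ne']

end IsCompactMotherWavelet

namespace IsStableRandomMeasure

variable {Ω : Type*} [MeasurableSpace Ω] {P : Measure Ω} [IsProbabilityMeasure P]
  {α : ℝ} {β : ℝ → ℝ} {Z : Set ℝ → Ω → ℝ} {ψ : ℝ → ℝ}

lemma isStableIntegral_wavelet (hZ : IsStableRandomMeasure P α β Z)
    (hβ : ∀ s, β s ∈ Icc (-1 : ℝ) 1) (hα : 1 ≤ α) (hα2 : α ≤ 2) (hψ : IsCompactMotherWavelet ψ)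
    (j k : ℤ) : IsStableIntegral P α Z (fun s => ψ ((2 : ℝ) ^ j * s - k))
      (stableIntegral P α Z fun s => ψ ((2 : ℝ) ^ j * s - k)) :=
  hZ.isStableIntegral_stableIntegral hβ hα hα2 (hψ.memLp_comp_affine _ j k)

lemma measurable_waveletCoeff (hZ : IsStableRandomMeasure P α β Z)
    (hβ : ∀ s, β s ∈ Icc (-1 : ℝ) 1) (hα : 1 ≤ α) (hα2 : α ≤ 2) (hψ : IsCompactMotherWavelet ψ)
    (j k : ℤ) : Measurable (waveletCoeff P α Z ψ j k) :=
  (hZ.isStableIntegral_wavelet hβ hα hα2 hψ j k).2.1.const_mul _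

lemma charFun_map_waveletCoeff (hZ : IsStableRandomMeasure P α β Z)
    (hβ : ∀ s, β s ∈ Icc (-1 : ℝ) 1) (hα : 1 ≤ α) (hα2 : α ≤ 2) (hψ : IsCompactMotherWavelet ψ)
    (j k : ℤ) (θ : ℝ) : charFun (P.map (waveletCoeff P α Z ψ j k)) θ =
      charFun (P.map (stableIntegral P α Z fun s => ψ ((2 : ℝ) ^ j * s - k)))
        (θ * (2 : ℝ) ^ ((j : ℝ) / α)) := by
  rw [charFun_map_eq_integral (hZ.measurable_waveletCoeff hβ hα hα2 hψ j k).aemeasurable,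
    charFun_map_eq_integral (hZ.isStableIntegral_wavelet hβ hα hα2 hψ j k).2.1.aemeasurable]
  simp only [waveletCoeff, mul_assoc]

/-- The factor `2^(j/α)` in `ε_{j,k}` makes the scale of its law independent of `j` and `k`. -/
lemma abs_rpow_mul_alphaEnergy_wavelet (hψ : IsCompactMotherWavelet ψ) (hα : 0 < α) (j k : ℤ)
    (θ : ℝ) : |θ * (2 : ℝ) ^ ((j : ℝ) / α)| ^ α *
      alphaEnergy α (fun s => ψ ((2 : ℝ) ^ j * s - k)) = |θ| ^ α * ∫ s, |ψ s| ^ α := by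
  rw [hψ.alphaEnergy_comp_affine hα, abs_mul, abs_of_pos (by positivity : (0:ℝ) < 2 ^ ((j : ℝ) / α)),
    Real.mul_rpow (abs_nonneg _) (by positivity), ← Real.rpow_mul (by norm_num),
    div_mul_cancel₀ _ hα.ne', Real.rpow_intCast]
  field_simp

lemma norm_charFun_waveletCoeff (hZ : IsStableRandomMeasure P α β Z)
    (hβ : ∀ s, β s ∈ Icc (-1 : ℝ) 1) (hα : 1 ≤ α) (hα2 : α ≤ 2) (hψ : IsCompactMotherWavelet ψ)
    (j k : ℤ) (θ : ℝ) : ‖charFun (P.map (waveletCoeff P α Z ψ j k)) θ‖ =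
      Real.exp (-(|θ| ^ α * ∫ s, |ψ s| ^ α)) := by
  rw [hZ.charFun_map_waveletCoeff hβ hα hα2 hψ, hZ.norm_charFun_stableIntegral hβ hα hα2
    (hZ.isStableIntegral_wavelet hβ hα hα2 hψ j k),
    abs_rpow_mul_alphaEnergy_wavelet hψ (by linarith)]

lemma norm_one_sub_charFun_waveletCoeff_le (hZ : IsStableRandomMeasure P α β Z)
    (hβ : ∀ s, β s ∈ Icc (-1 : ℝ) 1) (hα : 1 ≤ α) (hα2 : α ≤ 2) (hψ : IsCompactMotherWavelet ψ)
    (j k : ℤ) (θ : ℝ) : ‖1 - charFun (P.map (waveletCoeff P α Z ψ j k)) θ‖ ≤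
      (stableConst α * ∫ s, |ψ s| ^ α) * |θ| ^ α := by
  rw [hZ.charFun_map_waveletCoeff hβ hα hα2 hψ]
  refine (hZ.norm_one_sub_charFun_stableIntegral_le hβ hα hα2
    (hZ.isStableIntegral_wavelet hβ hα hα2 hψ j k) _).trans_eq ?_
  rw [abs_rpow_mul_alphaEnergy_wavelet hψ (by linarith)]
  ring

/-- The wavelet coefficients have uniformly a tail of order at most `α`. -/
lemma exists_measureReal_waveletCoeff_le (hZ : IsStableRandomMeasure P α β Z)
    (hβ : ∀ s, β s ∈ Icc (-1 : ℝ) 1) (hα : 1 ≤ α) (hα2 : α ≤ 2) (hψ : IsCompactMotherWavelet ψ) :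
    ∃ C, ∀ (j k : ℤ) (r : ℝ), 0 < r →
      P.real {ω | r < |waveletCoeff P α Z ψ j k ω|} ≤ C * r ^ (-α) := by
  refine ⟨8 * (stableConst α * ∫ s, |ψ s| ^ α), fun j k r hr => ?_⟩
  have hm := hZ.measurable_waveletCoeff hβ hα hα2 hψ j k
  have : IsProbabilityMeasure (P.map (waveletCoeff P α Z ψ j k)) :=
    Measure.isProbabilityMeasure_map hm.aemeasurable
  have h := measureReal_abs_gt_le_of_charFun (by linarith) hα2
    (mul_nonneg (stableConst_pos α).le (hψ.integral_abs_rpow_pos (by linarith : 0 < α)).le)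
    (hZ.norm_one_sub_charFun_waveletCoeff_le hβ hα hα2 hψ j k) hr
  rwa [map_measureReal_apply hm (measurableSet_lt (by fun_prop) (by fun_prop))] at h

/-- The wavelet coefficients have uniformly a tail of order at least `α`. -/
lemma exists_le_measureReal_waveletCoeff (hZ : IsStableRandomMeasure P α β Z)
    (hβ : ∀ s, β s ∈ Icc (-1 : ℝ) 1) (hα : 1 ≤ α) (hα2 : α < 2) (hψ : IsCompactMotherWavelet ψ) :
    ∃ c, 0 < c ∧ ∀ (j k : ℤ) (r : ℝ), 0 < r → (∫ s, |ψ s| ^ α) ≤ r ^ α →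
      c * r ^ (-α) ≤ P.real {ω | r < |waveletCoeff P α Z ψ j k ω|} := by
  have hN := hψ.integral_abs_rpow_pos (by linarith : 0 < α)
  obtain ⟨c, hc, h⟩ := exists_le_measureReal_abs_gt (by linarith : 0 < α) hα2 hN
    (mul_nonneg (stableConst_pos α).le hN.le)
  refine ⟨c, hc, fun j k r hr hNr => ?_⟩
  have hm := hZ.measurable_waveletCoeff hβ hα hα2.le hψ j k
  have : IsProbabilityMeasure (P.map (waveletCoeff P α Z ψ j k)) :=
    Measure.isProbabilityMeasure_map hm.aemeasurable
  have h1 := h _ (fun θ => (hZ.norm_charFun_waveletCoeff hβ hα hα2.le hψ j k θ).le)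
    (hZ.norm_one_sub_charFun_waveletCoeff_le hβ hα hα2.le hψ j k) r hr hNr
  rwa [map_measureReal_apply hm (measurableSet_lt (by fun_prop) (by fun_prop))] at h1

end IsStableRandomMeasure

/-! ### The growth of the wavelet coefficients -/

lemma summable_one_add_abs_int_rpow {s : ℝ} (hs : 1 < s) :
    Summable fun j : ℤ => (1 + |(j : ℝ)|) ^ (-s) := by
  have h : Summable fun n : ℕ => (1 + (n : ℝ)) ^ (-s) := by
    refine ((summable_nat_add_iff 1).2 (Real.summable_nat_rpow.2 (by linarith : -s < -1))).congr
      fun n => ?_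
    push_cast; ring_nf
  refine Summable.of_nat_of_neg ?_ ?_
  · simpa using h
  · simpa using h

lemma summable_one_add_inv_mul_log_rpow {s : ℝ} (hs : 1 < s) :
    Summable fun k : ℤ => (1 + |(k : ℝ)|)⁻¹ * Real.log (2 + |(k : ℝ)|) ^ (-s) := by
  have hl : ∀ x : ℝ, 0 ≤ x → 0 < Real.log (2 + x) := fun x hx => Real.log_pos (by linarith)
  have h : Summable fun n : ℕ => (1 + (n : ℝ))⁻¹ * Real.log (2 + (n : ℝ)) ^ (-s) := by
    have hn : ∀ n : ℕ, 0 < Real.log (2 + (n : ℝ)) := fun n => hl _ (by positivity)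
    refine (summable_condensed_iff_of_nonneg (fun n => ?_) fun m n _ hmn => ?_).1 ?_
    · have := hn n
      positivity
    · have := hn m
      have hmn' : (m : ℝ) ≤ n := by exact_mod_cast hmn
      have h1 : Real.log (2 + (n : ℝ)) ^ (-s) ≤ Real.log (2 + (m : ℝ)) ^ (-s) :=
        Real.rpow_le_rpow_of_nonpos this (Real.log_le_log (by positivity) (by linarith))
          (by linarith)
      have := hn n
      gcongr
    · have h2 : 0 < Real.log 2 := Real.log_pos (by norm_num)
      have hsum : Summable fun n : ℕ => (Real.log 2 / 2) ^ (-s) * (1 + (n : ℝ)) ^ (-s) := by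
        refine Summable.mul_left _ ?_
        refine ((summable_nat_add_iff 1).2
          (Real.summable_nat_rpow.2 (by linarith : -s < -1))).congr fun n => ?_
        push_cast; ring_nf
      refine Summable.of_nonneg_of_le (fun n => ?_) (fun n => ?_) hsum
      · have := hn (2 ^ n)
        positivity
      · have h3 : Real.log 2 / 2 * (1 + (n : ℝ)) ≤ Real.log (2 + ((2 ^ n : ℕ) : ℝ)) := by
          have e1 : (n : ℝ) * Real.log 2 ≤ Real.log (2 + ((2 ^ n : ℕ) : ℝ)) := by
            rw [← Real.log_pow]
            exact Real.log_le_log (by positivity) (by push_cast; linarith)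
          have e2 : Real.log 2 ≤ Real.log (2 + ((2 ^ n : ℕ) : ℝ)) :=
            Real.log_le_log (by norm_num) (by linarith [Nat.cast_nonneg (α := ℝ) (2 ^ n)])
          linarith
        rw [← Real.mul_rpow (by positivity) (by positivity)]
        have h4 : (2 : ℝ) ^ n * ((1 + ((2 ^ n : ℕ) : ℝ))⁻¹) ≤ 1 := by
          push_cast
          rw [mul_inv_le_iff₀ (by positivity)]
          linarith
        rw [← mul_assoc]
        refine (mul_le_mul h4 (Real.rpow_le_rpow_of_nonpos (by positivity) h3 (by linarith))
          (by have := hn (2 ^ n); positivity) zero_le_one).trans_eq (one_mul _)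
  refine Summable.of_nat_of_neg ?_ ?_
  · simpa using h
  · simpa using h

/-- The rate of growth of the coefficients `ε_{j,k}` in the event `slowGrowthEvent`. -/
noncomputable def growthRate (α η : ℝ) (p : ℤ × ℤ) : ℝ :=
  (1 + |(p.1 : ℝ)|) ^ (1 / α + η) * (1 + |(p.2 : ℝ)|) ^ (1 / α) *
    Real.log (2 + |(p.2 : ℝ)|) ^ (1 / α + η)

lemma log_two_add_abs_pos (x : ℝ) : 0 < Real.log (2 + |x|) :=
  Real.log_pos (by linarith [abs_nonneg x])

lemma growthRate_pos (α η : ℝ) (p : ℤ × ℤ) : 0 < growthRate α η p := by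
  have := log_two_add_abs_pos p.2
  unfold growthRate
  positivity

lemma summable_growthRate_rpow {α η : ℝ} (hα : 0 < α) (hη : 0 < η) :
    Summable fun p => growthRate α η p ^ (-α) := by
  have hs : 1 < 1 + α * η := by have := mul_pos hα hη; linarith
  refine ((summable_one_add_abs_int_rpow hs).mul_of_nonneg
    (summable_one_add_inv_mul_log_rpow hs) (fun j => by positivity) (fun k => ?_)).congr
    fun p => ?_
  · have := log_two_add_abs_pos k
    simp only [Pi.zero_apply]
    positivity
  · have h1 := log_two_add_abs_pos p.2
    have e1 : (1 / α + η) * -α = -(1 + α * η) := by field_simp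
    have e2 : 1 / α * -α = -1 := by field_simp
    unfold growthRate
    rw [Real.mul_rpow (by positivity) (by positivity), Real.mul_rpow (by positivity) (by positivity),
      ← Real.rpow_mul (by positivity), ← Real.rpow_mul (by positivity), ← Real.rpow_mul h1.le,
      e1, e2, Real.rpow_neg_one, mul_assoc]

lemma growthRate_le {α η η' : ℝ} (h : η' ≤ η) (p : ℤ × ℤ) :
    growthRate α η' p ≤ Real.log 2 ^ (η' - η) * growthRate α η p := by
  have hl := log_two_add_abs_pos p.2
  have h2 : Real.log 2 ≤ Real.log (2 + |(p.2 : ℝ)|) :=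
    Real.log_le_log (by norm_num) (by linarith [abs_nonneg (p.2 : ℝ)])
  have h3 : Real.log (2 + |(p.2 : ℝ)|) ^ (1 / α + η') ≤
      Real.log 2 ^ (η' - η) * Real.log (2 + |(p.2 : ℝ)|) ^ (1 / α + η) := by
    rw [show 1 / α + η' = (η' - η) + (1 / α + η) by ring, Real.rpow_add hl]
    refine mul_le_mul_of_nonneg_right ?_ (by positivity)
    exact Real.rpow_le_rpow_of_nonpos (Real.log_pos (by norm_num)) h2 (sub_nonpos.2 h)
  have h4 : (1 + |(p.1 : ℝ)|) ^ (1 / α + η') ≤ (1 + |(p.1 : ℝ)|) ^ (1 / α + η) :=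
    Real.rpow_le_rpow_of_exponent_le (by linarith [abs_nonneg (p.1 : ℝ)]) (by linarith)
  unfold growthRate
  calc _ ≤ (1 + |(p.1 : ℝ)|) ^ (1 / α + η) * (1 + |(p.2 : ℝ)|) ^ (1 / α) *
        (Real.log 2 ^ (η' - η) * Real.log (2 + |(p.2 : ℝ)|) ^ (1 / α + η)) := by gcongr
    _ = _ := by ring

namespace IsStableRandomMeasure

variable {Ω : Type*} [MeasurableSpace Ω] {P : Measure Ω} [IsProbabilityMeasure P]
  {α : ℝ} {β : ℝ → ℝ} {Z : Set ℝ → Ω → ℝ} {ψ : ℝ → ℝ}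

/-- By the Borel–Cantelli lemma only finitely many coefficients exceed their rate of growth. -/
lemma ae_finite_growthRate_lt (hZ : IsStableRandomMeasure P α β Z)
    (hβ : ∀ s, β s ∈ Icc (-1 : ℝ) 1) (hα : 1 ≤ α) (hα2 : α ≤ 2) (hψ : IsCompactMotherWavelet ψ)
    {η : ℝ} (hη : 0 < η) :
    ∀ᵐ ω ∂P, {p : ℤ × ℤ | growthRate α η p < |waveletCoeff P α Z ψ p.1 p.2 ω|}.Finite := by
  obtain ⟨C, hC⟩ := hZ.exists_measureReal_waveletCoeff_le hβ hα hα2 hψ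
  refine ae_finite_setOfPred_mem
    (s := fun p : ℤ × ℤ => {ω | growthRate α η p < |waveletCoeff P α Z ψ p.1 p.2 ω|}) ?_
  have hs := ((summable_growthRate_rpow (by linarith : 0 < α) hη).mul_left C).tsum_ofReal_ne_top
  refine ne_top_of_le_ne_top hs (ENNReal.tsum_le_tsum fun p => ?_)
  rw [← ofReal_measureReal]
  exact ENNReal.ofReal_le_ofReal (hC p.1 p.2 _ (growthRate_pos α η p))

theorem ae_mem_slowGrowthEvent (hZ : IsStableRandomMeasure P α β Z)
    (hβ : ∀ s, β s ∈ Icc (-1 : ℝ) 1) (hα : 1 ≤ α) (hα2 : α ≤ 2) (hψ : IsCompactMotherWavelet ψ) :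
    ∀ᵐ ω ∂P, ω ∈ slowGrowthEvent P α Z ψ := by
  have h := ae_all_iff.2 fun n : ℕ =>
    hZ.ae_finite_growthRate_lt hβ hα hα2 hψ (η := 1 / ((n : ℝ) + 1)) (by positivity)
  filter_upwards [h] with ω hω η hη
  obtain ⟨n, hn⟩ := exists_nat_one_div_lt hη
  set g := growthRate α (1 / ((n : ℝ) + 1)) with hg
  have hg0 : ∀ p, 0 < g p := growthRate_pos α _
  set F := (hω n).toFinset with hF
  set e : ℤ × ℤ → ℝ := fun p => |waveletCoeff P α Z ψ p.1 p.2 ω| with he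
  set C : ℝ := 1 + ∑ p ∈ F, e p / g p with hC
  have hterm : ∀ p, 0 ≤ e p / g p := fun p => div_nonneg (abs_nonneg _) (hg0 p).le
  -- the constant accounts for the finitely many exceptional coefficients
  have hC1 : 1 ≤ C := by have := Finset.sum_nonneg fun p (_ : p ∈ F) => hterm p; linarith
  have hbound : ∀ p, e p ≤ C * g p := fun p => by
    by_cases hp : g p < e p
    · have hpF : p ∈ F := by rw [hF, Set.Finite.mem_toFinset]; exact hp
      have h1 := Finset.single_le_sum (fun p _ => hterm p) hpF
      rw [← div_le_iff₀ (hg0 p)]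
      linarith
    · nlinarith [hg0 p]
  refine ⟨C * Real.log 2 ^ (1 / ((n : ℝ) + 1) - η), fun j k => (hbound (j, k)).trans ?_⟩
  have h2 := growthRate_le (α := α) hn.le (j, k)
  calc C * g (j, k) ≤ C * (Real.log 2 ^ (1 / ((n : ℝ) + 1) - η) * growthRate α η (j, k)) := by
        gcongr
    _ = _ := by unfold growthRate; ring

/-! ### Large wavelet coefficients near every point -/

/-- Coefficients whose translations are far apart are independent. -/
lemma iIndepFun_stableIntegral_wavelet (hZ : IsStableRandomMeasure P α β Z)
    (hβ : ∀ s, β s ∈ Icc (-1 : ℝ) 1) (hα : 1 ≤ α) (hα2 : α ≤ 2) (hψ : IsCompactMotherWavelet ψ)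
    {R : ℕ} (hR : ∀ x, (R : ℝ) < |x| → ψ x = 0) (j m : ℤ) (n : ℕ) :
    iIndepFun (fun i : Fin n =>
      stableIntegral P α Z fun s => ψ ((2 : ℝ) ^ j * s - (m + (2 * R + 1) * (i : ℕ) : ℤ))) P := by
  refine hZ.iIndepFun_stableIntegral hβ hα hα2
    (fun i => hZ.isStableIntegral_wavelet hβ hα hα2 hψ j _)
    (fun i => {s | |(2 : ℝ) ^ j * s - (m + (2 * R + 1) * (i : ℕ) : ℤ)| ≤ R})
    (fun i => measurableSet_le (by fun_prop) (by fun_prop))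
    (fun i x hx => hR _ (not_le.1 hx)) fun i i' hne => ?_
  refine disjoint_left.2 fun s hs hs' => hne ?_
  simp only [mem_ofPred_eq, abs_le] at hs hs'
  push_cast at hs hs'
  have hd : ∀ a b : ℕ, (2 * (R : ℝ) + 1) * a ≤ (2 * R + 1) * b + 2 * R → a ≤ b := fun a b hab => by
    by_contra! hlt
    have : (b : ℝ) + 1 ≤ a := by exact_mod_cast hlt
    have : (2 * (R : ℝ) + 1) * (b + 1) ≤ (2 * R + 1) * a := by gcongr
    linarith
  exact Fin.ext (le_antisymm (hd _ _ (by linarith [hs.1, hs.2, hs'.1, hs'.2]))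
    (hd _ _ (by linarith [hs.1, hs.2, hs'.1, hs'.2])))

/-- If each of `n` coefficients with distant translations exceeds `r` with probability at least
`q`, then all of them stay below `r` with probability at most `exp(-n q)`. -/
lemma measureReal_forall_waveletCoeff_le (hZ : IsStableRandomMeasure P α β Z)
    (hβ : ∀ s, β s ∈ Icc (-1 : ℝ) 1) (hα : 1 ≤ α) (hα2 : α ≤ 2) (hψ : IsCompactMotherWavelet ψ)
    {R : ℕ} (hR : ∀ x, (R : ℝ) < |x| → ψ x = 0) (j m : ℤ) (n : ℕ) {r q : ℝ}
    (hq : ∀ k : ℤ, q ≤ P.real {ω | r < |waveletCoeff P α Z ψ j k ω|}) :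
    P.real {ω | ∀ i < n, |waveletCoeff P α Z ψ j (m + (2 * R + 1) * (i : ℕ)) ω| ≤ r} ≤
      Real.exp (-(n * q)) := by
  have hind := hZ.iIndepFun_stableIntegral_wavelet hβ hα hα2 hψ hR j m n
  have hB : MeasurableSet {x : ℝ | |(2 : ℝ) ^ ((j : ℝ) / α) * x| ≤ r} :=
    measurableSet_le (by fun_prop) (by fun_prop)
  have h1 := hind.measure_inter_preimage_eq_mul Finset.univ
    (sets := fun _ => {x : ℝ | |(2 : ℝ) ^ ((j : ℝ) / α) * x| ≤ r}) fun _ _ => hB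
  have h2 : {ω | ∀ i < n, |waveletCoeff P α Z ψ j (m + (2 * R + 1) * (i : ℕ)) ω| ≤ r} =
      ⋂ i ∈ (Finset.univ : Finset (Fin n)), (stableIntegral P α Z fun s =>
        ψ ((2 : ℝ) ^ j * s - (m + (2 * R + 1) * (i : ℕ) : ℤ))) ⁻¹'
          {x : ℝ | |(2 : ℝ) ^ ((j : ℝ) / α) * x| ≤ r} := by
    ext ω
    simp only [mem_ofPred_eq, Finset.mem_univ, iInter_true, mem_iInter, mem_preimage]
    exact ⟨fun h i => h i i.2, fun h i hi => h ⟨i, hi⟩⟩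
  rw [h2, measureReal_def, h1, ENNReal.toReal_prod]
  have h3 : ∀ k : ℤ, (P ((stableIntegral P α Z fun s => ψ ((2 : ℝ) ^ j * s - k)) ⁻¹'
      {x : ℝ | |(2 : ℝ) ^ ((j : ℝ) / α) * x| ≤ r})).toReal ≤ Real.exp (-q) := fun k => by
    have hm := hZ.measurable_waveletCoeff hβ hα hα2 hψ j k
    have hms : MeasurableSet {ω | r < |waveletCoeff P α Z ψ j k ω|} :=
      measurableSet_lt measurable_const hm.abs
    have e : (stableIntegral P α Z fun s => ψ ((2 : ℝ) ^ j * s - k)) ⁻¹'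
        {x : ℝ | |(2 : ℝ) ^ ((j : ℝ) / α) * x| ≤ r} =
        {ω | r < |waveletCoeff P α Z ψ j k ω|}ᶜ := by
      ext ω; simp [waveletCoeff]
    rw [e, ← measureReal_def, probReal_compl_eq_one_sub hms]
    linarith [hq k, Real.add_one_le_exp (-q)]
  calc _ ≤ ∏ _i : Fin n, Real.exp (-q) :=
        Finset.prod_le_prod (fun _ _ => ENNReal.toReal_nonneg) fun i _ => h3 _
    _ = Real.exp (-(n * q)) := by
        rw [Finset.prod_const, Finset.card_univ, Fintype.card_fin, ← Real.exp_nat_mul]; ring_nf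

/-- Among the `2^j` coefficients of scale `j` near a given interval, some is of order almost
`2^(j/α)`, because each of them is of this order with a probability of order almost `2^(-j)`. -/
lemma ae_exists_large_waveletCoeff (hZ : IsStableRandomMeasure P α β Z)
    (hβ : ∀ s, β s ∈ Icc (-1 : ℝ) 1) (hα : 1 ≤ α) (hα2 : α < 2) (hψ : IsCompactMotherWavelet ψ)
    {p q : ℝ} (hpq : p < q) {C δ : ℝ} (hC : 0 < C) (hδ : 0 < δ) (hδα : δ < 1 / α) :
    ∀ᵐ ω ∂P, ∃ (j : ℕ) (k : ℤ), (k : ℝ) / 2 ^ j ∈ Icc p q ∧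
      C * 2 ^ ((j : ℝ) * (1 / α - δ)) < |waveletCoeff P α Z ψ j k ω| := by
  have hα0 : 0 < α := by linarith
  obtain ⟨c, hc, hlow⟩ := hZ.exists_le_measureReal_waveletCoeff hβ hα hα2 hψ
  obtain ⟨R, hR⟩ : ∃ R : ℕ, ∀ x, (R : ℝ) < |x| → ψ x = 0 := by
    obtain ⟨r, -, hr⟩ := exists_support_radius hψ.hasCompactSupport
    obtain ⟨R, hrR⟩ := exists_nat_ge r
    exact ⟨R, fun x hx => hr x (by linarith)⟩
  set D : ℝ := 2 * R + 1 with hD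
  have hD0 : 0 < D := by positivity
  set r : ℕ → ℝ := fun j => C * 2 ^ ((j : ℝ) * (1 / α - δ)) with hr
  have hr0 : ∀ j, 0 < r j := fun j => by positivity
  set n : ℕ → ℕ := fun j => ⌊(q - p) * 2 ^ j / D⌋₊ with hn
  set A : ℝ := c * C ^ (-α) with hA
  have hA0 : 0 < A := by positivity
  have hrα : ∀ j, r j ^ (-α) = C ^ (-α) * ((2 : ℝ) ^ (δ * α) ) ^ j * ((2 : ℝ) ^ j)⁻¹ := fun j => by
    rw [hr]
    simp only
    rw [Real.mul_rpow hC.le (by positivity), ← Real.rpow_mul (by norm_num),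
      ← Real.rpow_natCast, ← Real.rpow_mul (by norm_num), ← Real.rpow_natCast,
      ← Real.rpow_neg (by norm_num), mul_assoc (C ^ (-α)), ← Real.rpow_add (by norm_num)]
    congr 2
    field_simp
    ring
  set b : ℝ := (2 : ℝ) ^ (δ * α) with hb
  have hb1 : 1 < b := Real.one_lt_rpow (by norm_num) (by positivity)
  have hb2 : b ≤ 2 := by
    calc b ≤ 2 ^ (1 : ℝ) := Real.rpow_le_rpow_of_exponent_le (by norm_num)
          ((lt_div_iff₀ hα0).1 hδα).le
      _ = 2 := Real.rpow_one 2
  -- the expected number of large coefficients grows geometrically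
  have hnq : ∀ j, A * ((q - p) / D * b ^ j - 1) ≤ n j * (c * r j ^ (-α)) := fun j => by
    have h1 : (q - p) * 2 ^ j / D - 1 ≤ n j := (Nat.sub_one_lt_floor _).le
    have h2 : b ^ j * ((2 : ℝ) ^ j)⁻¹ ≤ 1 := by
      rw [← div_eq_mul_inv, div_le_one (by positivity)]
      exact pow_le_pow_left₀ (by positivity) hb2 j
    have h3 : 0 < b ^ j * ((2 : ℝ) ^ j)⁻¹ := by positivity
    calc A * ((q - p) / D * b ^ j - 1)
        ≤ A * ((q - p) / D * b ^ j - b ^ j * ((2 : ℝ) ^ j)⁻¹) := by gcongr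
      _ = ((q - p) * 2 ^ j / D - 1) * (A * (b ^ j * ((2 : ℝ) ^ j)⁻¹)) := by field_simp
      _ ≤ n j * (A * (b ^ j * ((2 : ℝ) ^ j)⁻¹)) := by gcongr
      _ = _ := by rw [hrα, hA]; ring
  set bad : Set Ω := {ω | ¬ ∃ (j : ℕ) (k : ℤ), (k : ℝ) / 2 ^ j ∈ Icc p q ∧
      C * 2 ^ ((j : ℝ) * (1 / α - δ)) < |waveletCoeff P α Z ψ j k ω|} with hbad
  have hrtop : Tendsto (fun j => r j ^ α) atTop atTop := by
    have h1 : Tendsto (fun j : ℕ => (C ^ α) * ((2 : ℝ) ^ (1 - δ * α)) ^ j) atTop atTop := by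
      refine (tendsto_pow_atTop_atTop_of_one_lt ?_).const_mul_atTop (by positivity)
      have := (lt_div_iff₀ hα0).1 hδα
      exact Real.one_lt_rpow (by norm_num) (by linarith)
    refine h1.congr fun j => ?_
    rw [hr]
    simp only
    rw [Real.mul_rpow hC.le (by positivity), ← Real.rpow_mul (by norm_num),
      ← Real.rpow_natCast, ← Real.rpow_mul (by norm_num)]
    congr 2
    field_simp
  have hev : ∀ᶠ j in atTop, P.real bad ≤ Real.exp (-(A * ((q - p) / D * b ^ j - 1))) := by
    filter_upwards [hrtop.eventually_ge_atTop (∫ s, |ψ s| ^ α)] with j hj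
    have h1 := hZ.measureReal_forall_waveletCoeff_le hβ hα hα2.le hψ hR j ⌈p * 2 ^ j⌉ (n j)
      (r := r j) (q := c * r j ^ (-α)) fun k => hlow j k (r j) (hr0 j) hj
    refine le_trans (measureReal_mono ?_) (h1.trans (Real.exp_le_exp.2 (neg_le_neg (hnq j))))
    intro ω hω i hi
    by_contra! hlt
    -- the translations `⌈p 2^j⌉ + D i` with `i < n j` correspond to dyadic points of `[p, q]`
    refine hω ⟨j, _, ?_, hlt⟩
    have h2 : (0 : ℝ) < 2 ^ j := by positivity
    rw [mem_Icc, le_div_iff₀ h2, div_le_iff₀ h2]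
    push_cast
    have c1 := Int.le_ceil (p * 2 ^ j)
    have c2 := (Int.ceil_lt_add_one (p * 2 ^ j)).le
    have c3 : (i : ℝ) + 1 ≤ (q - p) * 2 ^ j / D := by
      have : ((i + 1 : ℕ) : ℝ) ≤ n j := by exact_mod_cast hi
      push_cast at this
      exact this.trans (Nat.floor_le (div_nonneg (mul_nonneg (by linarith) h2.le) hD0.le))
    rw [le_div_iff₀ hD0] at c3
    have c4 : 0 ≤ D * (i : ℝ) := by positivity
    have c5 : 1 ≤ D := by rw [hD]; linarith [Nat.cast_nonneg (α := ℝ) R]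
    constructor
    · linarith
    · linarith
  have hlim : Tendsto (fun j : ℕ => Real.exp (-(A * ((q - p) / D * b ^ j - 1)))) atTop (𝓝 0) := by
    refine Real.tendsto_exp_neg_atTop_nhds_zero.comp (Tendsto.const_mul_atTop hA0 ?_)
    refine tendsto_atTop_add_const_right _ (-1) ?_
    exact (tendsto_pow_atTop_atTop_of_one_lt hb1).const_mul_atTop (div_pos (by linarith) hD0)
  have h0 : P.real bad = 0 := le_antisymm (ge_of_tendsto hlim hev) measureReal_nonneg
  rw [ae_iff]
  exact (measureReal_eq_zero_iff).1 h0

theorem ae_forall_exists_large_waveletCoeff (hZ : IsStableRandomMeasure P α β Z)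
    (hβ : ∀ s, β s ∈ Icc (-1 : ℝ) 1) (hα : 1 ≤ α) (hα2 : α < 2) (hψ : IsCompactMotherWavelet ψ) :
    ∀ᵐ ω ∂P, ∀ p q : ℚ, p < q → ∀ N C : ℕ, ∃ (j : ℕ) (k : ℤ), (k : ℝ) / 2 ^ j ∈ Icc (p : ℝ) q ∧
      (C : ℝ) * 2 ^ ((j : ℝ) * (1 / α - 1 / ((N : ℝ) + 1))) < |waveletCoeff P α Z ψ j k ω| := by
  simp only [ae_all_iff]
  intro p q hpq N C
  have hN : (0 : ℝ) ≤ N := Nat.cast_nonneg N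
  have hδα : 1 / ((N : ℝ) + 2) < 1 / α := one_div_lt_one_div_of_lt (by linarith) (by linarith)
  filter_upwards [hZ.ae_exists_large_waveletCoeff hβ hα hα2 hψ
    (by exact_mod_cast hpq : (p : ℝ) < q) (by positivity : (0 : ℝ) < C + 1)
    (by positivity : 0 < 1 / ((N : ℝ) + 2)) hδα] with ω ⟨j, k, hk, h⟩
  refine ⟨j, k, hk, lt_of_le_of_lt ?_ h⟩
  -- `N + 2` replaces `N + 1` since `1 / (N + 1) < 1 / α` fails for `N = 0`
  have h1 : 1 / ((N : ℝ) + 2) ≤ 1 / ((N : ℝ) + 1) :=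
    one_div_le_one_div_of_le (by linarith) (by linarith)
  gcongr
  · linarith
  · norm_num

end IsStableRandomMeasure

/-! ### The local Hölder exponent of the paths -/

theorem theorem8p1 {Ω : Type*} [MeasurableSpace Ω] (P : Measure Ω) [IsProbabilityMeasure P]
    (α : ℝ) (hα₁ : 1 < α) (hα₂ : α < 2)
    (β : ℝ → ℝ) (hβ_meas : Measurable β) (hβ : ∀ s, β s ∈ Icc (-1 : ℝ) 1)
    (Z : Set ℝ → Ω → ℝ) (hZ : IsStableRandomMeasure P α β Z)
    (ψ : ℝ → ℝ) (hψ : IsCompactMotherWavelet ψ)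
    (H : ℝ → ℝ) (hH : Continuous H)
    (Hlow Hhigh : ℝ) (hlow : 1 / α < Hlow) (hhigh : Hhigh < 1)
    (hH_mem : ∀ t, H t ∈ Icc Hlow Hhigh) :
    ∃ Ω₄ : Set Ω, MeasurableSet Ω₄ ∧ P Ω₄ = 1 ∧
      ∀ ω ∈ Ω₄,
        Continuous (fun t => lmsm P α Z ψ H t ω) ∧
        ∀ t₀ : ℝ, ENNReal.ofReal (1 / α) < localHolderExponent H t₀ →
          localHolderExponent (fun t => lmsm P α Z ψ H t ω) t₀ =
            ENNReal.ofReal (H t₀ - 1 / α) := by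
  have hα0 : 0 < α := by linarith
  have hae : ∀ᵐ ω ∂P, Continuous (fun t => lmsm P α Z ψ H t ω) ∧
      ∀ t₀ : ℝ, ENNReal.ofReal (1 / α) < localHolderExponent H t₀ →
        localHolderExponent (fun t => lmsm P α Z ψ H t ω) t₀ =
          ENNReal.ofReal (H t₀ - 1 / α) := by
    filter_upwards [hZ.ae_mem_slowGrowthEvent hβ hα₁.le hα₂.le hψ,
      hZ.ae_forall_exists_large_waveletCoeff hβ hα₁.le hα₂ hψ] with ω hω hlarge
    have hε : SlowlyGrowing α fun j k => waveletCoeff P α Z ψ j k ω := fun e he =>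
      exists_waveletCoeff_bound hα0 hω he
    have hY : (fun t => lmsm P α Z ψ H t ω) = fun t =>
        waveletSeries α ψ (fun j k => waveletCoeff P α Z ψ j k ω) t (H t) := by
      ext t
      unfold lmsm stableField
      rw [if_pos hω]
      rfl
    rw [hY]
    exact ⟨continuous_waveletSeries_comp hψ hε hα₁ hlow hhigh hH hH_mem, fun t₀ ht₀ =>
      le_antisymm
        (localHolderExponent_waveletSeries_le hψ hε hα₁ hα₂ hlow hhigh hH hH_mem hlarge ht₀)
        (le_localHolderExponent_waveletSeries hψ hε hα₁ hα₂ hlow hhigh hH hH_mem ht₀)⟩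
  -- the event of full measure above need not be measurable: pass to a measurable subset
  obtain ⟨N, hN, hNm, hN0⟩ := exists_measurable_superset_of_null (ae_iff.1 hae)
  refine ⟨Nᶜ, hNm.compl, (prob_compl_eq_one_iff hNm).2 hN0, fun ω hω => ?_⟩
  by_contra hcon
  exact hω (hN hcon)
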